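/- Let $\mathbb{T}=\mathbb{R}/\mathbb{Z}$ with Lebesgue measure (total mass $1$) and its standard metric $\operatorname{dist}$; functions on $\mathbb{T}$ are identified with $1$-periodic functions on $\mathbb{R}$. A dyadic interval is $I=[2^{-k}j,2^{-k}(j+1)]\subset\mathbb{T}$ with $k\ge 1$ and $0\le j<2^k$, and $|I|=2^{-k}$. Given constants $C_m>0$ $(m\ge 1)$, a family of smooth functions $\varphi_I:\mathbb{T}\to\mathbb{C}$, indexed by the dyadic intervals, is a $0$-mean adapted family with constants $(C_m)$ if $\int_{\mathbb{T}}\varphi_I=0$ for every $I$ and $$|\varphi_I(x)|\le C_m\Big(1+\frac{\operatorname{dist}(x,I)}{|I|}\Big)^{-m},\qquad |\varphi_I'(x)|\le \frac{C_m}{|I|}\Big(1+\frac{\operatorname{dist}(x,I)}{|I|}\Big)^{-m}$$ for all $I$, all $x\in\mathbb{T}$ and all integers $m\ge 1$. Put $\phi_I=|I|^{-1/2}\varphi_I$, $\langle g,h\rangle=\int_{\mathbb{T}}g\,\overline{h}$, and define the discrete Littlewood–Paley square function $$Sf(x)=\Big(\sum_I\frac{|\langle\phi_I,f\rangle|^2}{|I|}\,\chi_I(x)\Big)^{1/2},$$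 the sum being over all dyadic intervals. Theorem. For every $1<p<\infty$ and all constants $(C_m)_{m\ge1}$ there is a finite constant $K$, depending only on $p$ and $(C_m)$, such that for every $0$-mean adapted family $\{\varphi_I\}$ with constants $(C_m)$, the operator $S$ maps $L^p(\mathbb{T})$ into $L^p(\mathbb{T})$ and $$\|Sf\|_{L^p(\mathbb{T})}\le K\,\|f\|_{L^p(\mathbb{T})}\qquad\text{for all } f\in L^p(\mathbb{T}).$$ -/

import Mathlib

open MeasureTheory
open scoped ENNReal NNReal ContDiff ComplexConjugate

namespace LittlewoodPaley

/-- The closed dyadic interval `[2⁻ᵏ j, 2⁻ᵏ (j + 1)]` of the circle `ℝ / ℤ`, with `k ≥ 1`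
(the whole circle is not a dyadic interval). Taking `0 ≤ j < 2 ^ k` lists each of them once. -/
structure DyadicInterval where
  k : ℕ
  one_le_k : 1 ≤ k
  j : Fin (2 ^ k)

/-- The length `|I| = 2⁻ᵏ`. -/
noncomputable def DyadicInterval.length (I : DyadicInterval) : ℝ := ((2 : ℝ) ^ I.k)⁻¹

/-- The interval as a subset of the circle. -/
def DyadicInterval.toSet (I : DyadicInterval) : Set UnitAddCircle :=
  (fun t : ℝ => (t : UnitAddCircle)) ''
    Set.Icc ((I.j : ℕ) * I.length) (((I.j : ℕ) + 1) * I.length)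

/-- The `1`-periodic function on `ℝ` that corresponds to a function on the circle. -/
def periodicLift (φ : UnitAddCircle → ℂ) (t : ℝ) : ℂ := φ (t : UnitAddCircle)

/-- `φ` is smooth and adapted to the interval `I` with constants `C 1, C 2, …`. -/
structure IsAdapted (C : ℕ → ℝ) (I : DyadicInterval) (φ : UnitAddCircle → ℂ) : Prop where
  const_pos : ∀ m : ℕ, 1 ≤ m → 0 < C m
  smooth : ContDiff ℝ (∞ : ℕ∞ω) (periodicLift φ)
  bound : ∀ (m : ℕ), 1 ≤ m → ∀ x : UnitAddCircle,
    ‖φ x‖ ≤ C m * ((1 + Metric.infDist x I.toSet / I.length) ^ m)⁻¹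
  deriv_bound : ∀ (m : ℕ), 1 ≤ m → ∀ t : ℝ,
    ‖deriv (periodicLift φ) t‖ ≤
      C m * (1 / I.length) *
        ((1 + Metric.infDist (t : UnitAddCircle) I.toSet / I.length) ^ m)⁻¹

/-- A family indexed by the dyadic intervals is `0`-mean adapted with constants `C`: each member is
adapted to its own interval, with the same constants, and has integral zero. -/
structure IsZeroMeanAdaptedFamily (C : ℕ → ℝ)
    (φ : DyadicInterval → UnitAddCircle → ℂ) : Prop where
  adapted : ∀ I, IsAdapted C I (φ I)
  zero_mean : ∀ I, ∫ x, φ I x = 0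

/-- The `L²`-normalization `|I|^(-1/2) φ_I`. -/
noncomputable def normalized (φ : DyadicInterval → UnitAddCircle → ℂ) (I : DyadicInterval)
    (x : UnitAddCircle) : ℂ :=
  ((I.length ^ (-(1 / 2) : ℝ) : ℝ) : ℂ) * φ I x

/-- The pairing `⟨f, g⟩ = ∫ f ḡ` on the circle. -/
noncomputable def pairing (f g : UnitAddCircle → ℂ) : ℂ := ∫ x, f x * conj (g x)

/-- The discrete Littlewood–Paley square function
`S f (x) = (∑_I |⟨ϕ_I, f⟩|² / |I| χ_I(x))^(1/2)`, where `ϕ_I = |I|^(-1/2) φ_I`; it takes values in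
`[0, ∞]`. -/
noncomputable def squareFunction (φ : DyadicInterval → UnitAddCircle → ℂ)
    (f : UnitAddCircle → ℂ) (x : UnitAddCircle) : ℝ≥0∞ :=
  (∑' I : DyadicInterval,
    I.toSet.indicator
      (fun _ => ‖pairing (normalized φ I) f‖ₑ ^ 2 / ENNReal.ofReal I.length) x) ^ (1 / 2 : ℝ)

end LittlewoodPaley

/-! Outside a null set of endpoints, the square of the square function at `x` is a sum over scales
`k` of a single term `(2ᵏ |⟨ψ, f⟩|)²`, where `ψ` is the kernel of the half-open dyadic cell of
length `2⁻ᵏ` containing `x` (`squareFunction_ae_eq`). The proof uses only what `IsKernelFamily`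
records: cubic decay, a Lipschitz bound with quadratic decay, and mean zero. The case `m = 3` of the
adaptedness bounds supplies the first two.

`p = 2`: pairing two kernels, the mean zero of the finer one acts against the smoothness of the
coarser one. With weights `2^(k/2)` the rows of the Gram matrix decay like `2^(-|k-l|/2)` in the
scales, and Schur's test (`sum_sq_inner_le`) gives the bound.

`p > 2`: splitting `f` into a part near a cell and a part far from it localises the `L²` bound to a
packing estimate: the scales below a cell contribute to its integral at most a constant times the
integral over that cell of the maximal function of `|f|²`. If `S` is the sum of squares and `q =
p/2`, a discrete chain rule (`rpow_sum_le_sum_mul`) and summation by parts (`sum_lintegral_mul_le`)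
bound `∫ S^q` by `∫ S^(q-1) M(|f|²)`; Hölder and the maximal theorem finish.

`p < 2`: a Calderón–Zygmund decomposition at each height `t`, with the `L²` bound for the good part
and an `L¹` bound off the dilated cells for the bad part, gives `|{Sf > t}| ≤ C (|{M > t}| + t⁻²
∫_{M ≤ t} |f|²)`, where `M` is the dyadic maximal function of `|f|`. Integrating against `p t^(p-1)
dt` and using `|f| ≤ M` almost everywhere bounds everything by `∫ M^p`. Neither duality nor an
interpolation theorem is needed. -/

namespace LittlewoodPaley

/-! ### Half-open dyadic cells and their comparison with closed intervals -/

/-- The index of the half-open dyadic interval of length `2⁻ᵏ` that contains `x`. -/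
noncomputable def cellIndex (k : ℕ) (x : UnitAddCircle) : ℕ :=
  ⌊(2 : ℝ) ^ k * (AddCircle.equivIco (1 : ℝ) 0 x : ℝ)⌋₊

/-- The half-open dyadic interval `[2⁻ᵏ j, 2⁻ᵏ (j + 1))` of the circle. -/
def cell (k j : ℕ) : Set UnitAddCircle := {x | cellIndex k x = j}

/-- The left endpoint `2⁻ᵏ j` of a dyadic interval. -/
noncomputable def node (k j : ℕ) : UnitAddCircle := ((j / 2 ^ k : ℝ) : UnitAddCircle)

/-- The midpoint of a dyadic interval. -/
noncomputable def midpt (k j : ℕ) : UnitAddCircle :=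
  (((j + 1 / 2) / 2 ^ k : ℝ) : UnitAddCircle)

theorem cellIndex_lt (k : ℕ) (x : UnitAddCircle) : cellIndex k x < 2 ^ k := by
  have h := (AddCircle.equivIco (1 : ℝ) 0 x).2
  simp only [zero_add, Set.mem_Ico] at h
  unfold cellIndex
  rw [Nat.floor_lt (by have := h.1; positivity)]
  push_cast
  nlinarith [h.2, pow_pos (two_pos : (0 : ℝ) < 2) k]

theorem cellIndex_zero (x : UnitAddCircle) : cellIndex 0 x = 0 := by
  have := cellIndex_lt 0 x
  simpa using this

theorem cellIndex_add (k m : ℕ) (x : UnitAddCircle) :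
    cellIndex k x = cellIndex (k + m) x / 2 ^ m := by
  unfold cellIndex
  have : (2 : ℝ) ^ k * (AddCircle.equivIco (1 : ℝ) 0 x : ℝ)
      = ((2 : ℝ) ^ (k + m) * (AddCircle.equivIco (1 : ℝ) 0 x : ℝ)) / ((2 ^ m : ℕ) : ℝ) := by
    push_cast
    rw [pow_add]
    field_simp
  rw [this, Nat.floor_div_natCast]

theorem cellIndex_eq_of_le {k l : ℕ} (h : k ≤ l) {x y : UnitAddCircle}
    (hxy : cellIndex l x = cellIndex l y) : cellIndex k x = cellIndex k y := by
  obtain ⟨m, rfl⟩ := Nat.exists_eq_add_of_le h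
  rw [cellIndex_add k m x, cellIndex_add k m y, hxy]

theorem measurable_cellIndex (k : ℕ) : Measurable (cellIndex k) := by
  unfold cellIndex
  refine Nat.measurable_floor.comp (measurable_const.mul ?_)
  exact measurable_subtype_coe.comp (AddCircle.measurableEquivIco (1 : ℝ) 0).measurable

theorem measurableSet_cell (k j : ℕ) : MeasurableSet (cell k j) :=
  measurable_cellIndex k (measurableSet_singleton j)

theorem mem_cell_self (k : ℕ) (x : UnitAddCircle) : x ∈ cell k (cellIndex k x) := rfl

theorem exists_coe_of_mem_cell {k j : ℕ} {x : UnitAddCircle} (hx : x ∈ cell k j) :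
    ∃ t : ℝ, (t : UnitAddCircle) = x ∧ j / 2 ^ k ≤ t ∧ t < (j + 1) / 2 ^ k := by
  have h := (AddCircle.equivIco (1 : ℝ) 0 x).2
  simp only [zero_add, Set.mem_Ico] at h
  refine ⟨AddCircle.equivIco (1 : ℝ) 0 x, AddCircle.coe_equivIco, ?_⟩
  have hx' : cellIndex k x = j := hx
  unfold cellIndex at hx'
  have h2 : (0 : ℝ) < 2 ^ k := by positivity
  rw [Nat.floor_eq_iff (by have := h.1; positivity)] at hx'
  constructor
  · rw [div_le_iff₀ h2]; linarith [hx'.1]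
  · rw [lt_div_iff₀ h2]; linarith [hx'.2]

theorem dist_coe_le (s t : ℝ) : dist (s : UnitAddCircle) (t : UnitAddCircle) ≤ |s - t| := by
  rw [dist_eq_norm, ← AddCircle.coe_sub]
  exact (QuotientAddGroup.norm_mk_le_norm).trans_eq (Real.norm_eq_abs _)

theorem dist_node_le_of_mem {k j : ℕ} {x : UnitAddCircle} (hx : x ∈ cell k j) :
    dist x (node k j) ≤ ((2 : ℝ) ^ k)⁻¹ := by
  obtain ⟨t, rfl, h1, h2⟩ := exists_coe_of_mem_cell hx
  refine (dist_coe_le _ _).trans ?_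
  have : ((j : ℝ) + 1) / 2 ^ k = j / 2 ^ k + (2 ^ k)⁻¹ := by ring
  rw [abs_le]
  constructor <;> [skip; skip] <;> linarith [show (0 : ℝ) < ((2 : ℝ) ^ k)⁻¹ by positivity]

theorem dist_midpt_le {k j : ℕ} {x : UnitAddCircle} (hx : x ∈ cell k j) :
    dist x (midpt k j) ≤ ((2 : ℝ) ^ (k + 1))⁻¹ := by
  obtain ⟨t, rfl, h1, h2⟩ := exists_coe_of_mem_cell hx
  refine (dist_coe_le _ _).trans ?_
  have e1 : ((j : ℝ) + 1) / 2 ^ k = (j + 1 / 2) / 2 ^ k + (2 ^ (k + 1))⁻¹ := by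
    rw [pow_succ]; field_simp; ring
  have e2 : (j : ℝ) / 2 ^ k = (j + 1 / 2) / 2 ^ k - (2 ^ (k + 1))⁻¹ := by
    rw [pow_succ]; field_simp; ring
  rw [abs_le]
  constructor <;> linarith

theorem volume_closedBall_le (x : UnitAddCircle) (r : ℝ) :
    volume (Metric.closedBall x r) ≤ ENNReal.ofReal (2 * r) := by
  rw [AddCircle.volume_closedBall]
  exact ENNReal.ofReal_le_ofReal (min_le_right _ _)

theorem cell_subset_closedBall (k j : ℕ) :
    cell k j ⊆ Metric.closedBall (midpt k j) ((2 : ℝ) ^ (k + 1))⁻¹ :=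
  fun _ hx => dist_midpt_le hx

theorem ofReal_two_mul_inv (k : ℕ) :
    ENNReal.ofReal (2 * ((2 : ℝ) ^ (k + 1))⁻¹) = ((2 : ℝ≥0∞) ^ k)⁻¹ := by
  have : 2 * ((2 : ℝ) ^ (k + 1))⁻¹ = (2 ^ k)⁻¹ := by rw [pow_succ]; field_simp
  rw [this, ENNReal.ofReal_inv_of_pos (by positivity), ENNReal.ofReal_pow (by norm_num)]
  simp

theorem volume_closedBall_midpt_le (k j : ℕ) :
    volume (Metric.closedBall (midpt k j) ((2 : ℝ) ^ (k + 1))⁻¹) ≤ ((2 : ℝ≥0∞) ^ k)⁻¹ :=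
  (volume_closedBall_le _ _).trans_eq (ofReal_two_mul_inv k)

theorem pairwise_disjoint_cell (k : ℕ) : Pairwise (Function.onFun Disjoint (cell k)) := by
  intro i j hij
  refine Set.disjoint_left.2 fun x hi hj => hij ?_
  exact (show cellIndex k x = i from hi).symm.trans hj

theorem iUnion_cell (k : ℕ) : ⋃ j ∈ Finset.range (2 ^ k), cell k j = Set.univ := by
  refine Set.eq_univ_of_forall fun x => ?_
  simp only [Set.mem_iUnion, Finset.mem_range]
  exact ⟨_, cellIndex_lt k x, mem_cell_self k x⟩

theorem lintegral_eq_sum_cell (k : ℕ) (F : UnitAddCircle → ℝ≥0∞) :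
    ∫⁻ x, F x = ∑ j ∈ Finset.range (2 ^ k), ∫⁻ x in cell k j, F x := by
  rw [← lintegral_biUnion_finset (fun i _ j _ h => pairwise_disjoint_cell k h)
    (fun j _ => measurableSet_cell k j), iUnion_cell, Measure.restrict_univ]

/-- Each cell lies in a ball of measure at most `2⁻ᵏ`, and the `2ᵏ` cells together have mass one, so
none of them can fall short of `2⁻ᵏ`. -/
theorem volume_cell {k j : ℕ} (hj : j < 2 ^ k) : volume (cell k j) = ((2 : ℝ≥0∞) ^ k)⁻¹ := by
  have hle : ∀ i, volume (cell k i) ≤ ((2 : ℝ≥0∞) ^ k)⁻¹ := fun i =>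
    (measure_mono (cell_subset_closedBall k i)).trans (volume_closedBall_midpt_le k i)
  refine le_antisymm (hle j) ?_
  have h1 : (1 : ℝ≥0∞) = ∑ i ∈ Finset.range (2 ^ k), volume (cell k i) := by
    have := lintegral_eq_sum_cell k (fun _ => 1)
    simpa using this
  rw [← Finset.add_sum_erase _ _ (Finset.mem_range.2 hj)] at h1
  have h2 : ∑ i ∈ (Finset.range (2 ^ k)).erase j, volume (cell k i)
      ≤ ((2 ^ k - 1 : ℕ) : ℝ≥0∞) * ((2 : ℝ≥0∞) ^ k)⁻¹ := by
    refine (Finset.sum_le_sum fun i _ => hle i).trans_eq ?_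
    rw [Finset.sum_const, Finset.card_erase_of_mem (Finset.mem_range.2 hj), Finset.card_range,
      nsmul_eq_mul]
  have h3 : (1 : ℝ≥0∞) = ((2 : ℝ≥0∞) ^ k)⁻¹ + ((2 ^ k - 1 : ℕ) : ℝ≥0∞) * ((2 : ℝ≥0∞) ^ k)⁻¹ := by
    rw [← one_add_mul]
    have : (1 : ℝ≥0∞) + ((2 ^ k - 1 : ℕ) : ℝ≥0∞) = 2 ^ k := by
      have h : 1 + (2 ^ k - 1) = 2 ^ k := by have := Nat.one_le_two_pow (n := k); omega
      exact_mod_cast h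
    rw [this, ENNReal.mul_inv_cancel (by positivity) (by finiteness)]
  have hfin : ((2 ^ k - 1 : ℕ) : ℝ≥0∞) * ((2 : ℝ≥0∞) ^ k)⁻¹ ≠ ⊤ :=
    ENNReal.mul_ne_top (by finiteness) (ENNReal.inv_ne_top.2 (by positivity))
  have h4 : ((2 : ℝ≥0∞) ^ k)⁻¹ + ((2 ^ k - 1 : ℕ) : ℝ≥0∞) * ((2 : ℝ≥0∞) ^ k)⁻¹
      ≤ volume (cell k j) + ((2 ^ k - 1 : ℕ) : ℝ≥0∞) * ((2 : ℝ≥0∞) ^ k)⁻¹ := by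
    rw [← h3, h1]; gcongr
  exact (ENNReal.add_le_add_iff_right hfin).1 h4

theorem cell_ae_eq_closedBall {k j : ℕ} (hj : j < 2 ^ k) :
    cell k j =ᵐ[volume] Metric.closedBall (midpt k j) ((2 : ℝ) ^ (k + 1))⁻¹ := by
  refine ae_eq_of_subset_of_measure_ge (cell_subset_closedBall k j) ?_
    (measurableSet_cell k j).nullMeasurableSet (measure_ne_top _ _)
  rw [volume_cell hj]
  exact volume_closedBall_midpt_le k j

theorem DyadicInterval.length_pos (I : DyadicInterval) : 0 < I.length := by
  unfold length; positivity

theorem cell_subset_toSet (I : DyadicInterval) : cell I.k I.j ⊆ I.toSet := by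
  intro x hx
  obtain ⟨t, rfl, h1, h2⟩ := exists_coe_of_mem_cell hx
  refine ⟨t, ⟨?_, ?_⟩, rfl⟩
  · simpa [DyadicInterval.length, div_eq_mul_inv] using h1
  · simpa [DyadicInterval.length, div_eq_mul_inv] using h2.le

theorem toSet_subset_closedBall (I : DyadicInterval) :
    I.toSet ⊆ Metric.closedBall (midpt I.k I.j) ((2 : ℝ) ^ (I.k + 1))⁻¹ := by
  rintro _ ⟨t, ⟨h1, h2⟩, rfl⟩
  refine (dist_coe_le _ _).trans ?_
  unfold DyadicInterval.length at h1 h2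
  have e1 : (((I.j : ℕ) : ℝ) + 1) * ((2 : ℝ) ^ I.k)⁻¹
      = (((I.j : ℕ) : ℝ) + 1 / 2) / 2 ^ I.k + (2 ^ (I.k + 1))⁻¹ := by
    rw [pow_succ]; field_simp; ring
  have e2 : ((I.j : ℕ) : ℝ) * ((2 : ℝ) ^ I.k)⁻¹
      = (((I.j : ℕ) : ℝ) + 1 / 2) / 2 ^ I.k - (2 ^ (I.k + 1))⁻¹ := by
    rw [pow_succ]; field_simp; ring
  rw [abs_le]
  constructor <;> linarith

/-- The closed interval is squeezed between the cell and a closed ball about the midpoint, and these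
two have equal measure. -/
theorem toSet_ae_eq_cell (I : DyadicInterval) : I.toSet =ᵐ[volume] cell I.k I.j := by
  have h := cell_ae_eq_closedBall I.j.2
  refine Filter.EventuallyLE.antisymm ?_ (cell_subset_toSet I).eventuallyLE
  exact ((toSet_subset_closedBall I).eventuallyLE).trans h.symm.le

theorem dist_le_of_mem_toSet {I : DyadicInterval} {x : UnitAddCircle} (hx : x ∈ I.toSet) :
    dist x (node I.k I.j) ≤ I.length := by
  obtain ⟨t, ⟨h1, h2⟩, rfl⟩ := hx
  refine (dist_coe_le _ _).trans ?_
  rw [div_eq_mul_inv]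
  change |t - (I.j : ℕ) * I.length| ≤ I.length
  rw [abs_le]
  constructor <;> nlinarith [I.length_pos]

theorem toSet_nonempty (I : DyadicInterval) : I.toSet.Nonempty :=
  ⟨_, _, Set.left_mem_Icc.2 (by nlinarith [I.length_pos]), rfl⟩

theorem dist_node_le_infDist_add (I : DyadicInterval) (x : UnitAddCircle) :
    dist x (node I.k I.j) ≤ Metric.infDist x I.toSet + I.length := by
  rw [← sub_le_iff_le_add, Metric.le_infDist (toSet_nonempty I)]
  intro y hy
  have := dist_triangle x y (node I.k I.j)
  linarith [dist_le_of_mem_toSet hy]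

/-! ### Decay factors and bumps -/

/-- The decay factor `(1 + 2ᵏ dist (x, c))⁻¹`. -/
noncomputable def decay (k : ℕ) (x c : UnitAddCircle) : ℝ := (1 + 2 ^ k * dist x c)⁻¹

theorem decay_pos (k : ℕ) (x c : UnitAddCircle) : 0 < decay k x c := by
  unfold decay; positivity

theorem decay_le_one (k : ℕ) (x c : UnitAddCircle) : decay k x c ≤ 1 := by
  unfold decay
  exact inv_le_one_of_one_le₀ (by linarith [show 0 ≤ 2 ^ k * dist x c by positivity])

theorem decay_comm (k : ℕ) (x c : UnitAddCircle) : decay k x c = decay k c x := by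
  unfold decay; rw [dist_comm]

theorem continuous_decay (k : ℕ) : Continuous fun z : UnitAddCircle × UnitAddCircle =>
    decay k z.1 z.2 := by
  unfold decay
  refine Continuous.inv₀ (by fun_prop) fun z => ?_
  positivity

theorem dist_mul_decay_le (k : ℕ) (x c : UnitAddCircle) :
    dist x c * decay k x c ≤ (2 ^ k)⁻¹ := by
  unfold decay
  have h : 0 ≤ dist x c := dist_nonneg
  have h2 : (0 : ℝ) < 2 ^ k := by positivity
  rw [← div_eq_mul_inv, div_le_iff₀ (by positivity)]
  field_simp
  linarith

/-- Moving one argument by at most `2⁻ᵏ` changes the decay factor by a factor of at most two. -/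
theorem decay_le_two_mul {k : ℕ} {x c c' : UnitAddCircle} (h : dist c c' ≤ ((2 : ℝ) ^ k)⁻¹) :
    decay k x c ≤ 2 * decay k x c' := by
  unfold decay
  rw [← div_eq_mul_inv, le_div_iff₀ (by positivity), inv_mul_le_iff₀ (by positivity)]
  have h2 : (0 : ℝ) < 2 ^ k := by positivity
  have h3 : 2 ^ k * dist c c' ≤ 1 := by
    calc 2 ^ k * dist c c' ≤ 2 ^ k * ((2 : ℝ) ^ k)⁻¹ := by gcongr
      _ = 1 := by field_simp
  have := mul_le_mul_of_nonneg_left (dist_triangle x c c') h2.le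
  nlinarith [show 0 ≤ 2 ^ k * dist x c by positivity]

/-- The square of the decay factor, as an extended nonnegative real. -/
noncomputable def bump (k : ℕ) (x c : UnitAddCircle) : ℝ≥0∞ := ENNReal.ofReal (decay k x c ^ 2)

theorem bump_comm (k : ℕ) (x c : UnitAddCircle) : bump k x c = bump k c x := by
  unfold bump; rw [decay_comm]

theorem bump_ne_top (k : ℕ) (x c : UnitAddCircle) : bump k x c ≠ ⊤ := ENNReal.ofReal_ne_top

theorem bump_le_four_mul {k : ℕ} {x c c' : UnitAddCircle} (h : dist c c' ≤ ((2 : ℝ) ^ k)⁻¹) :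
    bump k x c ≤ 4 * bump k x c' := by
  unfold bump
  rw [show (4 : ℝ≥0∞) = ENNReal.ofReal 4 by simp, ← ENNReal.ofReal_mul (by norm_num)]
  refine ENNReal.ofReal_le_ofReal ?_
  have := decay_le_two_mul (x := x) h
  nlinarith [decay_pos k x c, decay_pos k x c']

theorem continuous_bump (k : ℕ) :
    Continuous fun z : UnitAddCircle × UnitAddCircle => bump k z.1 z.2 :=
  ENNReal.continuous_ofReal.comp ((continuous_decay k).pow 2)

theorem measurable_bump_left (k : ℕ) (c : UnitAddCircle) : Measurable fun x => bump k x c :=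
  ((continuous_bump k).comp (Continuous.prodMk_left c)).measurable

/-! ### The Hardy–Littlewood maximal theorem -/

/-- The centered Hardy–Littlewood maximal function along the radii `2⁻ⁿ`. -/
noncomputable def maximalFn (F : UnitAddCircle → ℝ≥0∞) (x : UnitAddCircle) : ℝ≥0∞ :=
  ⨆ n : ℕ, 2 ^ n * ∫⁻ y in Metric.closedBall x ((2 : ℝ) ^ n)⁻¹, F y

theorem measurable_maximalFn {F : UnitAddCircle → ℝ≥0∞} (hF : Measurable F) :
    Measurable (maximalFn F) := by
  refine Measurable.iSup fun n => measurable_const.mul ?_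
  have h : ∀ x, ∫⁻ y in Metric.closedBall x ((2 : ℝ) ^ n)⁻¹, F y
      = ∫⁻ y, {z : UnitAddCircle × UnitAddCircle | dist z.2 z.1 ≤ ((2 : ℝ) ^ n)⁻¹}.indicator
        (fun z => F z.2) (x, y) := by
    intro x
    rw [← lintegral_indicator Metric.isClosed_closedBall.measurableSet]
    rfl
  simp_rw [h]
  refine Measurable.lintegral_prod_right' ?_
  refine (hF.comp measurable_snd).indicator ?_
  exact (isClosed_le (by fun_prop) continuous_const).measurableSet

theorem le_maximalFn (F : UnitAddCircle → ℝ≥0∞) (x : UnitAddCircle) (n : ℕ) :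
    2 ^ n * ∫⁻ y in Metric.closedBall x ((2 : ℝ) ^ n)⁻¹, F y ≤ maximalFn F x :=
  le_iSup (fun n : ℕ => 2 ^ n * ∫⁻ y in Metric.closedBall x ((2 : ℝ) ^ n)⁻¹, F y) n

theorem setLIntegral_closedBall_le (F : UnitAddCircle → ℝ≥0∞) (x : UnitAddCircle) (n : ℕ) :
    ∫⁻ y in Metric.closedBall x ((2 : ℝ) ^ n)⁻¹, F y ≤ (2 ^ n)⁻¹ * maximalFn F x := by
  rw [← ENNReal.mul_le_iff_le_inv (by positivity) (by finiteness)]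
  exact le_maximalFn F x n

theorem ofReal_two_pow_inv (n : ℕ) : ENNReal.ofReal ((2 : ℝ) ^ n)⁻¹ = ((2 : ℝ≥0∞) ^ n)⁻¹ := by
  rw [ENNReal.ofReal_inv_of_pos (by positivity), ENNReal.ofReal_pow (by norm_num)]
  simp

/-- The weak-type `(1, 1)` inequality for the maximal function. -/
theorem mul_measure_maximalFn_gt_le (F : UnitAddCircle → ℝ≥0∞) (t : ℝ≥0∞) :
    t * volume {x | t < maximalFn F x} ≤ 10 * ∫⁻ y, F y := by
  have hex : ∀ x ∈ {x | t < maximalFn F x}, ∃ n : ℕ,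
      t * (2 ^ n)⁻¹ ≤ ∫⁻ y in Metric.closedBall x ((2 : ℝ) ^ n)⁻¹, F y := by
    intro x hx
    obtain ⟨n, hn⟩ := lt_iSup_iff.1 (show t < maximalFn F x from hx)
    refine ⟨n, ?_⟩
    rw [mul_comm, ENNReal.inv_mul_le_iff (by positivity) (by finiteness)]
    exact hn.le
  choose! n hn using hex
  -- Vitali covering with fivefold enlargement; the constant `10` is the length bound `2 · 5` of an
  -- enlarged ball relative to its original radius.
  obtain ⟨u, hu, hdisj, hcov⟩ := Vitali.exists_disjoint_subfamily_covering_enlargement_closedBall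
    {x | t < maximalFn F x} id (fun x => ((2 : ℝ) ^ n x)⁻¹) 1
    (fun x _ => inv_le_one_of_one_le₀ (one_le_pow₀ (by norm_num))) 5 (by norm_num)
  have hcount : u.Countable := by
    refine hdisj.countable_of_nonempty_interior fun x _ => ⟨x, ?_⟩
    exact Metric.ball_subset_interior_closedBall (Metric.mem_ball_self (by positivity))
  have hsub : {x | t < maximalFn F x} ⊆ ⋃ b ∈ u, Metric.closedBall b (5 * ((2 : ℝ) ^ n b)⁻¹) := by
    intro x hx
    obtain ⟨b, hb, hxb⟩ := hcov x hx
    exact Set.mem_biUnion hb (hxb (Metric.mem_closedBall_self (by positivity)))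
  calc t * volume {x | t < maximalFn F x}
      ≤ t * ∑' b : u, volume (Metric.closedBall (b : UnitAddCircle) (5 * ((2 : ℝ) ^ n b)⁻¹)) := by
        gcongr
        exact (measure_mono hsub).trans (measure_biUnion_le _ hcount _)
    _ = ∑' b : u, t * volume (Metric.closedBall (b : UnitAddCircle) (5 * ((2 : ℝ) ^ n b)⁻¹)) :=
        ENNReal.tsum_mul_left.symm
    _ ≤ ∑' b : u, 10 * ∫⁻ y in Metric.closedBall (b : UnitAddCircle) ((2 : ℝ) ^ n b)⁻¹, F y := by
        refine ENNReal.tsum_le_tsum fun b => ?_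
        have h1 : volume (Metric.closedBall (b : UnitAddCircle) (5 * ((2 : ℝ) ^ n b)⁻¹))
            ≤ 10 * ((2 : ℝ≥0∞) ^ n b)⁻¹ := by
          refine (volume_closedBall_le _ _).trans_eq ?_
          rw [← mul_assoc, ENNReal.ofReal_mul (by norm_num), ofReal_two_pow_inv]
          norm_num
        calc t * volume (Metric.closedBall (b : UnitAddCircle) (5 * ((2 : ℝ) ^ n b)⁻¹))
            ≤ t * (10 * ((2 : ℝ≥0∞) ^ n b)⁻¹) := by gcongr
          _ = 10 * (t * ((2 : ℝ≥0∞) ^ n b)⁻¹) := by ring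
          _ ≤ _ := by gcongr; exact hn b (hu b.2)
    _ = 10 * ∫⁻ y in ⋃ b ∈ u, Metric.closedBall b ((2 : ℝ) ^ n b)⁻¹, F y := by
        rw [ENNReal.tsum_mul_left, lintegral_biUnion hcount
          (fun b _ => Metric.isClosed_closedBall.measurableSet)
          (show u.PairwiseDisjoint fun b => Metric.closedBall b ((2 : ℝ) ^ n b)⁻¹ from hdisj)]
    _ ≤ 10 * ∫⁻ y, F y := by
        gcongr; exact Measure.restrict_le_self

theorem setLIntegral_Ioo_rpow {q : ℝ} (hq : 0 < q) {x : ℝ} (hx : 0 ≤ x) :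
    ∫⁻ t in Set.Ioo 0 x, ENNReal.ofReal (q * t ^ (q - 1)) = ENNReal.ofReal (x ^ q) := by
  rw [← setLIntegral_congr (Ioo_ae_eq_Ioc (α := ℝ)).symm,
    ← ofReal_integral_eq_lintegral_ofReal]
  · rw [← intervalIntegral.integral_of_le hx, intervalIntegral.integral_const_mul,
      integral_rpow (Or.inl (by linarith)), sub_add_cancel, Real.zero_rpow hq.ne']
    congr 1
    field_simp
    ring
  · have := (intervalIntegral.intervalIntegrable_rpow' (a := 0) (b := x)
      (show -1 < q - 1 by linarith)).const_mul q
    exact (intervalIntegrable_iff_integrableOn_Ioc_of_le hx).1 this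
  · filter_upwards [ae_restrict_mem measurableSet_Ioc] with t ht
    have := ht.1
    positivity

/-- The layer-cake formula for a single extended nonnegative real. -/
theorem setLIntegral_rpow_of_lt {q : ℝ} (hq : 0 < q) (X : ℝ≥0∞) :
    ∫⁻ t in Set.Ioi (0 : ℝ), {t : ℝ | ENNReal.ofReal t < X}.indicator
      (fun t => ENNReal.ofReal (q * t ^ (q - 1))) t = X ^ q := by
  have hm : MeasurableSet {t : ℝ | ENNReal.ofReal t < X} :=
    measurableSet_lt ENNReal.measurable_ofReal measurable_const
  rw [setLIntegral_indicator hm]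
  induction X with
  | top =>
    rw [ENNReal.top_rpow_of_pos hq]
    -- For `X = ∞` the integral already exceeds any `r` on the interval `(0, r^(1/q))`.
    refine ENNReal.eq_top_of_forall_nnreal_le fun r => ?_
    have h := setLIntegral_Ioo_rpow hq (x := (r : ℝ) ^ q⁻¹) (by positivity)
    rw [← Real.rpow_mul r.coe_nonneg, inv_mul_cancel₀ hq.ne', Real.rpow_one, ENNReal.ofReal_coe_nnreal] at h
    rw [← h]
    exact lintegral_mono_set fun t ht => ⟨ENNReal.ofReal_lt_top, ht.1⟩
  | coe x =>
    have : {t : ℝ | ENNReal.ofReal t < x} ∩ Set.Ioi 0 = Set.Ioo (0 : ℝ) x := by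
      ext t
      simp only [Set.mem_inter_iff, Set.mem_ofPred_eq, Set.mem_Ioi, Set.mem_Ioo]
      constructor
      · rintro ⟨h1, h2⟩
        refine ⟨h2, ?_⟩
        rwa [← ENNReal.ofReal_coe_nnreal, ENNReal.ofReal_lt_ofReal_iff_of_nonneg h2.le] at h1
      · rintro ⟨h1, h2⟩
        refine ⟨?_, h1⟩
        rwa [← ENNReal.ofReal_coe_nnreal, ENNReal.ofReal_lt_ofReal_iff_of_nonneg h1.le]
    rw [this, setLIntegral_Ioo_rpow hq x.coe_nonneg,
      ← ENNReal.ofReal_rpow_of_nonneg x.coe_nonneg hq.le, ENNReal.ofReal_coe_nnreal]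

theorem lintegral_rpow_eq_layercake {q : ℝ} (hq : 0 < q) {X : UnitAddCircle → ℝ≥0∞}
    (hX : Measurable X) :
    ∫⁻ x, X x ^ q = ∫⁻ t in Set.Ioi (0 : ℝ),
      ENNReal.ofReal (q * t ^ (q - 1)) * volume {x | ENNReal.ofReal t < X x} := by
  simp_rw [← setLIntegral_rpow_of_lt hq]
  rw [lintegral_lintegral_swap]
  · refine lintegral_congr fun t => ?_
    rw [← lintegral_indicator_const (measurableSet_lt measurable_const hX)]
    rfl
  · refine Measurable.aemeasurable ?_
    have hm : MeasurableSet {z : UnitAddCircle × ℝ | ENNReal.ofReal z.2 < X z.1} :=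
      measurableSet_lt (ENNReal.measurable_ofReal.comp measurable_snd) (hX.comp measurable_fst)
    exact Measurable.indicator (f := fun z : UnitAddCircle × ℝ =>
      ENNReal.ofReal (q * z.2 ^ (q - 1))) (by fun_prop) hm

theorem maximalFn_add_le {F G H : UnitAddCircle → ℝ≥0∞} (hG : Measurable G) (h : ∀ x, F x ≤ G x + H x)
    (x : UnitAddCircle) : maximalFn F x ≤ maximalFn G x + maximalFn H x := by
  refine iSup_le fun n => ?_
  calc 2 ^ n * ∫⁻ y in Metric.closedBall x ((2 : ℝ) ^ n)⁻¹, F y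
      ≤ 2 ^ n * ∫⁻ y in Metric.closedBall x ((2 : ℝ) ^ n)⁻¹, (G y + H y) := by
        gcongr with y; exact h y
    _ = 2 ^ n * (∫⁻ y in Metric.closedBall x ((2 : ℝ) ^ n)⁻¹, G y)
        + 2 ^ n * ∫⁻ y in Metric.closedBall x ((2 : ℝ) ^ n)⁻¹, H y := by
        rw [lintegral_add_left hG, mul_add]
    _ ≤ _ := add_le_add (le_maximalFn G x n) (le_maximalFn H x n)

theorem maximalFn_const_le (c : ℝ≥0∞) (x : UnitAddCircle) :
    maximalFn (fun _ => c) x ≤ 2 * c := by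
  refine iSup_le fun n => ?_
  rw [lintegral_const, Measure.restrict_apply_univ]
  calc 2 ^ n * (c * volume (Metric.closedBall x ((2 : ℝ) ^ n)⁻¹))
      ≤ 2 ^ n * (c * (2 * (2 ^ n)⁻¹)) := by
        gcongr
        refine (volume_closedBall_le _ _).trans_eq ?_
        rw [ENNReal.ofReal_mul (by norm_num), ofReal_two_pow_inv]
        norm_num
    _ = 2 * c * (2 ^ n * (2 ^ n)⁻¹) := by ring
    _ = 2 * c := by rw [ENNReal.mul_inv_cancel (by positivity) (by finiteness), mul_one]

/-- Cut `F` at height `t / 4`. The lower part adds at most `t / 2` to the maximal function, because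
a constant is at most doubled by it, so the weak-type inequality at height `t / 2` need only see the
upper part. -/
theorem measure_maximalFn_gt_le {F : UnitAddCircle → ℝ≥0∞} (hF : Measurable F) {t : ℝ} (ht : 0 < t) :
    volume {x | ENNReal.ofReal t < maximalFn F x}
      ≤ ENNReal.ofReal (20 * t⁻¹) * ∫⁻ y, {y | ENNReal.ofReal t < 4 * F y}.indicator F y := by
  set G := {y | ENNReal.ofReal t < 4 * F y}.indicator F with hG
  have hGm : Measurable G := hF.indicator (measurableSet_lt measurable_const (hF.const_mul 4))
  have hle : ∀ x, F x ≤ G x + ENNReal.ofReal (t / 4) := by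
    intro x
    by_cases hx : ENNReal.ofReal t < 4 * F x
    · rw [hG, Set.indicator_of_mem (by exact hx)]; exact le_self_add
    · refine le_add_of_le_right ?_
      rw [ENNReal.ofReal_div_of_pos (by norm_num), ENNReal.le_div_iff_mul_le (by simp) (by simp)]
      rw [mul_comm]
      simpa using hx
  have hsub : {x | ENNReal.ofReal t < maximalFn F x}
      ⊆ {x | ENNReal.ofReal (t / 2) < maximalFn G x} := by
    intro x hx
    by_contra hcon
    rw [Set.mem_ofPred_eq, not_lt] at hcon
    refine (lt_irrefl _ ((show ENNReal.ofReal t < maximalFn F x from hx).trans_le ?_))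
    calc maximalFn F x ≤ maximalFn G x + maximalFn (fun _ => ENNReal.ofReal (t / 4)) x :=
          maximalFn_add_le hGm hle x
      _ ≤ ENNReal.ofReal (t / 2) + 2 * ENNReal.ofReal (t / 4) :=
          add_le_add hcon (maximalFn_const_le _ x)
      _ = ENNReal.ofReal t := by
          rw [show (2 : ℝ≥0∞) = ENNReal.ofReal 2 by simp, ← ENNReal.ofReal_mul (by norm_num),
            ← ENNReal.ofReal_add (by positivity) (by positivity)]
          congr 1; ring
  have hw := mul_measure_maximalFn_gt_le G (ENNReal.ofReal (t / 2))
  have h20 : ENNReal.ofReal (20 * t⁻¹) = (ENNReal.ofReal (t / 2))⁻¹ * 10 := by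
    rw [← ENNReal.ofReal_inv_of_pos (by positivity), show (10 : ℝ≥0∞) = ENNReal.ofReal 10 by simp,
      ← ENNReal.ofReal_mul (by positivity)]
    congr 1; field_simp; norm_num
  refine (measure_mono hsub).trans ?_
  rw [h20, mul_assoc]
  rwa [← ENNReal.mul_le_iff_le_inv (by simpa using ht) ENNReal.ofReal_ne_top]

/-- The strong-type inequality for the maximal function. -/
theorem exists_lintegral_maximalFn_rpow_le {q : ℝ} (hq : 1 < q) : ∃ K : ℝ≥0,
    ∀ F : UnitAddCircle → ℝ≥0∞, Measurable F →
      ∫⁻ x, maximalFn F x ^ q ≤ K * ∫⁻ x, F x ^ q := by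
  have hq1 : 0 < q - 1 := by linarith
  refine ⟨(20 * q / (q - 1)).toNNReal * (4 : ℝ≥0) ^ (q - 1), fun F hF => ?_⟩
  rw [lintegral_rpow_eq_layercake (by linarith) (measurable_maximalFn hF)]
  have hm : MeasurableSet {z : ℝ × UnitAddCircle | ENNReal.ofReal z.1 < 4 * F z.2} :=
    measurableSet_lt (ENNReal.measurable_ofReal.comp measurable_fst)
      ((hF.comp measurable_snd).const_mul 4)
  calc ∫⁻ t in Set.Ioi (0 : ℝ),
        ENNReal.ofReal (q * t ^ (q - 1)) * volume {x | ENNReal.ofReal t < maximalFn F x}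
      ≤ ∫⁻ t in Set.Ioi (0 : ℝ), ENNReal.ofReal (20 * q / (q - 1)) * ∫⁻ y,
          {z : ℝ × UnitAddCircle | ENNReal.ofReal z.1 < 4 * F z.2}.indicator
            (fun z => F z.2 * ENNReal.ofReal ((q - 1) * z.1 ^ (q - 1 - 1))) (t, y) := by
        refine setLIntegral_mono' measurableSet_Ioi fun t ht => ?_
        have ht : 0 < t := ht
        refine (mul_le_mul_right (measure_maximalFn_gt_le hF ht) _).trans_eq ?_
        rw [← mul_assoc, ← ENNReal.ofReal_mul (by positivity)]
        have e1 : q * t ^ (q - 1) * (20 * t⁻¹)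
            = 20 * q / (q - 1) * ((q - 1) * t ^ (q - 1 - 1)) := by
          rw [Real.rpow_sub_one ht.ne' (q - 1)]
          field_simp
        rw [e1, ENNReal.ofReal_mul (by positivity), mul_assoc, ← lintegral_const_mul']
        · congr 2
          funext y
          by_cases hy : ENNReal.ofReal t < 4 * F y
          · rw [Set.indicator_of_mem (by exact hy), Set.indicator_of_mem (by exact hy), mul_comm]
          · rw [Set.indicator_of_notMem (by exact hy), Set.indicator_of_notMem (by exact hy),
              mul_zero]
        · exact ENNReal.ofReal_ne_top
    _ = ENNReal.ofReal (20 * q / (q - 1)) * ∫⁻ y, ∫⁻ t in Set.Ioi (0 : ℝ),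
          {z : ℝ × UnitAddCircle | ENNReal.ofReal z.1 < 4 * F z.2}.indicator
            (fun z => F z.2 * ENNReal.ofReal ((q - 1) * z.1 ^ (q - 1 - 1))) (t, y) := by
        rw [lintegral_const_mul' _ _ ENNReal.ofReal_ne_top, lintegral_lintegral_swap]
        refine Measurable.aemeasurable (Measurable.indicator ?_ hm)
        exact (hF.comp measurable_snd).mul (by fun_prop)
    -- After Fubini the inner integral is the layer-cake formula with exponent `q - 1`, evaluated at
    -- `4 * F y`.
    _ = ENNReal.ofReal (20 * q / (q - 1)) * ∫⁻ y, F y * (4 * F y) ^ (q - 1) := by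
        congr 1
        refine lintegral_congr fun y => ?_
        rw [← setLIntegral_rpow_of_lt hq1, ← lintegral_const_mul]
        · refine lintegral_congr fun t => ?_
          by_cases hy : ENNReal.ofReal t < 4 * F y
          · rw [Set.indicator_of_mem (by exact hy), Set.indicator_of_mem (by exact hy)]
          · rw [Set.indicator_of_notMem (by exact hy), Set.indicator_of_notMem (by exact hy),
              mul_zero]
        · exact Measurable.indicator (by fun_prop)
            (measurableSet_lt ENNReal.measurable_ofReal measurable_const)
    _ = _ := by
        rw [ENNReal.coe_mul, mul_assoc, ENNReal.coe_rpow_of_nonneg _ hq1.le]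
        congr 1
        rw [← lintegral_const_mul' _ _ (by finiteness)]
        refine lintegral_congr fun y => ?_
        rw [ENNReal.mul_rpow_of_nonneg _ _ hq1.le, mul_left_comm]
        congr 1
        nth_rewrite 1 [← ENNReal.rpow_one (F y)]
        rw [← ENNReal.rpow_add_of_nonneg _ _ zero_le_one hq1.le]
        congr 1; ring

/-! ### Integrals and sums of bumps -/

theorem dist_le_half (x y : UnitAddCircle) : dist x y ≤ 1 / 2 := by
  rw [dist_eq_norm]
  simpa using AddCircle.norm_le_half_period (p := (1 : ℝ)) (x := x - y) one_ne_zero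

/-- Take the least `n` with `2ᵏ dist y x ≤ 2ⁿ`; the term of index `n` alone dominates, since
minimality makes the decay factor at most `2^(1-n)`. The circle has diameter at most `1/2`, so `n ≤
k` and finitely many balls suffice. -/
theorem bump_le_sum (k : ℕ) (x y : UnitAddCircle) :
    bump k y x ≤ ∑ n ∈ Finset.range (k + 1),
      (Metric.closedBall x ((2 : ℝ) ^ (k - n))⁻¹).indicator (fun _ => 4 * ((4 : ℝ≥0∞) ^ n)⁻¹) y := by
  have hex : ∃ n : ℕ, 2 ^ k * dist y x ≤ 2 ^ n :=
    ⟨k, by nlinarith [dist_le_half y x, pow_pos (two_pos : (0 : ℝ) < 2) k]⟩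
  classical
  set n := Nat.find hex with hn
  have hspec : 2 ^ k * dist y x ≤ 2 ^ n := Nat.find_spec hex
  have hnk : n ≤ k :=
    Nat.find_min' hex (by nlinarith [dist_le_half y x, pow_pos (two_pos : (0 : ℝ) < 2) k])
  refine le_trans ?_ (Finset.single_le_sum (fun _ _ => zero_le)
    (Finset.mem_range.2 (Nat.lt_succ_of_le hnk)))
  have hmem : y ∈ Metric.closedBall x ((2 : ℝ) ^ (k - n))⁻¹ := by
    rw [Metric.mem_closedBall, ← one_div, le_div_iff₀ (by positivity)]
    have e : (2 : ℝ) ^ k = 2 ^ (k - n) * 2 ^ n := by rw [← pow_add, Nat.sub_add_cancel hnk]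
    rw [e] at hspec
    have : (0 : ℝ) < 2 ^ n := by positivity
    nlinarith
  rw [Set.indicator_of_mem hmem]
  have key : decay k y x ^ 2 ≤ 4 * ((4 : ℝ) ^ n)⁻¹ := by
    have hd0 := (decay_pos k y x).le
    rcases Nat.eq_zero_or_pos n with h0 | h0
    · rw [h0]
      nlinarith [decay_le_one k y x]
    · have hlt : ¬ (2 ^ k * dist y x ≤ 2 ^ (n - 1)) := Nat.find_min hex (by omega)
      rw [not_le] at hlt
      have h1 : decay k y x ≤ (2 ^ (n - 1))⁻¹ := by
        unfold decay
        gcongr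
        linarith
      have h2 : (2 : ℝ) ^ n = 2 ^ (n - 1) * 2 := by rw [← pow_succ, Nat.sub_add_cancel h0]
      calc decay k y x ^ 2 ≤ ((2 ^ (n - 1))⁻¹) ^ 2 := by gcongr
        _ = 4 * ((4 : ℝ) ^ n)⁻¹ := by
          rw [show (4 : ℝ) ^ n = (2 ^ n) ^ 2 by rw [← pow_mul, mul_comm, pow_mul]; norm_num, h2]
          field_simp; norm_num
  calc bump k y x ≤ ENNReal.ofReal (4 * ((4 : ℝ) ^ n)⁻¹) := ENNReal.ofReal_le_ofReal key
    _ = _ := by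
      rw [ENNReal.ofReal_mul (by norm_num), ENNReal.ofReal_inv_of_pos (by positivity),
        ENNReal.ofReal_pow (by norm_num)]
      norm_num

/-- Averages against a dilated bump are controlled by the maximal function. -/
theorem mul_lintegral_bump_le {F : UnitAddCircle → ℝ≥0∞} (hF : Measurable F) (k : ℕ) (x : UnitAddCircle) :
    2 ^ k * ∫⁻ y, bump k y x * F y ≤ 8 * maximalFn F x := by
  have hball : ∀ n, ∫⁻ y, (Metric.closedBall x ((2 : ℝ) ^ (k - n))⁻¹).indicator
      (fun _ => 4 * ((4 : ℝ≥0∞) ^ n)⁻¹) y * F y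
      ≤ 4 * ((4 : ℝ≥0∞) ^ n)⁻¹ * ((2 ^ (k - n))⁻¹ * maximalFn F x) := by
    intro n
    have e : ∀ y, (Metric.closedBall x ((2 : ℝ) ^ (k - n))⁻¹).indicator
        (fun _ => 4 * ((4 : ℝ≥0∞) ^ n)⁻¹) y * F y
        = (Metric.closedBall x ((2 : ℝ) ^ (k - n))⁻¹).indicator
          (fun y => 4 * ((4 : ℝ≥0∞) ^ n)⁻¹ * F y) y := by
      intro y
      by_cases hy : y ∈ Metric.closedBall x ((2 : ℝ) ^ (k - n))⁻¹
      · rw [Set.indicator_of_mem hy, Set.indicator_of_mem hy]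
      · rw [Set.indicator_of_notMem hy, Set.indicator_of_notMem hy, zero_mul]
    simp_rw [e]
    rw [lintegral_indicator Metric.isClosed_closedBall.measurableSet,
      lintegral_const_mul' _ _ (ENNReal.mul_ne_top (by finiteness)
        (ENNReal.inv_ne_top.2 (by positivity)))]
    gcongr
    exact setLIntegral_closedBall_le F x (k - n)
  have hsum : ∑ n ∈ Finset.range (k + 1), ((2 : ℝ≥0∞) ^ n)⁻¹ ≤ 2 := by
    refine (ENNReal.sum_le_tsum _).trans_eq ?_
    simp_rw [ENNReal.inv_pow]
    rw [ENNReal.tsum_geometric, ENNReal.one_sub_inv_two, inv_inv]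
  calc 2 ^ k * ∫⁻ y, bump k y x * F y
      ≤ 2 ^ k * ∑ n ∈ Finset.range (k + 1), ∫⁻ y, (Metric.closedBall x ((2 : ℝ) ^ (k - n))⁻¹).indicator
          (fun _ => 4 * ((4 : ℝ≥0∞) ^ n)⁻¹) y * F y := by
        rw [← lintegral_finsetSum]
        · gcongr with y
          rw [← Finset.sum_mul]
          gcongr
          exact bump_le_sum k x y
        · exact fun n _ =>
            (measurable_const.indicator Metric.isClosed_closedBall.measurableSet).mul hF
    _ ≤ 2 ^ k * ∑ n ∈ Finset.range (k + 1),
          4 * ((4 : ℝ≥0∞) ^ n)⁻¹ * ((2 ^ (k - n))⁻¹ * maximalFn F x) := by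
        gcongr with n; exact hball n
    -- The ball of radius `2^(n-k)` costs `2^(n-k)` and carries the coefficient `4⁻ⁿ`: a geometric
    -- series of ratio `1/2` remains.
    _ = ∑ n ∈ Finset.range (k + 1), 4 * ((2 : ℝ≥0∞) ^ n)⁻¹ * maximalFn F x := by
        rw [Finset.mul_sum]
        refine Finset.sum_congr rfl fun n hn => ?_
        have hnk : n ≤ k := Nat.lt_succ_iff.1 (Finset.mem_range.1 hn)
        have e1 : (2 : ℝ≥0∞) ^ k = 2 ^ n * 2 ^ (k - n) := by
          rw [← pow_add, Nat.add_sub_cancel' hnk]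
        have e2 : ((4 : ℝ≥0∞) ^ n)⁻¹ = (2 ^ n)⁻¹ * (2 ^ n)⁻¹ := by
          rw [← ENNReal.mul_inv (by simp) (by simp), ← mul_pow]; norm_num
        rw [e1, e2]
        calc _ = 4 * ((2 : ℝ≥0∞) ^ n)⁻¹ * maximalFn F x * (2 ^ n * (2 ^ n)⁻¹)
              * (2 ^ (k - n) * (2 ^ (k - n))⁻¹) := by ring
          _ = _ := by
            rw [ENNReal.mul_inv_cancel (by positivity) (by finiteness),
              ENNReal.mul_inv_cancel (by positivity) (by finiteness), mul_one, mul_one]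
    _ = 4 * maximalFn F x * ∑ n ∈ Finset.range (k + 1), ((2 : ℝ≥0∞) ^ n)⁻¹ := by
        rw [Finset.mul_sum]
        refine Finset.sum_congr rfl fun n _ => by ring
    _ ≤ 4 * maximalFn F x * 2 := by gcongr
    _ = 8 * maximalFn F x := by ring

theorem lintegral_bump_le (k : ℕ) (x : UnitAddCircle) :
    ∫⁻ y, bump k y x ≤ 16 * ((2 : ℝ≥0∞) ^ k)⁻¹ := by
  have h := mul_lintegral_bump_le (measurable_const (a := (1 : ℝ≥0∞))) k x
  simp only [mul_one] at h
  rw [ENNReal.mul_le_iff_le_inv (by positivity) (by finiteness)] at h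
  refine h.trans ?_
  rw [mul_comm]
  gcongr
  calc 8 * maximalFn (fun _ => 1) x ≤ 8 * (2 * 1) := by gcongr; exact maximalFn_const_le 1 x
    _ = 16 := by norm_num

/-- Bumps at scale `k`, summed over the nodes of a finer scale `l`. -/
theorem sum_bump_node_le {k l : ℕ} (h : k ≤ l) (c : UnitAddCircle) :
    ∑ j ∈ Finset.range (2 ^ l), bump k (node l j) c ≤ 64 * 2 ^ l * ((2 : ℝ≥0∞) ^ k)⁻¹ := by
  calc ∑ j ∈ Finset.range (2 ^ l), bump k (node l j) c
      = ∑ j ∈ Finset.range (2 ^ l), 2 ^ l * ∫⁻ y in cell l j, bump k (node l j) c := by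
        refine Finset.sum_congr rfl fun j hj => ?_
        rw [lintegral_const, Measure.restrict_apply_univ, volume_cell (Finset.mem_range.1 hj),
          mul_left_comm, ENNReal.mul_inv_cancel (by positivity) (by finiteness), mul_one]
    -- A node moves to any point of its cell by at most `2⁻ˡ ≤ 2⁻ᵏ`, which costs a factor `4` and
    -- turns the sum into an integral.
    _ ≤ ∑ j ∈ Finset.range (2 ^ l), 2 ^ l * ∫⁻ y in cell l j, 4 * bump k y c := by
        refine Finset.sum_le_sum fun j _ => ?_
        gcongr 2 ^ l * ?_
        refine setLIntegral_mono' (measurableSet_cell l j) fun y hy => ?_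
        rw [bump_comm, bump_comm k y]
        refine bump_le_four_mul ?_
        rw [dist_comm]
        refine (dist_node_le_of_mem hy).trans ?_
        gcongr
        norm_num
    _ = 2 ^ l * (4 * ∫⁻ y, bump k y c) := by
        rw [← Finset.mul_sum, ← lintegral_eq_sum_cell, lintegral_const_mul' _ _ (by finiteness)]
    _ ≤ 2 ^ l * (4 * (16 * ((2 : ℝ≥0∞) ^ k)⁻¹)) := by gcongr; exact lintegral_bump_le k c
    _ = _ := by ring

theorem sum_bump_node_le_const (k : ℕ) (c : UnitAddCircle) :
    ∑ j ∈ Finset.range (2 ^ k), bump k c (node k j) ≤ 64 := by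
  simp_rw [bump_comm k c]
  refine (sum_bump_node_le le_rfl c).trans_eq ?_
  rw [mul_assoc, ENNReal.mul_inv_cancel (by positivity) (by finiteness), mul_one]

/-! ### Kernel families and the `L²` bound by almost orthogonality -/

/-- Mean-zero functions indexed by scale and position, with decay and regularity at the
corresponding dyadic interval. -/
structure IsKernelFamily (B : ℝ≥0) (ψ : ℕ → ℕ → UnitAddCircle → ℂ) : Prop where
  cont : ∀ k j, Continuous (ψ k j)
  bound : ∀ k j x, ‖ψ k j x‖ ≤ B * decay k x (node k j) ^ 3
  diff : ∀ k j x y, ‖ψ k j x - ψ k j y‖ ≤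
    B * 2 ^ k * dist x y * (decay k x (node k j) ^ 2 + decay k y (node k j) ^ 2)
  mean : ∀ k j, ∫ x, ψ k j x = 0

/-- The coefficient `2ᵏ |⟨ψ, f⟩|` of `f` at a dyadic interval. -/
noncomputable def coeff (ψ : ℕ → ℕ → UnitAddCircle → ℂ) (f : UnitAddCircle → ℂ) (k j : ℕ) : ℝ≥0∞ :=
  2 ^ k * ‖∫ x, ψ k j x * conj (f x)‖ₑ

/-- The contribution of scale `k` to the square of the square function. -/
noncomputable def sqTerm (ψ : ℕ → ℕ → UnitAddCircle → ℂ) (f : UnitAddCircle → ℂ) (k : ℕ)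
    (x : UnitAddCircle) : ℝ≥0∞ :=
  coeff ψ f k (cellIndex k x) ^ 2

theorem measurable_comp_cellIndex {β : Type*} [MeasurableSpace β] (k : ℕ) (g : ℕ → β) :
    Measurable fun x => g (cellIndex k x) :=
  (measurable_of_countable g).comp (measurable_cellIndex k)

theorem measurable_sqTerm (ψ : ℕ → ℕ → UnitAddCircle → ℂ) (f : UnitAddCircle → ℂ) (k : ℕ) :
    Measurable (sqTerm ψ f k) :=
  measurable_comp_cellIndex k fun j => coeff ψ f k j ^ 2

theorem lintegral_comp_cellIndex (k : ℕ) (g : ℕ → ℝ≥0∞) :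
    ∫⁻ x, g (cellIndex k x) = ∑ j ∈ Finset.range (2 ^ k), (2 ^ k)⁻¹ * g j := by
  rw [lintegral_eq_sum_cell k]
  refine Finset.sum_congr rfl fun j hj => ?_
  rw [setLIntegral_congr_fun (g := fun _ => g j) (measurableSet_cell k j)
    (fun x hx => by change g (cellIndex k x) = g j; rw [show cellIndex k x = j from hx]),
    lintegral_const, Measure.restrict_apply_univ, volume_cell (Finset.mem_range.1 hj), mul_comm]

/-- Schur's test for the Gram matrix, by duality: `h = ∑ x i • v i` satisfies `⟨h, f⟩ = Q`, the row
sums give `‖h‖² ≤ A Q`, and Cauchy–Schwarz then yields `Q² ≤ A Q ‖f‖²`. -/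
theorem sum_sq_inner_le {H ι : Type*} [NormedAddCommGroup H] [InnerProductSpace ℂ H]
    (s : Finset ι) (v : ι → H) {A : ℝ} (hA0 : 0 ≤ A)
    (hA : ∀ i ∈ s, ∑ j ∈ s, ‖inner ℂ (v i) (v j)‖ ≤ A) (f : H) :
    ∑ i ∈ s, ‖inner ℂ (v i) f‖ ^ 2 ≤ A * ‖f‖ ^ 2 := by
  set x : ι → ℂ := fun i => inner ℂ (v i) f
  set Q := ∑ i ∈ s, ‖x i‖ ^ 2 with hQ
  have hQ0 : 0 ≤ Q := Finset.sum_nonneg fun i _ => by positivity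
  set h := ∑ i ∈ s, x i • v i
  have h1 : (inner ℂ h f : ℂ) = (Q : ℂ) := by
    rw [sum_inner, hQ]
    push_cast
    refine Finset.sum_congr rfl fun i _ => ?_
    rw [inner_smul_left]
    exact Complex.conj_mul' (x i)
  have h2 : ‖h‖ ^ 2 ≤ A * Q := by
    have e : ‖h‖ ^ 2 = ‖(inner ℂ h h : ℂ)‖ := by
      rw [inner_self_eq_norm_sq_to_K]
      simp
    rw [e, sum_inner]
    calc ‖∑ i ∈ s, inner ℂ (x i • v i) h‖
        ≤ ∑ i ∈ s, ∑ j ∈ s, ‖x i‖ * ‖x j‖ * ‖inner ℂ (v i) (v j)‖ := by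
          refine (norm_sum_le _ _).trans (Finset.sum_le_sum fun i _ => ?_)
          rw [inner_sum]
          refine (norm_sum_le _ _).trans (Finset.sum_le_sum fun j _ => ?_)
          rw [inner_smul_left, inner_smul_right, norm_mul, norm_mul, RCLike.norm_conj, mul_assoc]
      _ ≤ ∑ i ∈ s, ∑ j ∈ s, (‖x i‖ ^ 2 / 2 * ‖inner ℂ (v i) (v j)‖
            + ‖x j‖ ^ 2 / 2 * ‖inner ℂ (v j) (v i)‖) := by
          refine Finset.sum_le_sum fun i _ => Finset.sum_le_sum fun j _ => ?_
          rw [norm_inner_symm (v j) (v i)]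
          nlinarith [mul_nonneg (sq_nonneg (‖x i‖ - ‖x j‖)) (norm_nonneg (inner ℂ (v i) (v j)))]
      _ = 2 * ∑ i ∈ s, ∑ j ∈ s, ‖x i‖ ^ 2 / 2 * ‖inner ℂ (v i) (v j)‖ := by
          simp_rw [Finset.sum_add_distrib]
          rw [Finset.sum_comm (f := fun i j => ‖x j‖ ^ 2 / 2 * ‖inner ℂ (v j) (v i)‖), two_mul]
      _ = ∑ i ∈ s, ‖x i‖ ^ 2 * ∑ j ∈ s, ‖inner ℂ (v i) (v j)‖ := by
          rw [Finset.mul_sum]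
          refine Finset.sum_congr rfl fun i _ => ?_
          rw [← Finset.mul_sum]; ring
      _ ≤ ∑ i ∈ s, ‖x i‖ ^ 2 * A := by
          refine Finset.sum_le_sum fun i hi => ?_
          gcongr
          exact hA i hi
      _ = A * Q := by rw [← Finset.sum_mul, mul_comm]
  have h3 : Q ≤ ‖h‖ * ‖f‖ := by
    have := norm_inner_le_norm (𝕜 := ℂ) h f
    rwa [h1, Complex.norm_real, Real.norm_of_nonneg hQ0] at this
  have h4 : Q ^ 2 ≤ A * Q * ‖f‖ ^ 2 := by
    calc Q ^ 2 ≤ (‖h‖ * ‖f‖) ^ 2 := by gcongr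
      _ = ‖h‖ ^ 2 * ‖f‖ ^ 2 := by ring
      _ ≤ A * Q * ‖f‖ ^ 2 := by gcongr
  rcases hQ0.eq_or_lt with h0 | h0
  · change Q ≤ _
    rw [← h0]
    positivity
  · change Q ≤ _
    nlinarith

/-- In truncated subtraction `(l - k) + (k - l)` is `|l - k|`. The side `l ≥ k` is a full geometric
series and the side `l < k` starts at the first power, whence the factor `1 + r`. -/
theorem tsum_pow_sub_add_sub_le (r : ℝ≥0∞) (k : ℕ) :
    ∑' l : ℕ, r ^ ((l - k) + (k - l)) ≤ (1 + r) * (1 - r)⁻¹ := by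
  have hsplit := Summable.sum_add_tsum_nat_add' (f := fun l : ℕ => r ^ ((l - k) + (k - l)))
    (k := k) ENNReal.summable
  rw [← hsplit, add_comm, add_mul, one_mul]
  refine add_le_add ?_ ?_
  · rw [← ENNReal.tsum_geometric]
    refine ENNReal.tsum_le_tsum fun m => ?_
    rw [show m + k - k + (k - (m + k)) = m by omega]
  · rw [← Finset.sum_range_reflect, ← ENNReal.tsum_geometric, ← ENNReal.tsum_mul_left]
    refine le_trans (Finset.sum_le_sum fun j hj => ?_) (ENNReal.sum_le_tsum (Finset.range k))
    have := Finset.mem_range.1 hj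
    rw [show k - 1 - j - k + (k - (k - 1 - j)) = j + 1 by omega, pow_succ']

variable {B : ℝ≥0} {ψ : ℕ → ℕ → UnitAddCircle → ℂ}

theorem IsKernelFamily.integrable (h : IsKernelFamily B ψ) (k j : ℕ) : Integrable (ψ k j) :=
  (h.cont k j).integrable_of_hasCompactSupport (HasCompactSupport.of_compactSpace _)

theorem IsKernelFamily.memLp (h : IsKernelFamily B ψ) (k j : ℕ) : MemLp (ψ k j) 2 :=
  (h.cont k j).memLp_of_hasCompactSupport (HasCompactSupport.of_compactSpace _)

theorem IsKernelFamily.enorm_sub_le (h : IsKernelFamily B ψ) (k j : ℕ) (x y : UnitAddCircle) :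
    ‖ψ k j x - ψ k j y‖ₑ ≤ B * 2 ^ k * ENNReal.ofReal (dist x y) *
      (bump k x (node k j) + bump k y (node k j)) := by
  rw [← ofReal_norm, ← ENNReal.ofReal_coe_nnreal (p := B), bump, bump,
    ← ENNReal.ofReal_add (by positivity) (by positivity),
    show (2 : ℝ≥0∞) ^ k = ENNReal.ofReal (2 ^ k) by simp,
    ← ENNReal.ofReal_mul (by positivity), ← ENNReal.ofReal_mul (by positivity),
    ← ENNReal.ofReal_mul (by positivity)]
  exact ENNReal.ofReal_le_ofReal (h.diff k j x y)

/-- One of the three powers of decay absorbs the distance and turns it into `2⁻ᵏ`; the remaining two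
form a bump, which has mass of order `2⁻ᵏ`. -/
theorem IsKernelFamily.ofReal_dist_mul_enorm_le (h : IsKernelFamily B ψ) (k j : ℕ)
    (x : UnitAddCircle) :
    ENNReal.ofReal (dist x (node k j)) * ‖ψ k j x‖ₑ ≤ B * (2 ^ k)⁻¹ * bump k x (node k j) := by
  rw [← ofReal_norm, ← ENNReal.ofReal_coe_nnreal (p := B), bump, ← ofReal_two_pow_inv,
    ← ENNReal.ofReal_mul (by positivity), ← ENNReal.ofReal_mul (by positivity),
    ← ENNReal.ofReal_mul (by positivity)]
  refine ENNReal.ofReal_le_ofReal ?_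
  calc dist x (node k j) * ‖ψ k j x‖ ≤ dist x (node k j) * (B * decay k x (node k j) ^ 3) := by
        gcongr; exact h.bound k j x
    _ = B * (dist x (node k j) * decay k x (node k j)) * decay k x (node k j) ^ 2 := by ring
    _ ≤ _ := by
      gcongr
      exact dist_mul_decay_le _ _ _

/-- Since `ψ l j` has mean zero, the value of `ψ k i` at the node of `ψ l j` may be subtracted. The
Lipschitz bound yields `2ᵏ` times a distance, and the decay of `ψ l j` converts that distance into
`2⁻ˡ`. This is a gain when `l` is the finer scale. -/
theorem IsKernelFamily.enorm_integral_conj_mul_le (h : IsKernelFamily B ψ) (k i l j : ℕ) :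
    ‖∫ x, conj (ψ k i x) * ψ l j x‖ₑ ≤ B ^ 2 * (2 ^ k * (2 ^ l)⁻¹) *
      ∫⁻ x, (bump k x (node k i) + bump k (node l j) (node k i)) * bump l x (node l j) := by
  have e : ∫ x, conj (ψ k i x) * ψ l j x
      = ∫ x, conj (ψ k i x - ψ k i (node l j)) * ψ l j x := by
    have hint : Integrable fun x => conj (ψ k i x) * ψ l j x :=
      ((Complex.continuous_conj.comp (h.cont k i)).mul (h.cont l j)).integrable_of_hasCompactSupport
        (HasCompactSupport.of_compactSpace _)
    have hmean := h.mean l j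
    simp_rw [map_sub, sub_mul]
    rw [integral_sub hint ((h.integrable l j).const_mul _), integral_const_mul, hmean, mul_zero,
      sub_zero]
  rw [e]
  refine (enorm_integral_le_lintegral_enorm _).trans ?_
  rw [← lintegral_const_mul' _ _ (ENNReal.mul_ne_top (by finiteness)
    (ENNReal.mul_ne_top (by finiteness) (ENNReal.inv_ne_top.2 (by positivity))))]
  refine lintegral_mono fun x => ?_
  rw [enorm_mul, RCLike.enorm_conj]
  calc ‖ψ k i x - ψ k i (node l j)‖ₑ * ‖ψ l j x‖ₑ
      ≤ B * 2 ^ k * ENNReal.ofReal (dist x (node l j)) *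
          (bump k x (node k i) + bump k (node l j) (node k i)) * ‖ψ l j x‖ₑ := by
        gcongr; exact h.enorm_sub_le k i x (node l j)
    _ = B * 2 ^ k * (bump k x (node k i) + bump k (node l j) (node k i)) *
          (ENNReal.ofReal (dist x (node l j)) * ‖ψ l j x‖ₑ) := by ring
    _ ≤ B * 2 ^ k * (bump k x (node k i) + bump k (node l j) (node k i)) *
          (B * (2 ^ l)⁻¹ * bump l x (node l j)) := by
        exact mul_le_mul_right (h.ofReal_dist_mul_enorm_le l j x) _
    _ = _ := by ring

theorem measurable_bump_mul_bump (k l : ℕ) (a c : UnitAddCircle) :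
    Measurable fun x => bump k x a * bump l x c :=
  (measurable_bump_left k a).mul (measurable_bump_left l c)

theorem lintegral_bump_add_mul_bump (k l : ℕ) (a b c : UnitAddCircle) :
    ∫⁻ x, (bump k x a + bump k b a) * bump l x c
      = (∫⁻ x, bump k x a * bump l x c) + bump k b a * ∫⁻ x, bump l x c := by
  simp_rw [add_mul]
  rw [lintegral_add_left (measurable_bump_mul_bump k l a c),
    lintegral_const_mul' _ _ (bump_ne_top _ _ _)]

/-- Cancellation gains `2^(k-l)`, while the overlap integrals summed over all fine positions stay of
order `2⁻ᵏ`: bumps at the nodes of one scale have bounded sum, so the number of positions causes no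
loss. -/
theorem IsKernelFamily.sum_fine_le (h : IsKernelFamily B ψ) {k l : ℕ} (hkl : k ≤ l) (i : ℕ) :
    ∑ j ∈ Finset.range (2 ^ l), ‖∫ x, conj (ψ k i x) * ψ l j x‖ₑ ≤ 2048 * B ^ 2 * (2 ^ l)⁻¹ := by
  have hfirst : ∑ j ∈ Finset.range (2 ^ l), ∫⁻ x, bump k x (node k i) * bump l x (node l j)
      ≤ 1024 * (2 ^ k)⁻¹ := by
    rw [← lintegral_finsetSum _ fun j _ => measurable_bump_mul_bump k l _ _]
    calc ∫⁻ x, ∑ j ∈ Finset.range (2 ^ l), bump k x (node k i) * bump l x (node l j)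
        ≤ ∫⁻ x, bump k x (node k i) * 64 := by
          refine lintegral_mono fun x => ?_
          rw [← Finset.mul_sum]
          exact mul_le_mul_right (sum_bump_node_le_const l x) _
      _ = (∫⁻ x, bump k x (node k i)) * 64 := lintegral_mul_const' _ _ (by finiteness)
      _ ≤ 16 * (2 ^ k)⁻¹ * 64 := by gcongr; exact lintegral_bump_le k _
      _ = 1024 * (2 ^ k)⁻¹ := by ring
  have hsecond : ∑ j ∈ Finset.range (2 ^ l),
      bump k (node l j) (node k i) * ∫⁻ x, bump l x (node l j) ≤ 1024 * (2 ^ k)⁻¹ := by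
    calc _ ≤ ∑ j ∈ Finset.range (2 ^ l), bump k (node l j) (node k i) * (16 * (2 ^ l)⁻¹) := by
          gcongr with j; exact lintegral_bump_le l _
      _ = (∑ j ∈ Finset.range (2 ^ l), bump k (node l j) (node k i)) * (16 * (2 ^ l)⁻¹) := by
          rw [Finset.sum_mul]
      _ ≤ 64 * 2 ^ l * (2 ^ k)⁻¹ * (16 * (2 ^ l)⁻¹) := by
          gcongr; exact sum_bump_node_le hkl _
      _ = 1024 * (2 ^ k)⁻¹ * (2 ^ l * (2 ^ l)⁻¹) := by ring
      _ = _ := by rw [ENNReal.mul_inv_cancel (by positivity) (by finiteness), mul_one]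
  calc _ ≤ ∑ j ∈ Finset.range (2 ^ l), B ^ 2 * (2 ^ k * (2 ^ l)⁻¹) *
        ∫⁻ x, (bump k x (node k i) + bump k (node l j) (node k i)) * bump l x (node l j) :=
        Finset.sum_le_sum fun j _ => h.enorm_integral_conj_mul_le k i l j
    _ ≤ B ^ 2 * (2 ^ k * (2 ^ l)⁻¹) * (1024 * (2 ^ k)⁻¹ + 1024 * (2 ^ k)⁻¹) := by
        rw [← Finset.mul_sum]
        simp_rw [lintegral_bump_add_mul_bump]
        rw [Finset.sum_add_distrib]
        gcongr
    _ = 2048 * B ^ 2 * (2 ^ l)⁻¹ * (2 ^ k * (2 ^ k)⁻¹) := by ring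
    _ = _ := by rw [ENNReal.mul_inv_cancel (by positivity) (by finiteness), mul_one]

theorem enorm_integral_conj_mul_comm (u v : UnitAddCircle → ℂ) :
    ‖∫ x, conj (u x) * v x‖ₑ = ‖∫ x, conj (v x) * u x‖ₑ := by
  rw [← RCLike.enorm_conj, ← integral_conj]
  congr 2
  funext x
  simp [mul_comm]

/-- The pairing is symmetric up to conjugation, so here the cancellation is taken from the fixed
kernel `ψ k i`. The bound is useful for `l ≤ k`. -/
theorem IsKernelFamily.sum_coarse_le (h : IsKernelFamily B ψ) (k l i : ℕ) :
    ∑ j ∈ Finset.range (2 ^ l), ‖∫ x, conj (ψ k i x) * ψ l j x‖ₑ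
      ≤ 2048 * B ^ 2 * (2 ^ l * (2 ^ k)⁻¹ * (2 ^ k)⁻¹) := by
  have hfirst : ∑ j ∈ Finset.range (2 ^ l), ∫⁻ x, bump l x (node l j) * bump k x (node k i)
      ≤ 1024 * (2 ^ k)⁻¹ := by
    rw [← lintegral_finsetSum _ fun j _ => measurable_bump_mul_bump l k _ _]
    calc ∫⁻ x, ∑ j ∈ Finset.range (2 ^ l), bump l x (node l j) * bump k x (node k i)
        ≤ ∫⁻ x, 64 * bump k x (node k i) := by
          refine lintegral_mono fun x => ?_
          rw [← Finset.sum_mul]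
          exact mul_le_mul_left (sum_bump_node_le_const l x) _
      _ = 64 * (∫⁻ x, bump k x (node k i)) := lintegral_const_mul' _ _ (by finiteness)
      _ ≤ 64 * (16 * (2 ^ k)⁻¹) := by gcongr; exact lintegral_bump_le k _
      _ = 1024 * (2 ^ k)⁻¹ := by ring
  have hsecond : ∑ j ∈ Finset.range (2 ^ l),
      bump l (node k i) (node l j) * ∫⁻ x, bump k x (node k i) ≤ 1024 * (2 ^ k)⁻¹ := by
    rw [← Finset.sum_mul]
    calc _ ≤ 64 * (16 * ((2 : ℝ≥0∞) ^ k)⁻¹) :=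
          mul_le_mul' (sum_bump_node_le_const l _) (lintegral_bump_le k _)
      _ = 1024 * (2 ^ k)⁻¹ := by ring
  calc _ ≤ ∑ j ∈ Finset.range (2 ^ l), (B : ℝ≥0∞) ^ 2 * (2 ^ l * (2 ^ k)⁻¹) *
        ∫⁻ x, (bump l x (node l j) + bump l (node k i) (node l j)) * bump k x (node k i) := by
        refine Finset.sum_le_sum fun j _ => ?_
        rw [enorm_integral_conj_mul_comm]
        exact h.enorm_integral_conj_mul_le l j k i
    _ ≤ (B : ℝ≥0∞) ^ 2 * (2 ^ l * (2 ^ k)⁻¹) * (1024 * (2 ^ k)⁻¹ + 1024 * (2 ^ k)⁻¹) := by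
        rw [← Finset.mul_sum]
        simp_rw [lintegral_bump_add_mul_bump]
        rw [Finset.sum_add_distrib]
        gcongr
    _ = _ := by ring

/-- Here `σ` stands for `√2` and `r` for its inverse. The fine side gives exactly `r^m` at scale
difference `m`; the coarse side gives `r^(3m)`, relaxed to the same form. -/
theorem IsKernelFamily.weighted_sum_le (h : IsKernelFamily B ψ) {σ r : ℝ≥0∞} (hσ : σ * σ = 2)
    (hr : r * r = 2⁻¹) (hσr : σ * r = 1) (hr1 : r ≤ 1) (k i l : ℕ) :
    ∑ j ∈ Finset.range (2 ^ l), σ ^ k * σ ^ l * ‖∫ x, conj (ψ k i x) * ψ l j x‖ₑ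
      ≤ 2048 * B ^ 2 * r ^ ((l - k) + (k - l)) := by
  have e2 : ∀ n : ℕ, (2 : ℝ≥0∞) ^ n = σ ^ n * σ ^ n := fun n => by rw [← mul_pow, hσ]
  have e3 : ∀ n : ℕ, ((2 : ℝ≥0∞) ^ n)⁻¹ = r ^ n * r ^ n := fun n => by
    rw [← mul_pow, hr, ENNReal.inv_pow]
  rw [← Finset.mul_sum]
  rcases le_total k l with hkl | hkl
  · obtain ⟨m, rfl⟩ := Nat.exists_eq_add_of_le hkl
    refine (mul_le_mul_right (h.sum_fine_le hkl i) _).trans_eq ?_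
    rw [show k + m - k + (k - (k + m)) = m by omega, e3]
    calc _ = 2048 * B ^ 2 * ((σ * r) ^ (2 * k + m) * r ^ m) := by ring
      _ = _ := by rw [hσr, one_pow, one_mul]
  · obtain ⟨m, rfl⟩ := Nat.exists_eq_add_of_le hkl
    refine (mul_le_mul_right (h.sum_coarse_le (l + m) l i) _).trans ?_
    rw [show l - (l + m) + (l + m - l) = m by omega, e3, e2]
    calc _ = 2048 * B ^ 2 * ((σ * r) ^ (4 * l + m) * r ^ (3 * m)) := by ring
      _ ≤ _ := by
        rw [hσr, one_pow, one_mul]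
        gcongr 2048 * _ * ?_
        exact pow_le_pow_right_of_le_one' hr1 (by omega)

theorem enorm_toLp_sq {f : UnitAddCircle → ℂ} (hf : MemLp f 2) :
    ‖hf.toLp f‖ₑ ^ 2 = ∫⁻ x, ‖f x‖ₑ ^ 2 := by
  rw [Lp.enorm_toLp]
  have := eLpNorm_nnreal_pow_eq_lintegral (f := f) (μ := volume) (p := 2) (by norm_num)
  simpa using this

theorem enorm_coeff_symm (u f : UnitAddCircle → ℂ) :
    ‖∫ x, u x * conj (f x)‖ₑ = ‖∫ x, conj (u x) * f x‖ₑ := by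
  rw [enorm_integral_conj_mul_comm]
  simp_rw [mul_comm]

theorem inner_toLp {u f : UnitAddCircle → ℂ} (hu : MemLp u 2) (hf : MemLp f 2) :
    inner ℂ (hu.toLp u) (hf.toLp f) = ∫ x, conj (u x) * f x := by
  rw [L2.inner_def]
  refine integral_congr_ae ?_
  filter_upwards [hu.coeFn_toLp, hf.coeFn_toLp] with x h1 h2
  rw [h1, h2, RCLike.inner_apply, mul_comm]

/-- The square function is bounded on `L²`. -/
theorem exists_lintegral_tsum_sqTerm_le (B : ℝ≥0) : ∃ A : ℝ≥0,
    ∀ ψ, IsKernelFamily B ψ → ∀ f : UnitAddCircle → ℂ, MemLp f 2 →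
      ∫⁻ x, ∑' k, sqTerm ψ f k x ≤ A * ∫⁻ x, ‖f x‖ₑ ^ 2 := by
  set s : ℝ≥0 := NNReal.sqrt 2 with hs
  have hss : s * s = 2 := NNReal.mul_self_sqrt 2
  have hs1 : 1 < s := by rw [hs, ← NNReal.sqrt_one, NNReal.sqrt_lt_sqrt]; norm_num
  have hs0 : s ≠ 0 := (zero_lt_one.trans hs1).ne'
  set r : ℝ≥0 := s⁻¹ with hr
  have hr1 : r < 1 := inv_lt_one_of_one_lt₀ hs1
  have hrr : ((r : ℝ≥0∞) * r) = 2⁻¹ := by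
    rw [← ENNReal.coe_mul, hr, ← mul_inv, hss, ENNReal.coe_inv (by norm_num)]; rfl
  have hsr : ((s : ℝ≥0∞) * r) = 1 := by
    rw [← ENNReal.coe_mul, hr, mul_inv_cancel₀ hs0, ENNReal.coe_one]
  have hss' : ((s : ℝ≥0∞) * s) = 2 := by rw [← ENNReal.coe_mul, hss]; rfl
  set A' : ℝ≥0∞ := 2048 * B ^ 2 * ((1 + (r : ℝ≥0∞)) * (1 - (r : ℝ≥0∞))⁻¹) with hA'
  have hAtop : A' ≠ ⊤ := by
    have : (1 - (r : ℝ≥0∞))⁻¹ ≠ ⊤ := by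
      rw [ENNReal.inv_ne_top, ne_eq, tsub_eq_zero_iff_le, not_le]
      exact_mod_cast hr1
    exact ENNReal.mul_ne_top (by finiteness) (ENNReal.mul_ne_top (by finiteness) this)
  refine ⟨A'.toNNReal, fun ψ h f hf => ?_⟩
  rw [ENNReal.coe_toNNReal hAtop]
  rw [lintegral_tsum fun k => (measurable_sqTerm ψ f k).aemeasurable]
  refine ENNReal.tsum_le_of_sum_range_le fun n => ?_
  set S : Finset (Σ _ : ℕ, ℕ) := (Finset.range n).sigma fun k => Finset.range (2 ^ k)
  -- The factor `s ^ k = 2^(k/2)` makes `|⟨v, f⟩|²` the measure `2⁻ᵏ` of a cell times the squared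
  -- coefficient there.
  set v : (Σ _ : ℕ, ℕ) → Lp ℂ 2 (volume : Measure UnitAddCircle) :=
    fun p => (((s : ℝ) : ℂ) ^ p.1) • (h.memLp p.1 p.2).toLp (ψ p.1 p.2) with hv
  have hsn : ‖((s : ℝ) : ℂ)‖ₑ = s := by
    rw [← ofReal_norm, Complex.norm_real, Real.norm_of_nonneg s.coe_nonneg]
    exact ENNReal.ofReal_coe_nnreal
  have hvv : ∀ p q, ‖inner ℂ (v p) (v q)‖ₑ
      = s ^ p.1 * s ^ q.1 * ‖∫ x, conj (ψ p.1 p.2 x) * ψ q.1 q.2 x‖ₑ := by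
    intro p q
    rw [hv, inner_smul_left, inner_smul_right, inner_toLp, enorm_mul, enorm_mul,
      RCLike.enorm_conj, enorm_pow, enorm_pow, hsn, mul_assoc]
  have hvf : ∀ p, ‖inner ℂ (v p) (hf.toLp f)‖ₑ
      = s ^ p.1 * ‖∫ x, ψ p.1 p.2 x * conj (f x)‖ₑ := by
    intro p
    rw [hv, inner_smul_left, inner_toLp, enorm_mul,
      RCLike.enorm_conj, enorm_pow, hsn, enorm_coeff_symm]
  have hrow : ∀ p ∈ S, ∑ q ∈ S, ‖inner ℂ (v p) (v q)‖ ≤ A'.toReal := by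
    intro p _
    rw [← ENNReal.ofReal_le_iff_le_toReal hAtop, ENNReal.ofReal_sum_of_nonneg
      (fun _ _ => norm_nonneg _)]
    simp_rw [ofReal_norm, hvv]
    rw [Finset.sum_sigma]
    calc _ ≤ ∑ l ∈ Finset.range n, 2048 * B ^ 2 * (r : ℝ≥0∞) ^ ((l - p.1) + (p.1 - l)) :=
          Finset.sum_le_sum fun l _ => h.weighted_sum_le hss' hrr hsr
            (by exact_mod_cast hr1.le) p.1 p.2 l
      _ ≤ ∑' l, 2048 * B ^ 2 * (r : ℝ≥0∞) ^ ((l - p.1) + (p.1 - l)) := ENNReal.sum_le_tsum _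
      _ ≤ A' := by
          rw [ENNReal.tsum_mul_left, hA']
          gcongr
          exact tsum_pow_sub_add_sub_le r p.1
  have hmain := sum_sq_inner_le S v ENNReal.toReal_nonneg hrow (hf.toLp f)
  calc ∑ k ∈ Finset.range n, ∫⁻ x, sqTerm ψ f k x
      = ∑ p ∈ S, ‖inner ℂ (v p) (hf.toLp f)‖ₑ ^ 2 := by
        rw [Finset.sum_sigma]
        refine Finset.sum_congr rfl fun k _ => ?_
        unfold sqTerm
        rw [lintegral_comp_cellIndex k fun j => coeff ψ f k j ^ 2]
        refine Finset.sum_congr rfl fun j _ => ?_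
        rw [hvf, coeff, mul_pow, mul_pow]
        have : ((s : ℝ≥0∞) ^ k) ^ 2 = 2 ^ k := by rw [← pow_mul, mul_comm, pow_mul, sq, hss']
        rw [this, ← mul_assoc, sq (2 ^ k), ← mul_assoc,
          ENNReal.inv_mul_cancel (by positivity) (by finiteness), one_mul]
    _ = ENNReal.ofReal (∑ p ∈ S, ‖inner ℂ (v p) (hf.toLp f)‖ ^ 2) := by
        rw [ENNReal.ofReal_sum_of_nonneg (fun _ _ => by positivity)]
        refine Finset.sum_congr rfl fun p _ => ?_
        rw [ENNReal.ofReal_pow (norm_nonneg _), ofReal_norm]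
    _ ≤ ENNReal.ofReal (A'.toReal * ‖hf.toLp f‖ ^ 2) := ENNReal.ofReal_le_ofReal hmain
    _ = A' * ∫⁻ x, ‖f x‖ₑ ^ 2 := by
        rw [ENNReal.ofReal_mul ENNReal.toReal_nonneg, ENNReal.ofReal_toReal hAtop,
          ENNReal.ofReal_pow (norm_nonneg _), ofReal_norm, enorm_toLp_sq]

/-! ### The packing estimate -/

theorem add_sq_le_four_mul (a b : ℝ≥0∞) : (a + b) ^ 2 ≤ 4 * (a ^ 2 + b ^ 2) := by
  rcases le_total a b with h | h
  · calc (a + b) ^ 2 ≤ (b + b) ^ 2 := by gcongr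
      _ = 4 * b ^ 2 := by ring
      _ ≤ _ := by gcongr; exact le_add_self
  · calc (a + b) ^ 2 ≤ (a + a) ^ 2 := by gcongr
      _ = 4 * a ^ 2 := by ring
      _ ≤ _ := by gcongr; exact le_self_add

theorem IsKernelFamily.integrable_mul_conj (h : IsKernelFamily B ψ) (k j : ℕ)
    {f : UnitAddCircle → ℂ} (hf : Integrable f) : Integrable fun x => ψ k j x * conj (f x) := by
  refine Integrable.bdd_mul (c := B)
    (hf.congr (Filter.EventuallyEq.refl _ _) |> fun h' => ?_) (h.cont k j).aestronglyMeasurable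
    (Filter.Eventually.of_forall fun x => (h.bound k j x).trans ?_)
  · exact (integrable_norm_iff
      (Complex.continuous_conj.comp_aestronglyMeasurable h'.aestronglyMeasurable)).1
      (by simpa using h'.norm)
  · exact mul_le_of_le_one_right B.2 (pow_le_one₀ (decay_pos _ _ _).le (decay_le_one _ _ _))

theorem IsKernelFamily.sqTerm_add_le (h : IsKernelFamily B ψ) {f g : UnitAddCircle → ℂ}
    (hf : Integrable f) (hg : Integrable g) (k : ℕ) (x : UnitAddCircle) :
    sqTerm ψ (fun y => f y + g y) k x ≤ 4 * (sqTerm ψ f k x + sqTerm ψ g k x) := by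
  refine le_trans ?_ (add_sq_le_four_mul _ _)
  unfold sqTerm coeff
  rw [← mul_add]
  gcongr
  simp_rw [map_add, mul_add]
  rw [integral_add (h.integrable_mul_conj _ _ hf) (h.integrable_mul_conj _ _ hg)]
  exact enorm_add_le _ _

/-- Cauchy–Schwarz with respect to the bump as a weight, whose total mass is at most `16 · 2⁻ᵏ`. -/
theorem sq_lintegral_bump_mul_le (k : ℕ) (c : UnitAddCircle) {F : UnitAddCircle → ℝ≥0∞}
    (hF : Measurable F) :
    (∫⁻ x, bump k x c * F x) ^ 2 ≤ 16 * (2 ^ k)⁻¹ * ∫⁻ x, bump k x c * F x ^ 2 := by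
  set d : UnitAddCircle → ℝ≥0∞ := fun x => ENNReal.ofReal (decay k x c) with hd
  have hdm : Measurable d := ENNReal.measurable_ofReal.comp
    ((continuous_decay k).comp (Continuous.prodMk_left c)).measurable
  have hb : ∀ x, bump k x c = d x ^ 2 := fun x => by
    rw [hd, bump, ENNReal.ofReal_pow (decay_pos _ _ _).le]
  have hH := ENNReal.lintegral_mul_le_Lp_mul_Lq volume Real.HolderConjugate.two_two
    hdm.aemeasurable (hdm.mul hF).aemeasurable
  simp only [Pi.mul_apply, ENNReal.rpow_ofNat] at hH
  calc (∫⁻ x, bump k x c * F x) ^ 2 = (∫⁻ x, d x * (d x * F x)) ^ 2 := by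
        congr 2; funext x; rw [hb]; ring
    _ ≤ ((∫⁻ x, d x ^ 2) ^ (1 / 2 : ℝ) * (∫⁻ x, (d x * F x) ^ 2) ^ (1 / 2 : ℝ)) ^ 2 := by gcongr
    _ = (∫⁻ x, bump k x c) * ∫⁻ x, bump k x c * F x ^ 2 := by
        rw [mul_pow, ← ENNReal.rpow_mul_natCast, ← ENNReal.rpow_mul_natCast]
        simp only [hb, mul_pow]
        norm_num
    _ ≤ _ := by gcongr; exact lintegral_bump_le k c

/-- The kernel's node is within `2 · 2⁻ᵏ` of `c`, so `y` keeps at least a third of its distance to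
`c`. The decay at scale `k + m` is then at most `4 · 2⁻ᵐ` times the decay at scale `k`; cubing gives
`64 · 8⁻ᵐ`. -/
theorem IsKernelFamily.far_enorm_le (h : IsKernelFamily B ψ) {k m i : ℕ} {x y c : UnitAddCircle}
    (hx : x ∈ cell (k + m) i) (hxc : dist x c ≤ ((2 : ℝ) ^ k)⁻¹)
    (hy : 3 * ((2 : ℝ) ^ k)⁻¹ ≤ dist y c) :
    ‖ψ (k + m) i y‖ₑ ≤ 64 * B * (8 ^ m)⁻¹ * bump k y c := by
  set d := dist y c with hd
  have hk : (0 : ℝ) < 2 ^ k := by positivity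
  have hk' : (0 : ℝ) < (2 ^ k)⁻¹ := by positivity
  have hm : (0 : ℝ) < 2 ^ m := by positivity
  have h1 : d / 3 ≤ dist y (node (k + m) i) := by
    have t1 := dist_triangle y (node (k + m) i) c
    have t2 := dist_triangle (node (k + m) i) x c
    have t3 := dist_node_le_of_mem hx
    rw [dist_comm] at t3
    have t4 : ((2 : ℝ) ^ (k + m))⁻¹ ≤ (2 ^ k)⁻¹ := by
      gcongr
      · norm_num
      · omega
    linarith
  have hkd : 3 ≤ 2 ^ k * d := by
    calc (3 : ℝ) = 2 ^ k * (3 * (2 ^ k)⁻¹) := by field_simp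
      _ ≤ _ := by gcongr
  have h2 : decay (k + m) y (node (k + m) i) ≤ 4 * (2 ^ m)⁻¹ * decay k y c := by
    unfold decay
    rw [← hd, show 4 * ((2 : ℝ) ^ m)⁻¹ * (1 + 2 ^ k * d)⁻¹
      = (2 ^ m * (1 + 2 ^ k * d) / 4)⁻¹ by field_simp]
    refine inv_anti₀ (by positivity) ?_
    have : (2 : ℝ) ^ (k + m) * (d / 3) ≤ 2 ^ (k + m) * dist y (node (k + m) i) := by gcongr
    rw [pow_add] at this ⊢
    have h3 : 1 + 2 ^ k * d ≤ 4 / 3 * (2 ^ k * d) := by linarith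
    have := mul_le_mul_of_nonneg_left h3 hm.le
    linarith
  rw [← ofReal_norm, bump]
  have e8 : 64 * (B : ℝ≥0∞) * (8 ^ m)⁻¹ = ENNReal.ofReal (64 * B * (8 ^ m)⁻¹) := by
    rw [ENNReal.ofReal_mul (by positivity), ENNReal.ofReal_mul (by positivity),
      ENNReal.ofReal_inv_of_pos (by positivity), ENNReal.ofReal_pow (by positivity)]
    simp
  rw [e8, ← ENNReal.ofReal_mul (by positivity)]
  refine ENNReal.ofReal_le_ofReal ?_
  have hd0 := (decay_pos k y c).le
  calc ‖ψ (k + m) i y‖ ≤ B * decay (k + m) y (node (k + m) i) ^ 3 := h.bound _ _ _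
    _ ≤ B * (4 * (2 ^ m)⁻¹ * decay k y c) ^ 3 := by
        gcongr
        exact (decay_pos _ _ _).le
    _ = 64 * B * (8 ^ m)⁻¹ * decay k y c ^ 3 := by
        rw [show (8 : ℝ) ^ m = (2 ^ m) ^ 3 by rw [← pow_mul, mul_comm, pow_mul]; norm_num]
        field_simp
        ring
    _ ≤ 64 * B * (8 ^ m)⁻¹ * decay k y c ^ 2 :=
        mul_le_mul_of_nonneg_left
          (pow_le_pow_of_le_one hd0 (decay_le_one _ _ _) (by norm_num)) (by positivity)

theorem measurable_enorm_sq {f : UnitAddCircle → ℂ} (hf : Measurable f) :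
    Measurable fun x => ‖f x‖ₑ ^ 2 := hf.enorm.pow_const 2

/-- The far decay `8⁻ᵐ` beats the normalisation `2^(k+m)` by `4⁻ᵐ`. After squaring, the gain `16⁻ᵐ`
is relaxed to `2⁻ᵐ`, which still sums over the scales; `2¹⁶` is `64²` times the `16` from
Cauchy–Schwarz. -/
theorem IsKernelFamily.far_sqTerm_le (h : IsKernelFamily B ψ) {f : UnitAddCircle → ℂ}
    (hf : Measurable f) {k j : ℕ} (hsupp : ∀ y, dist y (node k j) < 3 * ((2 : ℝ) ^ k)⁻¹ → f y = 0)
    {x : UnitAddCircle} (hx : x ∈ cell k j) (m : ℕ) :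
    sqTerm ψ f (k + m) x ≤ 2 ^ 16 * B ^ 2 * 2 ^ k * (2⁻¹) ^ m *
      ∫⁻ y, bump k y (node k j) * ‖f y‖ₑ ^ 2 := by
  set I := ∫⁻ y, bump k y (node k j) * ‖f y‖ₑ with hI
  have hc : coeff ψ f (k + m) (cellIndex (k + m) x) ≤ 64 * B * 2 ^ k * (4 ^ m)⁻¹ * I := by
    unfold coeff
    calc (2 : ℝ≥0∞) ^ (k + m) * ‖∫ y, ψ (k + m) (cellIndex (k + m) x) y * conj (f y)‖ₑ
        ≤ 2 ^ (k + m) * ∫⁻ y, 64 * B * (8 ^ m)⁻¹ * (bump k y (node k j) * ‖f y‖ₑ) := by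
          gcongr
          refine (enorm_integral_le_lintegral_enorm _).trans (lintegral_mono fun y => ?_)
          rw [enorm_mul, RCLike.enorm_conj, ← mul_assoc]
          rcases lt_or_ge (dist y (node k j)) (3 * ((2 : ℝ) ^ k)⁻¹) with hy | hy
          · rw [hsupp y hy]; simp
          · gcongr
            exact h.far_enorm_le (mem_cell_self _ x) (dist_node_le_of_mem hx) hy
      _ = 2 ^ k * 2 ^ m * (64 * B * (8 ^ m)⁻¹ * I) := by
          rw [lintegral_const_mul' _ _ (ENNReal.mul_ne_top (by finiteness)
            (ENNReal.inv_ne_top.2 (by positivity))), pow_add]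
      _ = 64 * B * 2 ^ k * (4 ^ m)⁻¹ * I * (2 ^ m * (2 ^ m)⁻¹) := by
          rw [show (8 : ℝ≥0∞) = 4 * 2 by norm_num, mul_pow,
            ENNReal.mul_inv (by simp) (by simp)]
          ring
      _ = _ := by rw [ENNReal.mul_inv_cancel (by positivity) (by finiteness), mul_one]
  unfold sqTerm
  calc coeff ψ f (k + m) (cellIndex (k + m) x) ^ 2 ≤ (64 * B * 2 ^ k * (4 ^ m)⁻¹ * I) ^ 2 := by
        gcongr
    _ = 2 ^ 12 * B ^ 2 * 2 ^ k * 2 ^ k * ((4 ^ m)⁻¹) ^ 2 * I ^ 2 := by ring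
    _ ≤ 2 ^ 12 * B ^ 2 * 2 ^ k * 2 ^ k * (2⁻¹) ^ m *
        (16 * (2 ^ k)⁻¹ * ∫⁻ y, bump k y (node k j) * ‖f y‖ₑ ^ 2) := by
        refine mul_le_mul' (mul_le_mul_right ?_ _) (sq_lintegral_bump_mul_le k _ hf.enorm)
        rw [ENNReal.inv_pow, ← pow_mul, mul_comm m 2, pow_mul]
        refine pow_le_pow_left' ?_ m
        rw [← ENNReal.inv_pow, ENNReal.inv_le_inv]
        norm_num
    _ = 2 ^ 16 * B ^ 2 * 2 ^ k * (2⁻¹) ^ m * (∫⁻ y, bump k y (node k j) * ‖f y‖ₑ ^ 2)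
        * (2 ^ k * (2 ^ k)⁻¹) := by ring
    _ = _ := by rw [ENNReal.mul_inv_cancel (by positivity) (by finiteness), mul_one]

theorem one_le_sixteen_mul_bump {k : ℕ} {y c : UnitAddCircle}
    (hy : dist y c < 3 * ((2 : ℝ) ^ k)⁻¹) : 1 ≤ 16 * bump k y c := by
  unfold bump
  rw [show (16 : ℝ≥0∞) = ENNReal.ofReal 16 by simp, ← ENNReal.ofReal_mul (by norm_num),
    ENNReal.one_le_ofReal]
  have h1 : (4 : ℝ)⁻¹ ≤ decay k y c := by
    unfold decay
    refine inv_anti₀ (by positivity) ?_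
    have : 2 ^ k * dist y c ≤ 2 ^ k * (3 * ((2 : ℝ) ^ k)⁻¹) := by gcongr
    have e : 2 ^ k * (3 * ((2 : ℝ) ^ k)⁻¹) = 3 := by field_simp
    linarith
  nlinarith

/-- The Carleson-type packing estimate for the coefficients below a dyadic interval. -/
theorem exists_setLIntegral_cell_tsum_le (B : ℝ≥0) : ∃ A : ℝ≥0,
    ∀ ψ, IsKernelFamily B ψ → ∀ f : UnitAddCircle → ℂ, Measurable f → MemLp f 2 →
      ∀ k j, j < 2 ^ k → ∫⁻ x in cell k j, ∑' m, sqTerm ψ f (k + m) x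
        ≤ A * ∫⁻ y, bump k y (node k j) * ‖f y‖ₑ ^ 2 := by
  obtain ⟨A, hA⟩ := exists_lintegral_tsum_sqTerm_le B
  refine ⟨4 * (16 * A + 2 ^ 17 * B ^ 2), fun ψ h f hfm hf k j hj => ?_⟩
  -- On `E` the bump is at least `1/16`, so the near part follows from the global `L²` bound. The
  -- far part is bounded pointwise on the cell, with a geometric series in the scale.
  set E := {y : UnitAddCircle | dist y (node k j) < 3 * ((2 : ℝ) ^ k)⁻¹} with hE
  have hEm : MeasurableSet E := Metric.isOpen_ball.measurableSet
  set W := ∫⁻ y, bump k y (node k j) * ‖f y‖ₑ ^ 2 with hW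
  set f₁ := E.indicator f with hf₁
  set f₂ := Eᶜ.indicator f with hf₂
  have hf₁m : MemLp f₁ 2 := hf.indicator hEm
  have hf₂m : MemLp f₂ 2 := hf.indicator hEm.compl
  have hff : f = fun y => f₁ y + f₂ y := by
    funext y
    exact (congrFun (Set.indicator_self_add_compl E f) y).symm
  have hnear : ∫⁻ x in cell k j, ∑' m, sqTerm ψ f₁ (k + m) x ≤ 16 * A * W := by
    calc ∫⁻ x in cell k j, ∑' m, sqTerm ψ f₁ (k + m) x
        ≤ ∫⁻ x, ∑' m, sqTerm ψ f₁ m x := by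
          refine (setLIntegral_le_lintegral _ _).trans (lintegral_mono fun x => ?_)
          exact ENNReal.tsum_comp_le_tsum_of_injective (add_right_injective k)
            fun m => sqTerm ψ f₁ m x
      _ ≤ A * ∫⁻ y, ‖f₁ y‖ₑ ^ 2 := hA ψ h f₁ hf₁m
      _ ≤ A * ∫⁻ y, 16 * (bump k y (node k j) * ‖f y‖ₑ ^ 2) := by
          gcongr with y
          rw [hf₁]
          by_cases hy : y ∈ E
          · rw [Set.indicator_of_mem hy, ← mul_assoc]
            exact le_mul_of_one_le_left' (one_le_sixteen_mul_bump hy)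
          · rw [Set.indicator_of_notMem hy]; simp
      _ = _ := by rw [lintegral_const_mul' _ _ (by finiteness)]; ring
  have hfar : ∫⁻ x in cell k j, ∑' m, sqTerm ψ f₂ (k + m) x ≤ 2 ^ 17 * B ^ 2 * W := by
    have hpt : ∀ x ∈ cell k j, ∑' m, sqTerm ψ f₂ (k + m) x ≤ 2 ^ 17 * B ^ 2 * W * 2 ^ k := by
      intro x hx
      calc ∑' m, sqTerm ψ f₂ (k + m) x
          ≤ ∑' m, 2 ^ 16 * B ^ 2 * 2 ^ k * W * (2⁻¹ : ℝ≥0∞) ^ m := by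
            refine ENNReal.tsum_le_tsum fun m => ?_
            refine (h.far_sqTerm_le (hfm.indicator hEm.compl) ?_ hx m).trans ?_
            · intro y hy
              exact Set.indicator_of_notMem (fun hc : y ∈ Eᶜ => hc hy) _
            · rw [mul_right_comm]
              refine mul_le_mul_left (mul_le_mul_right (lintegral_mono fun y => ?_) _) _
              by_cases hy : y ∈ Eᶜ
              · rw [Set.indicator_of_mem hy]
              · rw [Set.indicator_of_notMem hy]; simp
        _ = _ := by
            rw [ENNReal.tsum_mul_left, ENNReal.tsum_geometric, ENNReal.one_sub_inv_two, inv_inv]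
            ring
    refine (setLIntegral_mono' (measurableSet_cell k j) hpt).trans_eq ?_
    rw [lintegral_const, Measure.restrict_apply_univ, volume_cell hj, mul_assoc,
      ENNReal.mul_inv_cancel (by positivity) (by finiteness), mul_one]
  have hmeas : Measurable fun x => ∑' m, sqTerm ψ f₁ (k + m) x :=
    Measurable.tsum fun m => measurable_sqTerm ψ f₁ (k + m)
  calc ∫⁻ x in cell k j, ∑' m, sqTerm ψ f (k + m) x
      ≤ ∫⁻ x in cell k j, 4 * ((∑' m, sqTerm ψ f₁ (k + m) x) + ∑' m, sqTerm ψ f₂ (k + m) x) := by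
        refine lintegral_mono fun x => ?_
        rw [← ENNReal.tsum_add, ← ENNReal.tsum_mul_left]
        refine ENNReal.tsum_le_tsum fun m => ?_
        conv_lhs => rw [hff]
        exact h.sqTerm_add_le (hf₁m.integrable (by norm_num)) (hf₂m.integrable (by norm_num)) _ _
    _ = 4 * ((∫⁻ x in cell k j, ∑' m, sqTerm ψ f₁ (k + m) x)
          + ∫⁻ x in cell k j, ∑' m, sqTerm ψ f₂ (k + m) x) := by
        rw [lintegral_const_mul' _ _ (by finiteness), lintegral_add_left hmeas]
    _ ≤ 4 * (16 * A * W + 2 ^ 17 * B ^ 2 * W) := by gcongr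
    _ = _ := by push_cast; ring

/-- Recentring the bump at any point `x` of the cell costs a factor `4`, so the average is
controlled by the maximal function at every such `x`; then integrate over the cell. The nonlocal
weight becomes an integral over the cell itself, as summation by parts requires. -/
theorem lintegral_bump_le_setLIntegral_maximalFn {F : UnitAddCircle → ℝ≥0∞} (hF : Measurable F)
    {k j : ℕ} (hj : j < 2 ^ k) :
    ∫⁻ y, bump k y (node k j) * F y ≤ 32 * ∫⁻ x in cell k j, maximalFn F x := by
  set W := ∫⁻ y, bump k y (node k j) * F y with hW
  have hpt : ∀ x ∈ cell k j, 2 ^ k * W ≤ 32 * maximalFn F x := by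
    intro x hx
    have hle : W ≤ ∫⁻ y, 4 * (bump k y x * F y) := by
      refine lintegral_mono fun y => ?_
      rw [← mul_assoc]
      gcongr
      refine bump_le_four_mul ?_
      rw [dist_comm]
      exact dist_node_le_of_mem hx
    rw [lintegral_const_mul' _ _ (by finiteness)] at hle
    calc 2 ^ k * W ≤ 2 ^ k * (4 * ∫⁻ y, bump k y x * F y) := by gcongr
      _ = 4 * (2 ^ k * ∫⁻ y, bump k y x * F y) := by ring
      _ ≤ 4 * (8 * maximalFn F x) := mul_le_mul_right (mul_lintegral_bump_le hF k x) _
      _ = _ := by ring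
  calc W = ∫⁻ x in cell k j, 2 ^ k * W := by
        rw [lintegral_const, Measure.restrict_apply_univ, volume_cell hj, mul_right_comm,
          ENNReal.mul_inv_cancel (by positivity) (by finiteness), one_mul]
    _ ≤ ∫⁻ x in cell k j, 32 * maximalFn F x :=
        setLIntegral_mono' (measurableSet_cell k j) hpt
    _ = _ := lintegral_const_mul' _ _ (by finiteness)

/-! ### Carleson embedding and the bound for exponents above two -/

/-- Convexity of the `q`-th power: its graph lies above the tangent at `a + b`. This is Bernoulli's
inequality with `s = -b / (a + b)`. -/
theorem add_rpow_le_rpow_add {q : ℝ} (hq : 1 < q) {a b : ℝ≥0∞} (ha : a ≠ ⊤) (hb : b ≠ ⊤) :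
    (a + b) ^ q ≤ a ^ q + ENNReal.ofReal q * (b * (a + b) ^ (q - 1)) := by
  lift a to ℝ≥0 using ha
  lift b to ℝ≥0 using hb
  have hq1 : 0 ≤ q - 1 := by linarith
  rw [← ENNReal.coe_add, ← ENNReal.coe_rpow_of_nonneg _ (by linarith),
    ← ENNReal.coe_rpow_of_nonneg _ (by linarith), ← ENNReal.coe_rpow_of_nonneg _ hq1,
    ENNReal.ofReal]
  norm_cast
  rw [← NNReal.coe_le_coe]
  push_cast
  rw [Real.coe_toNNReal _ (by linarith)]
  have ha := a.coe_nonneg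
  have hb := b.coe_nonneg
  generalize (a : ℝ) = a at *
  generalize (b : ℝ) = b at *
  rcases (add_nonneg ha hb).eq_or_lt with h0 | h0
  · rw [← h0, Real.zero_rpow (by linarith), Real.zero_rpow (by linarith)]
    positivity
  · have hB := one_add_mul_self_le_rpow_one_add (s := a / (a + b) - 1)
      (by have : 0 ≤ a / (a + b) := by positivity
          linarith) hq.le
    rw [add_sub_cancel, Real.div_rpow ha h0.le, le_div_iff₀ (by positivity)] at hB
    have e : (a + b) ^ q = (a + b) * (a + b) ^ (q - 1) := by
      rw [Real.rpow_sub_one h0.ne']; field_simp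
    have e2 : (1 + q * (a / (a + b) - 1)) * (a + b) ^ q
        = (a + b) ^ q - q * (b * (a + b) ^ (q - 1)) := by
      rw [e]; field_simp; ring
    linarith

/-- A discrete chain rule. The tangent is taken at the larger endpoint, so the partial sum beside `a
k` includes `a k` itself. -/
theorem rpow_sum_le_sum_mul {q : ℝ} (hq : 1 < q) {a : ℕ → ℝ≥0∞} (ha : ∀ k, a k ≠ ⊤) (n : ℕ) :
    (∑ k ∈ Finset.range n, a k) ^ q ≤ ENNReal.ofReal q *
      ∑ k ∈ Finset.range n, a k * (∑ i ∈ Finset.range (k + 1), a i) ^ (q - 1) := by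
  induction n with
  | zero => simp [ENNReal.zero_rpow_of_pos (show 0 < q by linarith)]
  | succ n ih =>
    rw [Finset.sum_range_succ (fun k => a k * (∑ i ∈ Finset.range (k + 1), a i) ^ (q - 1)), mul_add]
    conv_lhs => rw [Finset.sum_range_succ]
    refine (add_rpow_le_rpow_add hq (by simp [ENNReal.sum_eq_top, ha]) (ha n)).trans ?_
    rw [← Finset.sum_range_succ]
    gcongr

theorem exists_comp_cellIndex {h : UnitAddCircle → ℝ≥0∞} {k : ℕ}
    (hh : ∀ x y, cellIndex k x = cellIndex k y → h x = h y) :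
    ∃ g : ℕ → ℝ≥0∞, ∀ x, h x = g (cellIndex k x) := by
  have hf : Function.FactorsThrough h (cellIndex k) := fun x y hxy => hh x y hxy
  exact ⟨Function.extend (cellIndex k) h 0, fun x => (hf.extend_apply 0 x).symm⟩

theorem lintegral_comp_cellIndex_mul (k : ℕ) (g : ℕ → ℝ≥0∞) {Y : UnitAddCircle → ℝ≥0∞}
    (hY : Measurable Y) :
    ∫⁻ x, g (cellIndex k x) * Y x = ∑ j ∈ Finset.range (2 ^ k), g j * ∫⁻ x in cell k j, Y x := by
  rw [lintegral_eq_sum_cell k]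
  refine Finset.sum_congr rfl fun j _ => ?_
  rw [← lintegral_const_mul _ hY]
  refine setLIntegral_congr_fun (measurableSet_cell k j) fun x hx => ?_
  rw [show cellIndex k x = j from hx]

/-- Testing the packing estimate against a function that is constant on dyadic intervals. -/
theorem lintegral_mul_le_of_cell {Y G : UnitAddCircle → ℝ≥0∞} (hY : Measurable Y)
    (hG : Measurable G) {k : ℕ} {C : ℝ≥0∞}
    (hYG : ∀ j < 2 ^ k, ∫⁻ x in cell k j, Y x ≤ C * ∫⁻ x in cell k j, G x)
    {h : UnitAddCircle → ℝ≥0∞} (hh : ∀ x y, cellIndex k x = cellIndex k y → h x = h y) :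
    ∫⁻ x, h x * Y x ≤ C * ∫⁻ x, h x * G x := by
  obtain ⟨g, hg⟩ := exists_comp_cellIndex hh
  simp_rw [hg]
  rw [lintegral_comp_cellIndex_mul k g hY, lintegral_comp_cellIndex_mul k g hG, Finset.mul_sum]
  refine Finset.sum_le_sum fun j hj => ?_
  rw [mul_left_comm]
  gcongr
  exact hYG j (Finset.mem_range.1 hj)

theorem sqTerm_congr (ψ : ℕ → ℕ → UnitAddCircle → ℂ) (f : UnitAddCircle → ℂ) {k l : ℕ}
    (hkl : k ≤ l) {x y : UnitAddCircle} (hxy : cellIndex l x = cellIndex l y) :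
    sqTerm ψ f k x = sqTerm ψ f k y := by
  unfold sqTerm
  rw [cellIndex_eq_of_le hkl hxy]

theorem sqTerm_ne_top (ψ : ℕ → ℕ → UnitAddCircle → ℂ) (f : UnitAddCircle → ℂ) (k : ℕ)
    (x : UnitAddCircle) : sqTerm ψ f k x ≠ ⊤ := by
  unfold sqTerm coeff; finiteness

/-- A Carleson embedding by summation by parts, for an increasing adapted sequence `M`. -/
theorem sum_lintegral_mul_le {a M : ℕ → UnitAddCircle → ℝ≥0∞} {G : UnitAddCircle → ℝ≥0∞}
    {C : ℝ≥0∞} (ha : ∀ k, Measurable (a k)) (hG : Measurable G)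
    (hM : ∀ k x y, cellIndex k x = cellIndex k y → M k x = M k y) (hmono : ∀ x, Monotone (M · x))
    (hpack : ∀ k j, j < 2 ^ k → ∫⁻ x in cell k j, ∑' m, a (k + m) x ≤ C * ∫⁻ x in cell k j, G x)
    (n : ℕ) :
    ∑ k ∈ Finset.range (n + 1), ∫⁻ x, a k x * M k x ≤ C * ∫⁻ x, M n x * G x := by
  -- Increments of `M`, with the term before index zero read as `0`. Each `d i` is constant on cells
  -- of generation `i`, so the packing estimate at that generation can be tested against it.
  set d : ℕ → UnitAddCircle → ℝ≥0∞ := fun i x => M i x - (if i = 0 then 0 else M (i - 1) x) with hd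
  have hdi : ∀ i x y, cellIndex i x = cellIndex i y → d i x = d i y := by
    intro i x y hxy
    rw [hd]
    dsimp only
    rw [hM i x y hxy, hM (i - 1) x y (cellIndex_eq_of_le (Nat.sub_le i 1) hxy)]
  have hdm : ∀ i, Measurable (d i) := by
    intro i
    obtain ⟨g, hg⟩ := exists_comp_cellIndex (hdi i)
    rw [show d i = fun x => g (cellIndex i x) from funext hg]
    exact measurable_comp_cellIndex i g
  have hsum : ∀ k x, M k x = ∑ i ∈ Finset.range (k + 1), d i x := by
    intro k x
    induction k with
    | zero => simp [hd]
    | succ k ih =>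
      rw [Finset.sum_range_succ, ← ih, hd]
      simp only [Nat.add_eq_zero_iff, one_ne_zero, and_false, if_false, Nat.add_sub_cancel]
      exact (add_tsub_cancel_of_le (hmono x k.le_succ)).symm
  have htm : ∀ i, Measurable fun x => ∑' m, a (i + m) x := fun i =>
    Measurable.tsum fun m => ha (i + m)
  have hMm : ∀ k, Measurable (M k) := fun k => by
    rw [show M k = fun x => ∑ i ∈ Finset.range (k + 1), d i x from funext (hsum k)]
    exact Finset.measurable_fun_sum _ fun i _ => hdm i
  calc ∑ k ∈ Finset.range (n + 1), ∫⁻ x, a k x * M k x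
      = ∫⁻ x, ∑ k ∈ Finset.range (n + 1), a k x * M k x :=
        (lintegral_finsetSum _ fun k _ => (ha k).mul (hMm k)).symm
    _ ≤ ∫⁻ x, ∑ i ∈ Finset.range (n + 1), d i x * ∑' m, a (i + m) x := by
        refine lintegral_mono fun x => ?_
        have hswap : ∑ k ∈ Finset.range (n + 1), a k x * M k x
            = ∑ i ∈ Finset.range (n + 1), ∑ k ∈ Finset.Ico i (n + 1), d i x * a k x := by
          simp_rw [hsum, Finset.mul_sum]
          rw [Finset.range_eq_Ico, Finset.sum_sigma', Finset.sum_sigma']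
          refine Finset.sum_bij' (fun p _ => ⟨p.2, p.1⟩) (fun p _ => ⟨p.2, p.1⟩) ?_ ?_ ?_ ?_ ?_
          all_goals simp only [Finset.mem_sigma, Finset.mem_Ico, Finset.mem_range]
          · intro p hp; omega
          · intro p hp; omega
          · intro p hp; trivial
          · intro p hp; trivial
          · intro p hp; ring
        change ∑ k ∈ Finset.range (n + 1), a k x * M k x ≤ _
        rw [hswap]
        gcongr with i hi
        rw [← Finset.mul_sum]
        gcongr
        rw [Finset.sum_Ico_eq_sum_range]
        -- Extending the inner sum to all finer scales produces the quantity in the packing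
        -- hypothesis.
        exact ENNReal.sum_le_tsum _
    _ = ∑ i ∈ Finset.range (n + 1), ∫⁻ x, d i x * ∑' m, a (i + m) x :=
        lintegral_finsetSum _ fun i _ => (hdm i).mul (htm i)
    _ ≤ ∑ i ∈ Finset.range (n + 1), C * ∫⁻ x, d i x * G x :=
        Finset.sum_le_sum fun i _ => lintegral_mul_le_of_cell (htm i) hG (hpack i) (hdi i)
    _ = C * ∫⁻ x, M n x * G x := by
        have hdG : ∀ i, Measurable fun x => d i x * G x := fun i => (hdm i).mul hG
        rw [← Finset.mul_sum, ← lintegral_finsetSum _ fun i _ => hdG i]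
        simp_rw [hsum, Finset.sum_mul]

/-- The square function is bounded on `L^(2q)` for `q > 1`. -/
theorem exists_lintegral_tsum_sqTerm_rpow_le (B : ℝ≥0) {q : ℝ} (hq : 1 < q) : ∃ K : ℝ≥0,
    ∀ ψ, IsKernelFamily B ψ → ∀ f : UnitAddCircle → ℂ, Measurable f → MemLp f 2 →
      ∫⁻ x, (∑' k, sqTerm ψ f k x) ^ q ≤ K * ∫⁻ x, (‖f x‖ₑ ^ 2) ^ q := by
  obtain ⟨A, hA⟩ := exists_setLIntegral_cell_tsum_le B
  obtain ⟨K, hK⟩ := exists_lintegral_maximalFn_rpow_le hq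
  have hq0 : 0 < q := by linarith
  have hq1 : 0 < q - 1 := by linarith
  refine ⟨(q.toNNReal * (A * 32)) ^ q * K, fun ψ h f hfm hf => ?_⟩
  set G := maximalFn fun x => ‖f x‖ₑ ^ 2 with hG
  have hGm : Measurable G := measurable_maximalFn (measurable_enorm_sq hfm)
  have hGq : ∫⁻ x, G x ^ q ≤ K * ∫⁻ x, (‖f x‖ₑ ^ 2) ^ q := hK _ (measurable_enorm_sq hfm)
  set S : ℕ → UnitAddCircle → ℝ≥0∞ := fun n x => ∑ k ∈ Finset.range n, sqTerm ψ f k x with hS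
  have hSm : ∀ n, Measurable (S n) := fun n =>
    Finset.measurable_fun_sum _ fun k _ => measurable_sqTerm ψ f k
  have hScell : ∀ k x y, cellIndex k x = cellIndex k y → S (k + 1) x = S (k + 1) y :=
    fun k x y hxy => Finset.sum_congr rfl fun i hi =>
      sqTerm_congr ψ f (Nat.lt_succ_iff.1 (Finset.mem_range.1 hi)) hxy
  have hSmono : ∀ x, Monotone (S · x) := fun x m n hmn =>
    Finset.sum_le_sum_of_subset (Finset.range_mono hmn)
  have hStop : ∀ n x, S n x ≠ ⊤ := fun n x => by
    simp [hS, ENNReal.sum_eq_top, sqTerm_ne_top]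
  have hpart : ∀ n, ∫⁻ x, S (n + 1) x ^ q ≤ (ENNReal.ofReal q * (A * 32)) ^ q * ∫⁻ x, G x ^ q := by
    intro n
    set D := ENNReal.ofReal q * (A * 32) with hD
    set Y := ∫⁻ x, S (n + 1) x ^ q with hY
    -- A partial sum takes finitely many finite values, one per cell. Finiteness of `Y` is what
    -- permits division by `Y^(1 - 1/q)` below.
    have hYtop : Y ≠ ⊤ := by
      obtain ⟨g, hg⟩ := exists_comp_cellIndex (hScell n)
      have hgt : ∀ j ∈ Finset.range (2 ^ n), (2 ^ n)⁻¹ * g j ^ q ≠ ⊤ := by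
        intro j hj
        have hne : (cell n j).Nonempty := by
          refine nonempty_of_measure_ne_zero (μ := volume) ?_
          rw [volume_cell (Finset.mem_range.1 hj)]
          simp
        obtain ⟨x, hx⟩ := hne
        have := hStop (n + 1) x
        rw [hg, show cellIndex n x = j from hx] at this
        refine ENNReal.mul_ne_top (by simp) (ENNReal.rpow_ne_top_of_nonneg hq0.le this)
      rw [hY]
      simp_rw [hg]
      rw [lintegral_comp_cellIndex n fun j => g j ^ q]
      simpa [ENNReal.sum_eq_top] using hgt
    have h1 : Y ≤ D * ∫⁻ x, S (n + 1) x ^ (q - 1) * G x := by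
      calc Y ≤ ∫⁻ x, ENNReal.ofReal q *
            ∑ k ∈ Finset.range (n + 1), sqTerm ψ f k x * S (k + 1) x ^ (q - 1) :=
            lintegral_mono fun x => rpow_sum_le_sum_mul hq (fun k => sqTerm_ne_top ψ f k x) (n + 1)
        _ = ENNReal.ofReal q * ∑ k ∈ Finset.range (n + 1),
              ∫⁻ x, sqTerm ψ f k x * S (k + 1) x ^ (q - 1) := by
            rw [lintegral_const_mul' _ _ ENNReal.ofReal_ne_top, lintegral_finsetSum]
            exact fun k _ => (measurable_sqTerm ψ f k).mul ((hSm (k + 1)).pow_const _)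
        _ ≤ ENNReal.ofReal q * (A * 32 * ∫⁻ x, S (n + 1) x ^ (q - 1) * G x) := by
            gcongr
            -- `S (k + 1)` involves only the scales up to `k`, so its power is constant on cells of
            -- generation `k` and increases with `k`.
            refine sum_lintegral_mul_le (M := fun k x => S (k + 1) x ^ (q - 1))
              (measurable_sqTerm ψ f) hGm ?_ ?_ ?_ n
            · intro k x y hxy
              rw [hScell k x y hxy]
            · intro x k l hkl
              exact ENNReal.rpow_le_rpow (hSmono x (by omega)) hq1.le
            · intro k j hj
              refine (hA ψ h f hfm hf k j hj).trans ?_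
              rw [mul_assoc]
              gcongr
              exact lintegral_bump_le_setLIntegral_maximalFn (measurable_enorm_sq hfm) hj
        _ = _ := by rw [hD]; ring
    have hconj : Real.HolderConjugate q.conjExponent q :=
      (Real.HolderConjugate.conjExponent hq).symm
    have h2 : ∫⁻ x, S (n + 1) x ^ (q - 1) * G x
        ≤ Y ^ (1 - 1 / q) * (∫⁻ x, G x ^ q) ^ (1 / q) := by
      have := ENNReal.lintegral_mul_le_Lp_mul_Lq volume hconj
        ((hSm (n + 1)).pow_const (q - 1)).aemeasurable hGm.aemeasurable
      have e1 : 1 / q.conjExponent = 1 - 1 / q := by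
        unfold Real.conjExponent; field_simp
      have e2 : (q - 1) * q.conjExponent = q := by
        unfold Real.conjExponent; field_simp
      simp only [Pi.mul_apply, ← ENNReal.rpow_mul, e1, e2] at this
      exact this
    have h3 : Y ≤ Y ^ (1 - 1 / q) * (D * (∫⁻ x, G x ^ q) ^ (1 / q)) := by
      calc Y ≤ D * (Y ^ (1 - 1 / q) * (∫⁻ x, G x ^ q) ^ (1 / q)) := h1.trans (by gcongr)
        _ = _ := by ring
    rcases eq_or_ne Y 0 with h0 | h0
    · rw [h0]; exact zero_le
    · have h4 : Y ^ (1 / q) ≤ D * (∫⁻ x, G x ^ q) ^ (1 / q) := by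
        have hpos : Y ^ (1 - 1 / q) ≠ 0 := (ENNReal.rpow_pos (pos_iff_ne_zero.2 h0) hYtop).ne'
        have hfin : Y ^ (1 - 1 / q) ≠ ⊤ := by
          refine ENNReal.rpow_ne_top_of_nonneg ?_ hYtop
          rw [sub_nonneg, div_le_one hq0]; exact hq.le
        rw [← ENNReal.mul_le_mul_iff_right hpos hfin, ← ENNReal.rpow_add _ _ h0 hYtop]
        simpa using h3
      calc Y = (Y ^ (1 / q)) ^ q := by
            rw [← ENNReal.rpow_mul, one_div_mul_cancel hq0.ne', ENNReal.rpow_one]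
        _ ≤ (D * (∫⁻ x, G x ^ q) ^ (1 / q)) ^ q := by gcongr
        _ = _ := by
            rw [ENNReal.mul_rpow_of_nonneg _ _ hq0.le, ← ENNReal.rpow_mul,
              one_div_mul_cancel hq0.ne', ENNReal.rpow_one]
  have hlim : ∀ x, (∑' k, sqTerm ψ f k x) ^ q = ⨆ n, S (n + 1) x ^ q := by
    intro x
    have hs : ∑' k, sqTerm ψ f k x = ⨆ n, S (n + 1) x := by
      rw [ENNReal.tsum_eq_iSup_nat]
      refine le_antisymm (iSup_mono fun n => hSmono x n.le_succ) ?_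
      exact iSup_le fun n => le_iSup (fun n => S n x) (n + 1)
    rw [hs]
    exact (ENNReal.monotone_rpow_of_nonneg hq0.le).map_iSup_of_continuousAt
      ENNReal.continuous_rpow_const.continuousAt (by simp [hq0])
  simp_rw [hlim]
  rw [lintegral_iSup (fun n => (hSm (n + 1)).pow_const q)
    (fun m n hmn x => ENNReal.rpow_le_rpow (hSmono x (by omega)) hq0.le)]
  refine iSup_le fun n => (hpart n).trans ?_
  rw [ENNReal.coe_mul, ENNReal.coe_rpow_of_nonneg _ hq0.le, mul_assoc]
  push_cast
  gcongr
  exact le_rfl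

/-! ### Dyadic maximal function and Calderón–Zygmund decomposition -/

/-- The average of `F` over the dyadic interval of length `2⁻ᵏ` that contains `x`. -/
noncomputable def dyadicAvg (F : UnitAddCircle → ℝ≥0∞) (k : ℕ) (x : UnitAddCircle) : ℝ≥0∞ :=
  2 ^ k * ∫⁻ y in cell k (cellIndex k x), F y

/-- The dyadic maximal function. -/
noncomputable def dyadicMax (F : UnitAddCircle → ℝ≥0∞) (x : UnitAddCircle) : ℝ≥0∞ :=
  ⨆ k, dyadicAvg F k x

theorem measurable_dyadicAvg (F : UnitAddCircle → ℝ≥0∞) (k : ℕ) : Measurable (dyadicAvg F k) :=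
  measurable_comp_cellIndex k fun j => 2 ^ k * ∫⁻ y in cell k j, F y

theorem measurable_dyadicMax (F : UnitAddCircle → ℝ≥0∞) : Measurable (dyadicMax F) :=
  Measurable.iSup fun k => measurable_dyadicAvg F k

theorem dyadicAvg_zero (F : UnitAddCircle → ℝ≥0∞) (x : UnitAddCircle) :
    dyadicAvg F 0 x = ∫⁻ y, F y := by
  unfold dyadicAvg
  have : cell 0 (cellIndex 0 x) = Set.univ :=
    Set.eq_univ_of_forall fun y => by
      change cellIndex 0 y = cellIndex 0 x
      rw [cellIndex_zero, cellIndex_zero]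
  rw [this, Measure.restrict_univ, pow_zero, one_mul]

theorem dyadicMax_le_maximalFn (F : UnitAddCircle → ℝ≥0∞) (x : UnitAddCircle) :
    dyadicMax F x ≤ maximalFn F x := by
  refine iSup_le fun k => le_trans ?_ (le_maximalFn F x k)
  unfold dyadicAvg
  gcongr
  intro y hy
  have h1 := dist_midpt_le hy
  have h2 := dist_midpt_le (mem_cell_self k x)
  have h3 := dist_triangle_right y x (midpt k (cellIndex k x))
  rw [Metric.mem_closedBall]
  have e : ((2 : ℝ) ^ k)⁻¹ = (2 ^ (k + 1))⁻¹ + (2 ^ (k + 1))⁻¹ := by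
    rw [pow_succ]; field_simp; norm_num
  linarith

/-- The Lebesgue differentiation theorem along dyadic intervals. -/
theorem ae_enorm_le_dyadicMax {f : UnitAddCircle → ℂ} (hf : Integrable f) :
    ∀ᵐ x, ‖f x‖ₑ ≤ dyadicMax (fun y => ‖f y‖ₑ) x := by
  have hL := IsUnifLocDoublingMeasure.ae_tendsto_average (μ := (volume : Measure UnitAddCircle))
    hf.norm.locallyIntegrable 1
  filter_upwards [hL] with x hx
  -- Cells are almost everywhere equal to balls about their midpoints. These balls contain `x`
  -- without being centred there, so differentiation along such off-centre balls is needed.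
  have hlim := hx (l := Filter.atTop) (fun k : ℕ => midpt k (cellIndex k x))
    (fun k : ℕ => ((2 : ℝ) ^ (k + 1))⁻¹) ?_ ?_
  · have h2 := (ENNReal.continuous_ofReal.tendsto _).comp hlim
    rw [ofReal_norm] at h2
    refine le_of_tendsto h2 (Filter.Eventually.of_forall fun k => ?_)
    refine le_trans (le_of_eq ?_) (le_iSup (fun k => dyadicAvg (fun y => ‖f y‖ₑ) k x) k)
    have hae := cell_ae_eq_closedBall (cellIndex_lt k x)
    simp only [Function.comp_apply, dyadicAvg]
    rw [← setAverage_congr hae, ofReal_setAverage hf.norm.integrableOn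
      (Filter.Eventually.of_forall fun y => norm_nonneg _), volume_cell (cellIndex_lt k x),
      ENNReal.div_eq_inv_mul, inv_inv]
    simp_rw [ofReal_norm]
  · refine tendsto_nhdsWithin_iff.2 ⟨?_, Filter.Eventually.of_forall fun k => ?_⟩
    · simp_rw [← inv_pow]
      exact (tendsto_pow_atTop_nhds_zero_of_lt_one (by norm_num) (by norm_num)).comp
        (Filter.tendsto_add_atTop_nat 1)
    · exact Set.mem_Ioi.2 (by positivity)
  · refine Filter.Eventually.of_forall fun k => ?_
    rw [one_mul]
    exact dist_midpt_le (mem_cell_self k x)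

/-- The set of points whose first dyadic average above `t` occurs at scale `k`. -/
def stopSet (F : UnitAddCircle → ℝ≥0∞) (t : ℝ≥0∞) (k : ℕ) : Set UnitAddCircle :=
  {x | t < dyadicAvg F k x ∧ ∀ m < k, dyadicAvg F m x ≤ t}

theorem measurableSet_stopSet (F : UnitAddCircle → ℝ≥0∞) (t : ℝ≥0∞) (k : ℕ) :
    MeasurableSet (stopSet F t k) := by
  have : stopSet F t k = {x | t < dyadicAvg F k x} ∩ ⋂ m, ⋂ (_ : m < k), {x | dyadicAvg F m x ≤ t} := by
    ext x; simp [stopSet]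
  rw [this]
  refine (measurableSet_lt measurable_const (measurable_dyadicAvg F k)).inter ?_
  exact MeasurableSet.iInter fun m => MeasurableSet.iInter fun _ =>
    measurableSet_le (measurable_dyadicAvg F m) measurable_const

theorem stopSet_index_unique {F : UnitAddCircle → ℝ≥0∞} {t : ℝ≥0∞} {k l : ℕ} {x : UnitAddCircle}
    (hk : x ∈ stopSet F t k) (hl : x ∈ stopSet F t l) : k = l := by
  rcases lt_trichotomy k l with h | h | h
  · exact absurd hk.1 (not_lt.2 (hl.2 k h))
  · exact h
  · exact absurd hl.1 (not_lt.2 (hk.2 l h))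

theorem exists_mem_stopSet_iff {F : UnitAddCircle → ℝ≥0∞} {t : ℝ≥0∞} {x : UnitAddCircle} :
    (∃ k, x ∈ stopSet F t k) ↔ t < dyadicMax F x := by
  classical
  constructor
  · rintro ⟨k, hk⟩
    exact hk.1.trans_le (le_iSup (fun k => dyadicAvg F k x) k)
  · intro h
    have hex : ∃ k, t < dyadicAvg F k x := lt_iSup_iff.1 h
    exact ⟨Nat.find hex, Nat.find_spec hex, fun m hm => not_lt.1 (Nat.find_min hex hm)⟩

theorem dyadicAvg_congr (F : UnitAddCircle → ℝ≥0∞) {k l : ℕ} (hkl : k ≤ l) {x y : UnitAddCircle}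
    (hxy : cellIndex l x = cellIndex l y) : dyadicAvg F k x = dyadicAvg F k y := by
  unfold dyadicAvg
  rw [cellIndex_eq_of_le hkl hxy]

theorem mem_stopSet_congr {F : UnitAddCircle → ℝ≥0∞} {t : ℝ≥0∞} {k : ℕ} {x y : UnitAddCircle}
    (hxy : cellIndex k x = cellIndex k y) (hx : x ∈ stopSet F t k) : y ∈ stopSet F t k := by
  refine ⟨?_, fun m hm => ?_⟩
  · rw [← dyadicAvg_congr F le_rfl hxy]; exact hx.1
  · rw [← dyadicAvg_congr F hm.le hxy]; exact hx.2 m hm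

/-- The parent cell was not selected, so its average is at most `t`, and it has twice the measure.
Generation zero is never selected because the total integral is at most `t`. -/
theorem dyadicAvg_le_of_mem_stopSet {F : UnitAddCircle → ℝ≥0∞} {t : ℝ≥0∞} {k : ℕ}
    (hF : ∫⁻ y, F y ≤ t) {x : UnitAddCircle} (hx : x ∈ stopSet F t k) :
    dyadicAvg F k x ≤ 2 * t := by
  cases k with
  | zero => exact absurd hx.1 (not_lt.2 ((dyadicAvg_zero F x).trans_le hF))
  | succ k =>
    have h := hx.2 k k.lt_succ_self
    refine le_trans ?_ (mul_le_mul_right h 2)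
    unfold dyadicAvg
    rw [pow_succ', mul_assoc]
    gcongr
    intro y hy
    exact cellIndex_eq_of_le k.le_succ hy

/-- The Calderón–Zygmund decomposition at height `t`. -/
theorem exists_calderonZygmund {f : UnitAddCircle → ℂ} (hf : Measurable f) (hi : Integrable f)
    {t : ℝ≥0∞} (ht : ∫⁻ y, ‖f y‖ₑ ≤ t) :
    ∃ (g : UnitAddCircle → ℂ) (T : Set (ℕ × ℕ)), Measurable g ∧
      (∀ p ∈ T, p.2 < 2 ^ p.1) ∧
      (T.PairwiseDisjoint fun p => cell p.1 p.2) ∧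
      (⋃ p ∈ T, cell p.1 p.2) = {x | t < dyadicMax (fun y => ‖f y‖ₑ) x} ∧
      (∀ x, dyadicMax (fun y => ‖f y‖ₑ) x ≤ t → g x = f x) ∧
      (∀ p ∈ T, ∀ x ∈ cell p.1 p.2, ‖g x‖ₑ ≤ 2 * t) ∧
      (∀ p ∈ T, ∫ x in cell p.1 p.2, (f x - g x) = 0) ∧
      (∀ p ∈ T, ∫⁻ x in cell p.1 p.2, ‖f x‖ₑ ≤ 2 * t * volume (cell p.1 p.2)) := by
  classical
  set F : UnitAddCircle → ℝ≥0∞ := fun y => ‖f y‖ₑ with hF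
  set a : ℕ → UnitAddCircle → ℂ := fun k x => 2 ^ k * ∫ y in cell k (cellIndex k x), f y with ha
  have ham : ∀ k, Measurable (a k) := fun k =>
    measurable_comp_cellIndex k fun j => (2 : ℂ) ^ k * ∫ y in cell k j, f y
  -- The dyadic martingale of `f`, stopped at the first generation at which the average of `|f|`
  -- exceeds `t`; where this never happens, `f` itself.
  set g : UnitAddCircle → ℂ := fun x =>
    if h : ∃ k, x ∈ stopSet F t k then a (Nat.find h) x else f x with hg
  have hga : ∀ k x, x ∈ stopSet F t k → g x = a k x := by
    intro k x hx
    have hex : ∃ k, x ∈ stopSet F t k := ⟨k, hx⟩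
    rw [hg]
    simp only [dif_pos hex]
    rw [stopSet_index_unique (Nat.find_spec hex) hx]
  have hgf : ∀ x, dyadicMax F x ≤ t → g x = f x := by
    intro x hx
    have hex : ¬ ∃ k, x ∈ stopSet F t k := by
      rw [exists_mem_stopSet_iff]; exact not_lt.2 hx
    rw [hg]
    simp only [dif_neg hex]
  have hmem : ∀ {k j : ℕ}, (k, j) ∈ {p : ℕ × ℕ | p.2 < 2 ^ p.1 ∧ cell p.1 p.2 ⊆ stopSet F t p.1} →
      ∀ x ∈ cell k j, x ∈ stopSet F t k ∧ cellIndex k x = j := fun hp x hx => ⟨hp.2 hx, hx⟩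
  refine ⟨g, {p | p.2 < 2 ^ p.1 ∧ cell p.1 p.2 ⊆ stopSet F t p.1}, ?_, fun p hp => hp.1, ?_, ?_,
    hgf, ?_, ?_, ?_⟩
  · intro s hs
    have e : g ⁻¹' s = (f ⁻¹' s ∩ {x | dyadicMax F x ≤ t})
        ∪ ⋃ k, (stopSet F t k ∩ a k ⁻¹' s) := by
      ext x
      simp only [Set.mem_preimage, Set.mem_union, Set.mem_inter_iff, Set.mem_iUnion,
        Set.mem_ofPred_eq]
      constructor
      · intro hx
        rcases le_or_gt (dyadicMax F x) t with h | h
        · exact Or.inl ⟨by rwa [← hgf x h], h⟩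
        · obtain ⟨k, hk⟩ := exists_mem_stopSet_iff.2 h
          exact Or.inr ⟨k, hk, by rwa [← hga k x hk]⟩
      · rintro (⟨h1, h2⟩ | ⟨k, h1, h2⟩)
        · rwa [hgf x h2]
        · rwa [hga k x h1]
    rw [e]
    refine ((hf hs).inter (measurableSet_le (measurable_dyadicMax F) measurable_const)).union ?_
    exact MeasurableSet.iUnion fun k => (measurableSet_stopSet F t k).inter (ham k hs)
  · rintro ⟨k, i⟩ hp ⟨l, j⟩ hq hne
    refine Set.disjoint_left.2 fun x hx hy => hne ?_
    obtain ⟨h1, h2⟩ := hmem hp x hx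
    obtain ⟨h3, h4⟩ := hmem hq x hy
    obtain rfl := stopSet_index_unique h1 h3
    rw [← h2, ← h4]
  · ext x
    simp only [Set.mem_iUnion, Set.mem_ofPred_eq]
    rw [← exists_mem_stopSet_iff]
    constructor
    · rintro ⟨p, hp, hx⟩
      exact ⟨p.1, hp.2 hx⟩
    · rintro ⟨k, hk⟩
      exact ⟨(k, cellIndex k x), ⟨cellIndex_lt k x, fun y hy => mem_stopSet_congr hy.symm hk⟩,
        mem_cell_self k x⟩
  · rintro ⟨k, j⟩ hp x hx
    obtain ⟨h1, h2⟩ := hmem hp x hx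
    rw [hga k x h1, ha]
    refine le_trans ?_ (dyadicAvg_le_of_mem_stopSet ht h1)
    unfold dyadicAvg
    dsimp only
    rw [enorm_mul, enorm_pow]
    gcongr
    · rw [← ofReal_norm]; simp
    · exact enorm_integral_le_lintegral_enorm _
  · rintro ⟨k, j⟩ hp
    have hcongr : ∫ x in cell k j, (f x - g x)
        = ∫ x in cell k j, (f x - 2 ^ k * ∫ y in cell k j, f y) := by
      refine setIntegral_congr_fun (measurableSet_cell k j) fun x hx => ?_
      obtain ⟨h1, h2⟩ := hmem hp x hx
      rw [hga k x h1, ha]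
      simp only [h2]
    dsimp only
    rw [hcongr, integral_sub hi.integrableOn (integrable_const _), integral_const]
    have hv : (volume.restrict (cell k j)).real Set.univ = (2 ^ k)⁻¹ := by
      rw [Measure.real, Measure.restrict_apply_univ, volume_cell hp.1]
      simp
    rw [hv, Complex.real_smul]
    push_cast
    rw [inv_mul_cancel_left₀ (pow_ne_zero _ two_ne_zero), sub_self]
  · rintro ⟨k, j⟩ hp
    have hne : (cell k j).Nonempty := by
      refine nonempty_of_measure_ne_zero (μ := volume) ?_
      rw [volume_cell hp.1]
      simp
    obtain ⟨x, hx⟩ := hne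
    obtain ⟨h1, h2⟩ := hmem hp x hx
    have h3 := dyadicAvg_le_of_mem_stopSet ht h1
    unfold dyadicAvg at h3
    rw [h2, mul_comm, ← ENNReal.le_div_iff_mul_le (by simp) (by simp), ENNReal.div_eq_inv_mul,
      mul_comm] at h3
    dsimp only
    rwa [volume_cell hp.1]

/-! ### The bad part away from the dilated cells -/

/-- The mean zero of `b` on the cell allows the kernel's value at the node to be subtracted; points
of the cell are within `2⁻ˡ` of that node. This is a gain for kernels coarser than the cell. -/
theorem IsKernelFamily.enorm_setIntegral_le (h : IsKernelFamily B ψ) {b : UnitAddCircle → ℂ}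
    (hb : Integrable b) {l j : ℕ} (hmean : ∫ y in cell l j, b y = 0) (k i : ℕ) :
    ‖∫ y in cell l j, ψ k i y * conj (b y)‖ₑ ≤ ∫⁻ y in cell l j, B * (2 ^ k * (2 ^ l)⁻¹) *
      (bump k y (node k i) + bump k (node l j) (node k i)) * ‖b y‖ₑ := by
  have hconj : ∫ y in cell l j, conj (b y) = 0 := by
    rw [integral_conj, hmean, map_zero]
  have hbc : IntegrableOn (fun y => conj (b y)) (cell l j) := by
    refine Integrable.integrableOn ?_
    exact (integrable_norm_iff
      (Complex.continuous_conj.comp_aestronglyMeasurable hb.aestronglyMeasurable)).1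
      (by simpa using hb.norm)
  have e : ∫ y in cell l j, ψ k i y * conj (b y)
      = ∫ y in cell l j, (ψ k i y - ψ k i (node l j)) * conj (b y) := by
    simp_rw [sub_mul]
    rw [integral_sub (h.integrable_mul_conj k i hb).integrableOn (hbc.const_mul _),
      integral_const_mul, hconj, mul_zero, sub_zero]
  rw [e]
  refine (enorm_integral_le_lintegral_enorm _).trans ?_
  refine setLIntegral_mono' (measurableSet_cell l j) fun y hy => ?_
  rw [enorm_mul, RCLike.enorm_conj]
  gcongr
  refine (h.enorm_sub_le k i y (node l j)).trans ?_
  rw [mul_assoc (B : ℝ≥0∞) (2 ^ k)]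
  gcongr
  rw [← ofReal_two_pow_inv]
  exact ENNReal.ofReal_le_ofReal (dist_node_le_of_mem hy)

/-- For kernels finer than the cell, separation replaces cancellation: of the distance `3 · 2⁻ˡ`,
one `2⁻ˡ` is lost on each side, so `y` stays `2⁻ˡ` away from the kernel's node and one power of
decay becomes `2^(l-k)`. -/
theorem IsKernelFamily.enorm_le_of_far (h : IsKernelFamily B ψ) {k i l j : ℕ} (hlk : l ≤ k)
    {x y : UnitAddCircle} (hx : x ∈ cell k i) (hy : y ∈ cell l j)
    (hfar : 3 * ((2 : ℝ) ^ l)⁻¹ ≤ dist x (node l j)) :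
    ‖ψ k i y‖ₑ ≤ B * (2 ^ l * (2 ^ k)⁻¹) * bump k y (node k i) := by
  have hl : (0 : ℝ) < (2 ^ l)⁻¹ := by positivity
  have h1 : ((2 : ℝ) ^ l)⁻¹ ≤ dist y (node k i) := by
    have t1 := dist_triangle x y (node l j)
    have t2 := dist_triangle_right x y (node k i)
    have t3 := dist_node_le_of_mem hx
    have t4 := dist_node_le_of_mem hy
    have t5 : ((2 : ℝ) ^ k)⁻¹ ≤ (2 ^ l)⁻¹ := by
      gcongr
      norm_num
    linarith
  have h2 : decay k y (node k i) ≤ 2 ^ l * (2 ^ k)⁻¹ := by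
    have := dist_mul_decay_le k y (node k i)
    have h3 : ((2 : ℝ) ^ l)⁻¹ * decay k y (node k i) ≤ (2 ^ k)⁻¹ :=
      (mul_le_mul_of_nonneg_right h1 (decay_pos _ _ _).le).trans this
    rwa [inv_mul_le_iff₀ (by positivity)] at h3
  rw [← ofReal_norm, bump, ← ENNReal.ofReal_coe_nnreal (p := B), ← ofReal_two_pow_inv,
    show (2 : ℝ≥0∞) ^ l = ENNReal.ofReal (2 ^ l) by simp, ← ENNReal.ofReal_mul (by positivity),
    ← ENNReal.ofReal_mul (by positivity), ← ENNReal.ofReal_mul (by positivity)]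
  refine ENNReal.ofReal_le_ofReal ((h.bound k i y).trans ?_)
  calc B * decay k y (node k i) ^ 3
      = B * decay k y (node k i) * decay k y (node k i) ^ 2 := by ring
    _ ≤ B * (2 ^ l * (2 ^ k)⁻¹) * decay k y (node k i) ^ 2 := by gcongr

theorem two_pow_mul_inv_eq {k l : ℕ} (h : k ≤ l) :
    (2 : ℝ≥0∞) ^ k * (2 ^ l)⁻¹ = (2⁻¹) ^ ((k - l) + (l - k)) := by
  obtain ⟨m, rfl⟩ := Nat.exists_eq_add_of_le h
  rw [show k - (k + m) + (k + m - k) = m by omega, pow_add, ENNReal.mul_inv (by simp) (by simp),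
    ← mul_assoc, ENNReal.mul_inv_cancel (by positivity) (by finiteness), one_mul, ENNReal.inv_pow]

-- Coarse kernels gain from the mean zero of `b`, fine ones from separation, and either way the gain
-- is `2^(-|k-l|)`. The restriction to kernels whose cell meets the exterior of the dilate matters
-- only on the fine side.
open scoped Classical in
theorem IsKernelFamily.sum_enorm_setIntegral_le (h : IsKernelFamily B ψ) {b : UnitAddCircle → ℂ}
    (hbm : Measurable b) (hb : Integrable b) {l j : ℕ} (hmean : ∫ y in cell l j, b y = 0) (k : ℕ) :
    ∑ i ∈ (Finset.range (2 ^ k)).filter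
        (fun i => ∃ x ∈ cell k i, 3 * ((2 : ℝ) ^ l)⁻¹ ≤ dist x (node l j)),
      ‖∫ y in cell l j, ψ k i y * conj (b y)‖ₑ
      ≤ 128 * B * (2⁻¹) ^ ((k - l) + (l - k)) * ∫⁻ y in cell l j, ‖b y‖ₑ := by
  rcases le_total k l with hkl | hkl
  · calc _ ≤ ∑ i ∈ Finset.range (2 ^ k), ‖∫ y in cell l j, ψ k i y * conj (b y)‖ₑ :=
          Finset.sum_le_sum_of_subset (Finset.filter_subset _ _)
      _ ≤ ∑ i ∈ Finset.range (2 ^ k), ∫⁻ y in cell l j, B * (2 ^ k * (2 ^ l)⁻¹) *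
            (bump k y (node k i) + bump k (node l j) (node k i)) * ‖b y‖ₑ :=
          Finset.sum_le_sum fun i _ => h.enorm_setIntegral_le hb hmean k i
      _ = ∫⁻ y in cell l j, ∑ i ∈ Finset.range (2 ^ k), B * (2 ^ k * (2 ^ l)⁻¹) *
            (bump k y (node k i) + bump k (node l j) (node k i)) * ‖b y‖ₑ := by
          refine (lintegral_finsetSum _ fun i _ => ?_).symm
          exact (((measurable_bump_left k _).add_const _).const_mul _).mul hbm.enorm
      _ ≤ ∫⁻ y in cell l j, 128 * B * (2⁻¹) ^ ((k - l) + (l - k)) * ‖b y‖ₑ := by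
          refine lintegral_mono fun y => ?_
          rw [← Finset.sum_mul, ← Finset.mul_sum, Finset.sum_add_distrib, two_pow_mul_inv_eq hkl]
          refine mul_le_mul_left ?_ _
          calc _ ≤ (B : ℝ≥0∞) * 2⁻¹ ^ (k - l + (l - k)) * (64 + 64) :=
                mul_le_mul_right (add_le_add (sum_bump_node_le_const k _)
                  (sum_bump_node_le_const k _)) _
            _ = _ := by ring
      _ = _ := lintegral_const_mul' _ _ (by finiteness)
  · calc _ ≤ ∑ i ∈ (Finset.range (2 ^ k)).filter
            (fun i => ∃ x ∈ cell k i, 3 * ((2 : ℝ) ^ l)⁻¹ ≤ dist x (node l j)),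
          ∫⁻ y in cell l j, B * (2 ^ l * (2 ^ k)⁻¹) * bump k y (node k i) * ‖b y‖ₑ := by
          refine Finset.sum_le_sum fun i hi => ?_
          obtain ⟨x, hx, hfar⟩ := (Finset.mem_filter.1 hi).2
          refine (enorm_integral_le_lintegral_enorm _).trans ?_
          refine setLIntegral_mono' (measurableSet_cell l j) fun y hy => ?_
          rw [enorm_mul, RCLike.enorm_conj]
          gcongr
          exact h.enorm_le_of_far hkl hx hy hfar
      _ ≤ ∑ i ∈ Finset.range (2 ^ k),
          ∫⁻ y in cell l j, B * (2 ^ l * (2 ^ k)⁻¹) * bump k y (node k i) * ‖b y‖ₑ :=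
          Finset.sum_le_sum_of_subset (Finset.filter_subset _ _)
      _ = ∫⁻ y in cell l j, ∑ i ∈ Finset.range (2 ^ k),
            B * (2 ^ l * (2 ^ k)⁻¹) * bump k y (node k i) * ‖b y‖ₑ := by
          refine (lintegral_finsetSum _ fun i _ => ?_).symm
          exact ((measurable_bump_left k _).const_mul _).mul hbm.enorm
      _ ≤ ∫⁻ y in cell l j, 128 * B * (2⁻¹) ^ ((k - l) + (l - k)) * ‖b y‖ₑ := by
          refine lintegral_mono fun y => ?_
          rw [← Finset.sum_mul, ← Finset.mul_sum, two_pow_mul_inv_eq hkl, add_comm (l - k)]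
          refine mul_le_mul_left ?_ _
          calc _ ≤ (B : ℝ≥0∞) * 2⁻¹ ^ (k - l + (l - k)) * 128 :=
                mul_le_mul_right ((sum_bump_node_le_const k _).trans (by norm_num)) _
            _ = _ := by ring
      _ = _ := lintegral_const_mul' _ _ (by finiteness)

/-- The union of the dilates of a family of dyadic intervals. -/
def dilatedUnion (T : Set (ℕ × ℕ)) : Set UnitAddCircle :=
  ⋃ p ∈ T, Metric.ball (node p.1 p.2) (3 * ((2 : ℝ) ^ p.1)⁻¹)

theorem measurableSet_dilatedUnion (T : Set (ℕ × ℕ)) : MeasurableSet (dilatedUnion T) :=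
  (isOpen_biUnion fun _ _ => Metric.isOpen_ball).measurableSet

theorem volume_dilatedUnion_le {T : Set (ℕ × ℕ)} (hT : ∀ p ∈ T, p.2 < 2 ^ p.1)
    (hdisj : T.PairwiseDisjoint fun p => cell p.1 p.2) :
    volume (dilatedUnion T) ≤ 6 * volume (⋃ p ∈ T, cell p.1 p.2) := by
  have hc : T.Countable := Set.to_countable T
  rw [measure_biUnion hc hdisj fun p _ => measurableSet_cell _ _, ← ENNReal.tsum_mul_left]
  refine (measure_biUnion_le _ hc _).trans (ENNReal.tsum_le_tsum fun p => ?_)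
  rw [volume_cell (hT p p.2)]
  refine (measure_mono Metric.ball_subset_closedBall).trans ((volume_closedBall_le _ _).trans_eq ?_)
  rw [← mul_assoc, ENNReal.ofReal_mul (by norm_num), ofReal_two_pow_inv]
  norm_num

theorem setLIntegral_comp_cellIndex_le (k : ℕ) (g : ℕ → ℝ≥0∞) (E : Set UnitAddCircle)
    (P : ℕ → Prop) [DecidablePred P] (hP : ∀ x ∈ E, P (cellIndex k x)) (hE : MeasurableSet E) :
    ∫⁻ x in E, g (cellIndex k x) ≤ ∑ i ∈ (Finset.range (2 ^ k)).filter P, (2 ^ k)⁻¹ * g i := by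
  rw [Finset.sum_filter]
  calc ∫⁻ x in E, g (cellIndex k x)
      ≤ ∫⁻ x in E, (fun i => if P i then g i else 0) (cellIndex k x) := by
        refine setLIntegral_mono' hE fun x hx => ?_
        simp [hP x hx]
    _ ≤ ∫⁻ x, (fun i => if P i then g i else 0) (cellIndex k x) := setLIntegral_le_lintegral _ _
    _ = _ := by
        rw [lintegral_comp_cellIndex k fun i => if P i then g i else 0]
        refine Finset.sum_congr rfl fun i _ => ?_
        simp only [mul_ite, mul_zero]

/-- The `L¹` estimate for the bad part away from the dilated intervals. -/
theorem IsKernelFamily.setLIntegral_compl_tsum_coeff_le (h : IsKernelFamily B ψ)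
    {b : UnitAddCircle → ℂ} (hbm : Measurable b) (hb : Integrable b) {T : Set (ℕ × ℕ)}
    (hdisj : T.PairwiseDisjoint fun p => cell p.1 p.2)
    (hsupp : ∀ x, x ∉ ⋃ p ∈ T, cell p.1 p.2 → b x = 0)
    (hmean : ∀ p ∈ T, ∫ x in cell p.1 p.2, b x = 0) :
    ∫⁻ x in (dilatedUnion T)ᶜ, ∑' k, coeff ψ b k (cellIndex k x)
      ≤ 384 * B * ∫⁻ x, ‖b x‖ₑ := by
  classical
  have hc : T.Countable := Set.to_countable T
  have hcm : ∀ p : T, MeasurableSet (cell (p : ℕ × ℕ).1 (p : ℕ × ℕ).2) := fun p =>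
    measurableSet_cell _ _
  have hdisj' : Pairwise (Function.onFun Disjoint fun p : T => cell (p : ℕ × ℕ).1 (p : ℕ × ℕ).2) :=
    fun p q hpq => hdisj p.2 q.2 (fun e => hpq (Subtype.ext e))
  have hsupp' : ∀ x, x ∉ ⋃ p : T, cell (p : ℕ × ℕ).1 (p : ℕ × ℕ).2 → b x = 0 := by
    intro x hx
    refine hsupp x ?_
    rwa [Set.biUnion_eq_iUnion]
  have hcoef : ∀ k i, (2 ^ k)⁻¹ * coeff ψ b k i
      ≤ ∑' p : T, ‖∫ y in cell (p : ℕ × ℕ).1 (p : ℕ × ℕ).2, ψ k i y * conj (b y)‖ₑ := by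
    intro k i
    unfold coeff
    rw [← mul_assoc, ENNReal.inv_mul_cancel (by positivity) (by finiteness), one_mul]
    rw [← setIntegral_eq_integral_of_forall_compl_eq_zero
      (s := ⋃ p : T, cell (p : ℕ × ℕ).1 (p : ℕ × ℕ).2)
      (fun x hx => by rw [hsupp' x hx]; simp),
      integral_iUnion hcm hdisj' (h.integrable_mul_conj k i hb).integrableOn]
    -- The coefficient of `b` splits over the selected cells before its size is taken, so each
    -- cell's cancellation survives.
    exact enorm_tsum_le_tsum_enorm
  calc ∫⁻ x in (dilatedUnion T)ᶜ, ∑' k, coeff ψ b k (cellIndex k x)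
      = ∑' k, ∫⁻ x in (dilatedUnion T)ᶜ, coeff ψ b k (cellIndex k x) :=
        lintegral_tsum fun k => (measurable_comp_cellIndex k (coeff ψ b k)).aemeasurable
    _ ≤ ∑' k, ∑' p : T, 128 * B *
          (2⁻¹) ^ ((k - (p : ℕ × ℕ).1) + ((p : ℕ × ℕ).1 - k)) *
            ∫⁻ y in cell (p : ℕ × ℕ).1 (p : ℕ × ℕ).2, ‖b y‖ₑ := by
        refine ENNReal.tsum_le_tsum fun k => ?_
        refine (setLIntegral_comp_cellIndex_le k (coeff ψ b k) _
          (fun i => ∃ x ∈ cell k i, x ∈ (dilatedUnion T)ᶜ)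
          (fun x hx => ⟨x, mem_cell_self k x, hx⟩) (measurableSet_dilatedUnion T).compl).trans ?_
        refine (Finset.sum_le_sum fun i _ => hcoef k i).trans ?_
        rw [← Summable.tsum_finsetSum fun _ _ => ENNReal.summable]
        refine ENNReal.tsum_le_tsum fun p => ?_
        refine le_trans ?_ (h.sum_enorm_setIntegral_le hbm hb (hmean p p.2) k)
        refine Finset.sum_le_sum_of_subset fun i hi => ?_
        rw [Finset.mem_filter] at hi ⊢
        refine ⟨hi.1, ?_⟩
        obtain ⟨x, hx, hxT⟩ := hi.2
        refine ⟨x, hx, ?_⟩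
        by_contra hcon
        exact hxT (Set.mem_biUnion p.2 (Metric.mem_ball.2 (not_le.1 hcon)))
    _ = ∑' p : T, (128 * B * ∫⁻ y in cell (p : ℕ × ℕ).1 (p : ℕ × ℕ).2, ‖b y‖ₑ) *
          ∑' k : ℕ, (2⁻¹ : ℝ≥0∞) ^ ((k - (p : ℕ × ℕ).1) + ((p : ℕ × ℕ).1 - k)) := by
        rw [ENNReal.tsum_comm]
        refine tsum_congr fun p => ?_
        rw [← ENNReal.tsum_mul_left]
        exact tsum_congr fun k => by ring
    -- The two-sided geometric series with ratio `1/2` is bounded by `(1 + 1/2) · 2 = 3`.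
    _ ≤ ∑' p : T, (128 * B * ∫⁻ y in cell (p : ℕ × ℕ).1 (p : ℕ × ℕ).2, ‖b y‖ₑ) * 3 := by
        refine ENNReal.tsum_le_tsum fun p => mul_le_mul_right ?_ _
        refine (tsum_pow_sub_add_sub_le _ _).trans_eq ?_
        rw [ENNReal.one_sub_inv_two, inv_inv, add_mul, one_mul,
          ENNReal.inv_mul_cancel (by norm_num) (by norm_num)]
        norm_num
    _ = 384 * B * ∑' p : T, ∫⁻ y in cell (p : ℕ × ℕ).1 (p : ℕ × ℕ).2, ‖b y‖ₑ := by
        rw [← ENNReal.tsum_mul_left]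
        exact tsum_congr fun p => by ring
    _ ≤ 384 * B * ∫⁻ x, ‖b x‖ₑ := by
        rw [← lintegral_iUnion hcm hdisj']
        gcongr
        exact Measure.restrict_le_self

/-! ### The distributional estimate -/

/-- Replaces the `ℓ²` sum over scales by an `ℓ¹` sum, which is the quantity the `L¹` estimate for
the bad part controls. -/
theorem tsum_sq_le_sq_tsum (c : ℕ → ℝ≥0∞) : ∑' k, c k ^ 2 ≤ (∑' k, c k) ^ 2 := by
  rw [sq, ← ENNReal.tsum_mul_right]
  refine ENNReal.tsum_le_tsum fun k => ?_
  rw [sq]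
  gcongr
  exact ENNReal.le_tsum k

theorem memLp_two_of_lintegral_ne_top {g : UnitAddCircle → ℂ} (hg : Measurable g)
    (h : ∫⁻ x, ‖g x‖ₑ ^ 2 ≠ ⊤) : MemLp g 2 := by
  refine ⟨hg.aestronglyMeasurable, lt_top_iff_ne_top.2 fun htop => h ?_⟩
  have := eLpNorm_nnreal_pow_eq_lintegral (f := g) (μ := volume) (p := 2) (by norm_num)
  simp only [ENNReal.coe_ofNat, NNReal.coe_ofNat, ENNReal.rpow_ofNat, htop] at this
  rw [← this]
  simp

theorem setLIntegral_biUnion_cell_le {T : Set (ℕ × ℕ)} {F : UnitAddCircle → ℝ≥0∞} {c : ℝ≥0∞}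
    (hdisj : T.PairwiseDisjoint fun p => cell p.1 p.2)
    (hF : ∀ p ∈ T, ∫⁻ x in cell p.1 p.2, F x ≤ c * volume (cell p.1 p.2)) :
    ∫⁻ x in ⋃ p ∈ T, cell p.1 p.2, F x ≤ c * volume (⋃ p ∈ T, cell p.1 p.2) := by
  have hc : T.Countable := Set.to_countable T
  rw [lintegral_biUnion hc (fun p _ => measurableSet_cell _ _) hdisj,
    measure_biUnion hc hdisj fun p _ => measurableSet_cell _ _, ← ENNReal.tsum_mul_left]
  exact ENNReal.tsum_le_tsum fun p => hF p p.2

theorem volume_gt_le_of_lintegral {F : UnitAddCircle → ℝ≥0∞} {E : Set UnitAddCircle}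
    (hF : Measurable F) {t c : ℝ≥0∞} (ht0 : t ≠ 0) (ht : t ≠ ⊤) (h : ∫⁻ x in E, F x ≤ t * c) :
    volume (E ∩ {x | t < F x}) ≤ c := by
  have h1 := mul_meas_ge_le_lintegral₀ (μ := volume.restrict E) hF.aemeasurable t
  have h2 : volume (E ∩ {x | t < F x}) ≤ volume.restrict E {x | t ≤ F x} := by
    rw [Measure.restrict_apply (measurableSet_le measurable_const hF), Set.inter_comm]
    exact measure_mono (Set.inter_subset_inter_left _ fun x (hx : t < F x) => hx.le)
  rw [← ENNReal.mul_le_mul_iff_right ht0 ht]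
  exact (mul_le_mul_right h2 t).trans (h1.trans h)

/-- The distributional estimate for the square function obtained from the Calderón–Zygmund
decomposition. -/
theorem exists_volume_tsum_sqTerm_gt_le (B : ℝ≥0) : ∃ C : ℝ≥0,
    ∀ ψ, IsKernelFamily B ψ → ∀ f : UnitAddCircle → ℂ, Measurable f → Integrable f →
      ∀ t : ℝ≥0∞, t ≠ 0 → t ≠ ⊤ →
        volume {x | t ^ 2 < ∑' k, sqTerm ψ f k x} ≤
          C * (volume {x | t < dyadicMax (fun y => ‖f y‖ₑ) x} +
            (t ^ 2)⁻¹ * ∫⁻ x in {x | dyadicMax (fun y => ‖f y‖ₑ) x ≤ t}, ‖f x‖ₑ ^ 2) := by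
  obtain ⟨A, hA⟩ := exists_lintegral_tsum_sqTerm_le B
  -- The dilates contribute `6`, the good part `32 A` and `8 A`, and the bad part `3 · 384 · 4 =
  -- 4608` times `B`; the slack leaves one constant for both terms.
  refine ⟨7 + 40 * A + 4608 * B, fun ψ h f hfm hf t ht0 ht => ?_⟩
  have ht20 : t ^ 2 ≠ 0 := pow_ne_zero 2 ht0
  have ht2 : t ^ 2 ≠ ⊤ := ENNReal.pow_ne_top ht
  set M := dyadicMax fun y => ‖f y‖ₑ with hM
  have hMm : Measurable M := measurable_dyadicMax _
  set Ω := {x | t < M x} with hΩ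
  set I := ∫⁻ x in {x | M x ≤ t}, ‖f x‖ₑ ^ 2 with hI
  have hΩm : MeasurableSet Ω := measurableSet_lt measurable_const hMm
  have hΩc : Ωᶜ = {x | M x ≤ t} := by ext x; simp [hΩ]
  push_cast
  by_cases hItop : I = ⊤
  · rw [hItop, ENNReal.mul_top (ENNReal.inv_ne_zero.2 ht2), add_top, ENNReal.mul_top]
    · exact le_top
    · positivity
  -- If `t` is below the mean of `|f|`, the average at generation zero already exceeds `t`, so `Ω`
  -- is the whole circle and the bound is trivial.
  rcases lt_or_ge t (∫⁻ y, ‖f y‖ₑ) with hlt | hle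
  · have huniv : Ω = Set.univ := Set.eq_univ_of_forall fun x => by
      refine lt_of_lt_of_le ?_ (le_iSup (fun k => dyadicAvg (fun y => ‖f y‖ₑ) k x) 0)
      rwa [dyadicAvg_zero]
    calc volume {x | t ^ 2 < ∑' k, sqTerm ψ f k x} ≤ 1 * (volume Ω + 0) := by
          rw [huniv, one_mul, add_zero]; exact measure_mono (Set.subset_univ _)
      _ ≤ _ := by
          gcongr
          · rw [add_assoc]
            exact le_add_right (by norm_num)
          · exact zero_le
  obtain ⟨g, T, hgm, hT, hdisj, hunion, hgf, hgle, hmean, hfle⟩ :=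
    exists_calderonZygmund hfm hf hle
  replace hunion : ⋃ p ∈ T, cell p.1 p.2 = Ω := hunion
  set b : UnitAddCircle → ℂ := fun x => f x - g x with hb
  have hbm : Measurable b := hfm.sub hgm
  have hg2 : ∫⁻ x, ‖g x‖ₑ ^ 2 ≤ 4 * t ^ 2 * volume Ω + I := by
    rw [← lintegral_add_compl _ hΩm, hΩc]
    refine add_le_add ?_ ?_
    · rw [← hunion]
      refine setLIntegral_biUnion_cell_le hdisj fun p hp => ?_
      rw [← setLIntegral_const]
      refine setLIntegral_mono' (measurableSet_cell _ _) fun x hx => ?_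
      calc ‖g x‖ₑ ^ 2 ≤ (2 * t) ^ 2 := by gcongr; exact hgle p hp x hx
        _ = _ := by ring
    · refine setLIntegral_mono' (measurableSet_le hMm measurable_const) fun x hx => ?_
      rw [hgf x hx]
  have hgL2 : MemLp g 2 := memLp_two_of_lintegral_ne_top hgm
    (ne_top_of_le_ne_top (by finiteness) hg2)
  have hgi : Integrable g := hgL2.integrable (by norm_num)
  have hbi : Integrable b := hf.sub hgi
  have hbsupp : ∀ x, x ∉ ⋃ p ∈ T, cell p.1 p.2 → b x = 0 := by
    intro x hx
    rw [hunion] at hx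
    exact sub_eq_zero.2 (hgf x (not_lt.1 hx)).symm
  have hbL1 : ∫⁻ x, ‖b x‖ₑ ≤ 4 * t * volume Ω := by
    have hzero : ∫⁻ x in (⋃ p ∈ T, cell p.1 p.2)ᶜ, ‖b x‖ₑ = 0 := by
      rw [← lintegral_zero (μ := volume.restrict (⋃ p ∈ T, cell p.1 p.2)ᶜ)]
      refine setLIntegral_congr_fun (by rw [hunion]; exact hΩm.compl) fun x hx => ?_
      simp [hbsupp x hx]
    rw [← lintegral_add_compl _ (show MeasurableSet (⋃ p ∈ T, cell p.1 p.2) by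
      rw [hunion]; exact hΩm), hzero, add_zero]
    refine (setLIntegral_biUnion_cell_le hdisj (c := 4 * t) fun p hp => ?_).trans_eq (by rw [hunion])
    calc ∫⁻ x in cell p.1 p.2, ‖b x‖ₑ ≤ ∫⁻ x in cell p.1 p.2, (‖f x‖ₑ + 2 * t) := by
          refine setLIntegral_mono' (measurableSet_cell _ _) fun x hx => ?_
          exact enorm_sub_le.trans (by gcongr; exact hgle p hp x hx)
      _ = (∫⁻ x in cell p.1 p.2, ‖f x‖ₑ) + 2 * t * volume (cell p.1 p.2) := by
          rw [lintegral_add_left hfm.enorm, setLIntegral_const]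
      _ ≤ 2 * t * volume (cell p.1 p.2) + 2 * t * volume (cell p.1 p.2) := by
          gcongr; exact hfle p hp
      _ = _ := by ring
  have hfgb : f = fun x => g x + b x := by funext x; simp [hb]
  have hsqm : ∀ u : UnitAddCircle → ℂ, Measurable fun x => ∑' k, sqTerm ψ u k x := fun u =>
    Measurable.tsum fun k => measurable_sqTerm ψ u k
  set X : UnitAddCircle → ℝ≥0∞ := fun x => ∑' k, coeff ψ b k (cellIndex k x) with hX
  have hXm : Measurable X := Measurable.tsum fun k => measurable_comp_cellIndex k (coeff ψ b k)
  -- The larger of the good and bad sums accounts for the total with factor `8`; rounding `8` up to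
  -- `3²` gives the threshold `3 * X x` for the bad part.
  have hsplit : {x | t ^ 2 < ∑' k, sqTerm ψ f k x} ⊆
      (Set.univ ∩ {x | t ^ 2 < 8 * ∑' k, sqTerm ψ g k x}) ∪
        (dilatedUnion T ∪ ((dilatedUnion T)ᶜ ∩ {x | t < 3 * X x})) := by
    intro x hx
    have h1 : ∑' k, sqTerm ψ f k x
        ≤ 4 * ((∑' k, sqTerm ψ g k x) + ∑' k, sqTerm ψ b k x) := by
      rw [← ENNReal.tsum_add, ← ENNReal.tsum_mul_left]
      refine ENNReal.tsum_le_tsum fun k => ?_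
      conv_lhs => rw [hfgb]
      exact h.sqTerm_add_le hgi hbi k x
    have h2 : t ^ 2 < 4 * ((∑' k, sqTerm ψ g k x) + ∑' k, sqTerm ψ b k x) := lt_of_lt_of_le hx h1
    rcases le_total (∑' k, sqTerm ψ b k x) (∑' k, sqTerm ψ g k x) with hbg | hbg
    · refine Or.inl ⟨trivial, h2.trans_le ?_⟩
      calc _ ≤ 4 * ((∑' k, sqTerm ψ g k x) + ∑' k, sqTerm ψ g k x) := by gcongr
        _ = _ := by ring
    · refine Or.inr ?_
      by_cases hxT : x ∈ dilatedUnion T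
      · exact Or.inl hxT
      · refine Or.inr ⟨hxT, ?_⟩
        by_contra hcon
        have hcon : 3 * X x ≤ t := not_lt.1 hcon
        refine absurd h2 (not_lt.2 ?_)
        calc _ ≤ 4 * ((∑' k, sqTerm ψ b k x) + ∑' k, sqTerm ψ b k x) := by gcongr
          _ = 8 * ∑' k, sqTerm ψ b k x := by ring
          _ ≤ 9 * (X x) ^ 2 := by
              gcongr
              · norm_num
              · exact tsum_sq_le_sq_tsum _
          _ = (3 * X x) ^ 2 := by ring
          _ ≤ t ^ 2 := by gcongr
  have hgood : volume (Set.univ ∩ {x | t ^ 2 < 8 * ∑' k, sqTerm ψ g k x})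
      ≤ 32 * A * volume Ω + 8 * A * ((t ^ 2)⁻¹ * I) := by
    refine volume_gt_le_of_lintegral ((hsqm g).const_mul 8) ht20 ht2 ?_
    rw [Measure.restrict_univ, lintegral_const_mul' _ _ (by finiteness)]
    calc 8 * ∫⁻ x, ∑' k, sqTerm ψ g k x ≤ 8 * (A * (4 * t ^ 2 * volume Ω + I)) := by
          gcongr
          exact (hA ψ h g hgL2).trans (by gcongr)
      _ = t ^ 2 * (32 * A * volume Ω) + 8 * A * (t ^ 2 * (t ^ 2)⁻¹) * I := by
          rw [ENNReal.mul_inv_cancel ht20 ht2]; ring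
      _ = _ := by ring
  have hbad : volume ((dilatedUnion T)ᶜ ∩ {x | t < 3 * X x}) ≤ 4608 * B * volume Ω := by
    refine volume_gt_le_of_lintegral (hXm.const_mul 3) ht0 ht ?_
    rw [lintegral_const_mul' _ _ (by finiteness)]
    calc 3 * ∫⁻ x in (dilatedUnion T)ᶜ, X x ≤ 3 * (384 * B * (4 * t * volume Ω)) := by
          gcongr
          exact (h.setLIntegral_compl_tsum_coeff_le hbm hbi hdisj hbsupp hmean).trans (by gcongr)
      _ = _ := by ring
  have hdil : volume (dilatedUnion T) ≤ 6 * volume Ω := by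
    rw [← hunion]; exact volume_dilatedUnion_le hT hdisj
  calc volume {x | t ^ 2 < ∑' k, sqTerm ψ f k x}
      ≤ (32 * A * volume Ω + 8 * A * ((t ^ 2)⁻¹ * I)) + (6 * volume Ω + 4608 * B * volume Ω) := by
        refine (measure_mono hsplit).trans ((measure_union_le _ _).trans ?_)
        exact add_le_add hgood ((measure_union_le _ _).trans (add_le_add hdil hbad))
    _ = (6 + 32 * A + 4608 * B) * volume Ω + 8 * A * ((t ^ 2)⁻¹ * I) := by ring
    _ ≤ (7 + 40 * A + 4608 * B) * volume Ω + (7 + 40 * A + 4608 * B) * ((t ^ 2)⁻¹ * I) := by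
        gcongr
        · norm_num
        · norm_num
        · calc (8 : ℝ≥0∞) * A ≤ 40 * A := by gcongr; norm_num
            _ ≤ 7 + 40 * A + 4608 * B := by
              rw [add_comm 7, add_assoc]; exact le_self_add
    _ = _ := by rw [← mul_add]

/-! ### The bound for exponents between one and two -/

/-- The tail `∫_X^∞ p t^(p-3) dt` converges because `p < 2`. At `X = 0` the right-hand side is
infinite, and at `X = ∞` the left-hand side vanishes. -/
theorem setLIntegral_rpow_of_le {p : ℝ} (hp0 : 0 < p) (hp : p < 2) (X : ℝ≥0∞) :
    ∫⁻ t in Set.Ioi (0 : ℝ), {t : ℝ | X ≤ ENNReal.ofReal t}.indicator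
      (fun t => ENNReal.ofReal (p * t ^ (p - 3))) t ≤ ENNReal.ofReal (p / (2 - p)) * X ^ (p - 2) := by
  have hp2 : 0 < 2 - p := by linarith
  have hc : ENNReal.ofReal (p / (2 - p)) ≠ 0 := by
    rw [ne_eq, ENNReal.ofReal_eq_zero, not_le]; positivity
  induction X with
  | top => simp
  | coe x =>
    rcases eq_or_ne x 0 with rfl | hx
    · rw [ENNReal.coe_zero, ENNReal.zero_rpow_of_neg (by linarith), ENNReal.mul_top hc]
      exact le_top
    have hx0 : (0 : ℝ) < x := by positivity
    have hset : {t : ℝ | (x : ℝ≥0∞) ≤ ENNReal.ofReal t} ∩ Set.Ioi 0 = Set.Ici (x : ℝ) := by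
      ext t
      simp only [Set.mem_inter_iff, Set.mem_ofPred_eq, Set.mem_Ioi, Set.mem_Ici]
      constructor
      · rintro ⟨h1, h2⟩
        rwa [← ENNReal.ofReal_coe_nnreal, ENNReal.ofReal_le_ofReal_iff h2.le] at h1
      · intro h1
        have h2 : 0 < t := hx0.trans_le h1
        refine ⟨?_, h2⟩
        rwa [← ENNReal.ofReal_coe_nnreal, ENNReal.ofReal_le_ofReal_iff h2.le]
    rw [setLIntegral_indicator (measurableSet_le measurable_const ENNReal.measurable_ofReal), hset,
      ← setLIntegral_congr (Ioi_ae_eq_Ici (α := ℝ)), ← ofReal_integral_eq_lintegral_ofReal]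
    · rw [integral_const_mul, integral_Ioi_rpow_of_lt (by linarith) hx0,
        ← ENNReal.ofReal_coe_nnreal (p := x), ENNReal.ofReal_rpow_of_pos hx0,
        ← ENNReal.ofReal_mul (by positivity)]
      refine le_of_eq ?_
      congr 1
      rw [show p - 3 + 1 = p - 2 by ring, show p - 2 = -(2 - p) by ring]
      field_simp
    · exact (integrableOn_Ioi_rpow_of_lt (by linarith) hx0).const_mul p
    · filter_upwards [ae_restrict_mem measurableSet_Ioi] with t ht
      have : 0 < t := hx0.trans ht
      positivity

/-- The square function is bounded on `L^p` for `1 < p < 2`. -/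
theorem exists_lintegral_tsum_sqTerm_rpow_le_of_lt_two (B : ℝ≥0) {p : ℝ} (hp1 : 1 < p)
    (hp2 : p < 2) : ∃ K : ℝ≥0,
    ∀ ψ, IsKernelFamily B ψ → ∀ f : UnitAddCircle → ℂ, Measurable f → Integrable f →
      ∫⁻ x, (∑' k, sqTerm ψ f k x) ^ (p / 2) ≤ K * ∫⁻ x, ‖f x‖ₑ ^ p := by
  obtain ⟨C, hC⟩ := exists_volume_tsum_sqTerm_gt_le B
  obtain ⟨K, hK⟩ := exists_lintegral_maximalFn_rpow_le hp1
  have hp0 : 0 < p := by linarith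
  refine ⟨C * (1 + (p / (2 - p)).toNNReal) * K, fun ψ h f hfm hf => ?_⟩
  set M := dyadicMax fun y => ‖f y‖ₑ with hM
  have hMm : Measurable M := measurable_dyadicMax _
  set S : UnitAddCircle → ℝ≥0∞ := fun x => ∑' k, sqTerm ψ f k x with hS
  have hSm : Measurable S := Measurable.tsum fun k => measurable_sqTerm ψ f k
  have hMp : ∫⁻ x, M x ^ p ≤ K * ∫⁻ x, ‖f x‖ₑ ^ p := by
    refine le_trans (lintegral_mono fun x => ?_) (hK _ hfm.enorm)
    exact ENNReal.rpow_le_rpow (dyadicMax_le_maximalFn _ x) hp0.le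
  -- Fubini turns the good-part term into a multiple of `∫ M^(p-2) |f|²`; since `|f| ≤ M` almost
  -- everywhere, this is at most a multiple of `∫ M^p`.
  have hswap : ∫⁻ t in Set.Ioi (0 : ℝ), ∫⁻ x, {z : ℝ × UnitAddCircle | M z.2 ≤ ENNReal.ofReal z.1}.indicator
        (fun z => ENNReal.ofReal (p * z.1 ^ (p - 3)) * ‖f z.2‖ₑ ^ 2) (t, x)
      ≤ ENNReal.ofReal (p / (2 - p)) * ∫⁻ x, M x ^ p := by
    have hmeas : Measurable ({z : ℝ × UnitAddCircle | M z.2 ≤ ENNReal.ofReal z.1}.indicator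
        (fun z => ENNReal.ofReal (p * z.1 ^ (p - 3)) * ‖f z.2‖ₑ ^ 2)) := by
      refine Measurable.indicator ?_ (measurableSet_le (hMm.comp measurable_snd)
        (ENNReal.measurable_ofReal.comp measurable_fst))
      exact Measurable.mul (by fun_prop) ((measurable_enorm_sq hfm).comp measurable_snd)
    rw [lintegral_lintegral_swap (f := fun (t : ℝ) (x : UnitAddCircle) =>
      {z : ℝ × UnitAddCircle | M z.2 ≤ ENNReal.ofReal z.1}.indicator
        (fun z => ENNReal.ofReal (p * z.1 ^ (p - 3)) * ‖f z.2‖ₑ ^ 2) (t, x)) hmeas.aemeasurable,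
      ← lintegral_const_mul' _ _ ENNReal.ofReal_ne_top]
    refine lintegral_mono_ae ?_
    filter_upwards [ae_enorm_le_dyadicMax hf] with x hx
    calc ∫⁻ t in Set.Ioi (0 : ℝ), {z : ℝ × UnitAddCircle | M z.2 ≤ ENNReal.ofReal z.1}.indicator
          (fun z => ENNReal.ofReal (p * z.1 ^ (p - 3)) * ‖f z.2‖ₑ ^ 2) (t, x)
        = (∫⁻ t in Set.Ioi (0 : ℝ), {t : ℝ | M x ≤ ENNReal.ofReal t}.indicator
            (fun t => ENNReal.ofReal (p * t ^ (p - 3))) t) * ‖f x‖ₑ ^ 2 := by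
          rw [← lintegral_mul_const' _ _ (by finiteness)]
          refine lintegral_congr fun t => ?_
          by_cases hy : M x ≤ ENNReal.ofReal t
          · rw [Set.indicator_of_mem (by exact hy), Set.indicator_of_mem (by exact hy)]
          · rw [Set.indicator_of_notMem (by exact hy), Set.indicator_of_notMem (by exact hy),
              zero_mul]
      _ ≤ ENNReal.ofReal (p / (2 - p)) * M x ^ (p - 2) * ‖f x‖ₑ ^ 2 := by
          gcongr
          exact setLIntegral_rpow_of_le hp0 hp2 (M x)
      _ ≤ ENNReal.ofReal (p / (2 - p)) * M x ^ p := by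
          rw [mul_assoc]
          gcongr
          rcases eq_or_ne (M x) 0 with h0 | h0
          · have hf0 : ‖f x‖ₑ = 0 := le_antisymm (hx.trans_eq h0) zero_le
            rw [hf0]; simp
          rcases eq_or_ne (M x) ⊤ with ht | ht
          · rw [ht, ENNReal.top_rpow_of_neg (by linarith), zero_mul]; exact zero_le
          calc M x ^ (p - 2) * ‖f x‖ₑ ^ 2 ≤ M x ^ (p - 2) * M x ^ 2 := by gcongr
            _ = M x ^ p := by
              rw [← ENNReal.rpow_natCast, ← ENNReal.rpow_add _ _ h0 ht]
              norm_num
  calc ∫⁻ x, S x ^ (p / 2) = ∫⁻ x, (S x ^ (2 : ℝ)⁻¹) ^ p := by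
        refine lintegral_congr fun x => ?_
        rw [← ENNReal.rpow_mul]
        congr 1; ring
    _ = ∫⁻ t in Set.Ioi (0 : ℝ),
          ENNReal.ofReal (p * t ^ (p - 1)) * volume {x | ENNReal.ofReal t < S x ^ (2 : ℝ)⁻¹} :=
        lintegral_rpow_eq_layercake hp0 (hSm.pow_const _)
    _ ≤ ∫⁻ t in Set.Ioi (0 : ℝ), C * (ENNReal.ofReal (p * t ^ (p - 1)) *
          volume {x | ENNReal.ofReal t < M x} +
          ∫⁻ x, {z : ℝ × UnitAddCircle | M z.2 ≤ ENNReal.ofReal z.1}.indicator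
            (fun z => ENNReal.ofReal (p * z.1 ^ (p - 3)) * ‖f z.2‖ₑ ^ 2) (t, x)) := by
        refine setLIntegral_mono' measurableSet_Ioi fun t ht => ?_
        have ht : 0 < t := ht
        have hd := hC ψ h f hfm hf (ENNReal.ofReal t) (by simpa using ht) ENNReal.ofReal_ne_top
        have hset : {x | ENNReal.ofReal t < S x ^ (2 : ℝ)⁻¹} = {x | ENNReal.ofReal t ^ 2 < S x} := by
          ext x
          simp only [Set.mem_ofPred_eq]
          rw [ENNReal.lt_rpow_inv_iff two_pos, ENNReal.rpow_ofNat]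
        rw [hset]
        refine (mul_le_mul_right hd _).trans_eq ?_
        rw [mul_left_comm, mul_add]
        congr 2
        rw [← lintegral_indicator (measurableSet_le hMm measurable_const), ← mul_assoc,
          ← ENNReal.ofReal_pow ht.le, ← ENNReal.ofReal_inv_of_pos (by positivity),
          ← ENNReal.ofReal_mul (by positivity)]
        have e : p * t ^ (p - 1) * (t ^ 2)⁻¹ = p * t ^ (p - 3) := by
          rw [show p - 1 = p - 3 + 2 by ring, Real.rpow_add ht, Real.rpow_ofNat]
          field_simp
        rw [e, ← lintegral_const_mul' _ _ ENNReal.ofReal_ne_top]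
        refine lintegral_congr fun x => ?_
        by_cases hy : M x ≤ ENNReal.ofReal t
        · rw [Set.indicator_of_mem (by exact hy), Set.indicator_of_mem (by exact hy)]
        · rw [Set.indicator_of_notMem (by exact hy), Set.indicator_of_notMem (by exact hy),
            mul_zero]
    _ ≤ C * ((∫⁻ x, M x ^ p) + ENNReal.ofReal (p / (2 - p)) * ∫⁻ x, M x ^ p) := by
        rw [lintegral_const_mul' _ _ (by finiteness), lintegral_add_left,
          ← lintegral_rpow_eq_layercake hp0 hMm]
        · gcongr
        · refine Measurable.mul (by fun_prop) ?_
          -- The distribution function is measurable in `t` because it is monotone.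
          have hanti : Antitone fun t : ℝ => volume {x | ENNReal.ofReal t < M x} := fun s t hst =>
            measure_mono fun x hx => (ENNReal.ofReal_le_ofReal hst).trans_lt hx
          exact hanti.measurable
    _ = C * (1 + ENNReal.ofReal (p / (2 - p))) * ∫⁻ x, M x ^ p := by ring
    _ ≤ C * (1 + ENNReal.ofReal (p / (2 - p))) * (K * ∫⁻ x, ‖f x‖ₑ ^ p) := by gcongr
    _ = _ := by
        rw [ENNReal.coe_mul, ENNReal.coe_mul, ENNReal.coe_add, ENNReal.coe_one, mul_assoc, mul_assoc,
          mul_assoc]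
        rfl

/-! ### From adapted families to kernel families -/

/-- Shifting one lift by the nearest integer realises the circle distance on the line. The mean
value inequality can then be used along the shortest arc. -/
theorem exists_coe_eq_abs_sub_eq_dist (x y : UnitAddCircle) :
    ∃ s t : ℝ, (s : UnitAddCircle) = x ∧ (t : UnitAddCircle) = y ∧ |s - t| = dist x y := by
  obtain ⟨s, rfl⟩ := QuotientAddGroup.mk_surjective x
  obtain ⟨u, rfl⟩ := QuotientAddGroup.mk_surjective y
  refine ⟨s, u + round (s - u), rfl, ?_, ?_⟩
  · have : ((round (s - u) : ℝ) : UnitAddCircle) = 0 := by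
      rw [AddCircle.coe_eq_zero_iff]
      exact ⟨round (s - u), by simp⟩
    rw [AddCircle.coe_add, this, add_zero]
  · have h := UnitAddCircle.norm_eq (x := s - u)
    rw [dist_eq_norm]
    rw [← sub_sub, ← h]
    rfl

variable {C : ℕ → ℝ} {I : DyadicInterval} {φ : UnitAddCircle → ℂ}

/-- Measuring from the left endpoint instead of from the interval adds at most one length, hence a
factor `2` in the base and `8 = 2³` in the cube. -/
theorem one_add_div_length_inv_pow_le (I : DyadicInterval) (x : UnitAddCircle) :
    ((1 + Metric.infDist x I.toSet / I.length) ^ 3)⁻¹ ≤ 8 * decay I.k x (node I.k I.j) ^ 3 := by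
  have h1 := dist_node_le_infDist_add I x
  have h0 : 0 ≤ Metric.infDist x I.toSet := Metric.infDist_nonneg
  have hk : (0 : ℝ) < 2 ^ I.k := by positivity
  have hl : Metric.infDist x I.toSet / I.length = 2 ^ I.k * Metric.infDist x I.toSet := by
    unfold DyadicInterval.length; field_simp
  have h2 : 2 ^ I.k * dist x (node I.k I.j) ≤ 2 ^ I.k * Metric.infDist x I.toSet + 1 := by
    have := mul_le_mul_of_nonneg_left h1 hk.le
    unfold DyadicInterval.length at this
    rwa [mul_add, mul_inv_cancel₀ hk.ne'] at this
  have h3 : (1 + Metric.infDist x I.toSet / I.length)⁻¹ ≤ 2 * decay I.k x (node I.k I.j) := by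
    unfold decay
    rw [hl, ← div_eq_mul_inv, le_div_iff₀ (by positivity), inv_mul_le_iff₀ (by positivity)]
    nlinarith [mul_nonneg hk.le h0]
  calc ((1 + Metric.infDist x I.toSet / I.length) ^ 3)⁻¹
      = ((1 + Metric.infDist x I.toSet / I.length)⁻¹) ^ 3 := by rw [inv_pow]
    _ ≤ (2 * decay I.k x (node I.k I.j)) ^ 3 := by
        have := I.length_pos
        gcongr
    _ = _ := by ring

theorem IsAdapted.norm_le (h : IsAdapted C I φ) (x : UnitAddCircle) :
    ‖φ x‖ ≤ 8 * C 3 * decay I.k x (node I.k I.j) ^ 3 := by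
  have hC := h.const_pos 3 (by norm_num)
  refine (h.bound 3 (by norm_num) x).trans ?_
  calc _ ≤ C 3 * (8 * decay I.k x (node I.k I.j) ^ 3) := by
        gcongr; exact one_add_div_length_inv_pow_le I x
    _ = _ := by ring

theorem IsAdapted.norm_deriv_le (h : IsAdapted C I φ) (t : ℝ) :
    ‖deriv (periodicLift φ) t‖ ≤ 8 * C 3 * 2 ^ I.k * decay I.k t (node I.k I.j) ^ 3 := by
  have hC := h.const_pos 3 (by norm_num)
  refine (h.deriv_bound 3 (by norm_num) t).trans ?_
  have hl : 1 / I.length = 2 ^ I.k := by unfold DyadicInterval.length; simp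
  rw [hl]
  calc _ ≤ C 3 * 2 ^ I.k * (8 * decay I.k t (node I.k I.j) ^ 3) := by
        gcongr; exact one_add_div_length_inv_pow_le I t
    _ = _ := by ring

theorem decay_cube_le_sq (k : ℕ) (x c : UnitAddCircle) : decay k x c ^ 3 ≤ decay k x c ^ 2 :=
  pow_le_pow_of_le_one (decay_pos _ _ _).le (decay_le_one _ _ _) (by norm_num)

/-- Points within `2⁻ᵏ`: the mean value inequality along the short arc, where the decay factor
varies by at most `2`, so `64 = 8 · 2³`. Points farther apart: `2ᵏ dist x y ≥ 1`, and the size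
bounds suffice. -/
theorem IsAdapted.norm_sub_le (h : IsAdapted C I φ) (x y : UnitAddCircle) :
    ‖φ x - φ y‖ ≤ 64 * C 3 * 2 ^ I.k * dist x y *
      (decay I.k x (node I.k I.j) ^ 2 + decay I.k y (node I.k I.j) ^ 2) := by
  have hC := h.const_pos 3 (by norm_num)
  have hk : (0 : ℝ) < 2 ^ I.k := by positivity
  set c := node I.k I.j with hc
  have hdx := (decay_pos I.k x c).le
  have hdy := (decay_pos I.k y c).le
  rcases le_total (dist x y) (2 ^ I.k)⁻¹ with hd | hd
  · obtain ⟨s, t, rfl, rfl, hst⟩ := exists_coe_eq_abs_sub_eq_dist x y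
    have hder : ∀ u ∈ segment ℝ s t,
        ‖deriv (periodicLift φ) u‖ ≤ 64 * C 3 * 2 ^ I.k * decay I.k (s : UnitAddCircle) c ^ 2 := by
      intro u hu
      have hus : |u - s| ≤ |s - t| := by
        rw [segment_eq_uIcc] at hu
        rw [abs_sub_comm s t]
        exact Set.abs_sub_left_of_mem_uIcc hu
      have hdist : dist (u : UnitAddCircle) (s : UnitAddCircle) ≤ (2 ^ I.k)⁻¹ :=
        (dist_coe_le u s).trans ((hus.trans_eq hst).trans hd)
      have h1 : decay I.k (u : UnitAddCircle) c ≤ 2 * decay I.k (s : UnitAddCircle) c := by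
        rw [decay_comm, decay_comm _ (s : UnitAddCircle)]
        exact decay_le_two_mul hdist
      have h0 := (decay_pos I.k (u : UnitAddCircle) c).le
      calc _ ≤ 8 * C 3 * 2 ^ I.k * decay I.k u c ^ 3 := h.norm_deriv_le u
        _ ≤ 8 * C 3 * 2 ^ I.k * (2 * decay I.k s c) ^ 3 := by gcongr
        _ = 64 * C 3 * 2 ^ I.k * decay I.k s c ^ 3 := by ring
        _ ≤ _ := by gcongr 64 * C 3 * 2 ^ I.k * ?_; exact decay_cube_le_sq _ _ _
    have hmv := (convex_segment s t).norm_image_sub_le_of_norm_deriv_le (𝕜 := ℝ)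
      (f := periodicLift φ)
      (fun u _ => (h.smooth.differentiable (by simp)).differentiableAt) hder
      (right_mem_segment ℝ s t) (left_mem_segment ℝ s t)
    calc ‖φ (s : UnitAddCircle) - φ (t : UnitAddCircle)‖
        ≤ 64 * C 3 * 2 ^ I.k * decay I.k (s : UnitAddCircle) c ^ 2 * ‖s - t‖ := hmv
      _ = 64 * C 3 * 2 ^ I.k * dist (s : UnitAddCircle) (t : UnitAddCircle)
            * decay I.k (s : UnitAddCircle) c ^ 2 := by
          rw [Real.norm_eq_abs, hst]; ring
      _ ≤ _ := by gcongr; exact le_add_of_nonneg_right (by positivity)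
  · have h1 : 1 ≤ 2 ^ I.k * dist x y := by
      calc (1 : ℝ) = 2 ^ I.k * (2 ^ I.k)⁻¹ := by field_simp
        _ ≤ _ := by gcongr
    calc ‖φ x - φ y‖ ≤ ‖φ x‖ + ‖φ y‖ := _root_.norm_sub_le _ _
      _ ≤ 8 * C 3 * decay I.k x c ^ 3 + 8 * C 3 * decay I.k y c ^ 3 :=
          add_le_add (h.norm_le x) (h.norm_le y)
      _ ≤ 8 * C 3 * decay I.k x c ^ 2 + 8 * C 3 * decay I.k y c ^ 2 := by
          gcongr 8 * C 3 * ?_ + 8 * C 3 * ?_ <;> exact decay_cube_le_sq _ _ _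
      _ = 8 * C 3 * 1 * (decay I.k x c ^ 2 + decay I.k y c ^ 2) := by ring
      _ ≤ 64 * C 3 * (2 ^ I.k * dist x y) * (decay I.k x c ^ 2 + decay I.k y c ^ 2) := by
          gcongr
          norm_num
      _ = _ := by ring

theorem IsAdapted.continuous (h : IsAdapted C I φ) : Continuous φ := by
  have hC := h.const_pos 3 (by norm_num)
  have hL : LipschitzWith (64 * C 3 * 2 ^ I.k * 2).toNNReal φ := by
    refine LipschitzWith.of_dist_le_mul fun x y => ?_
    rw [dist_eq_norm, Real.coe_toNNReal _ (by positivity)]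
    refine (h.norm_sub_le x y).trans ?_
    have h1 : decay I.k x (node I.k I.j) ^ 2 ≤ 1 :=
      pow_le_one₀ (decay_pos _ _ _).le (decay_le_one _ _ _)
    have h2 : decay I.k y (node I.k I.j) ^ 2 ≤ 1 :=
      pow_le_one₀ (decay_pos _ _ _).le (decay_le_one _ _ _)
    calc _ ≤ 64 * C 3 * 2 ^ I.k * dist x y * (1 + 1) := by gcongr
      _ = _ := by ring
  exact hL.continuous

/-- A family over the dyadic intervals as a family indexed by scale and position. -/
noncomputable def scaleFamily (φ : DyadicInterval → UnitAddCircle → ℂ) (k j : ℕ) :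
    UnitAddCircle → ℂ :=
  -- The value `0` at scale zero and at out-of-range positions satisfies every kernel condition and
  -- contributes nothing, so sums may run over all pairs.
  if h : 1 ≤ k ∧ j < 2 ^ k then φ ⟨k, h.1, ⟨j, h.2⟩⟩ else 0

theorem scaleFamily_apply (φ : DyadicInterval → UnitAddCircle → ℂ) (I : DyadicInterval) :
    scaleFamily φ I.k I.j = φ I := by
  unfold scaleFamily
  rw [dif_pos ⟨I.one_le_k, I.j.2⟩]

theorem IsZeroMeanAdaptedFamily.isKernelFamily {φ : DyadicInterval → UnitAddCircle → ℂ}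
    (h : IsZeroMeanAdaptedFamily C φ) : IsKernelFamily (64 * C 3).toNNReal (scaleFamily φ) := by
  have key : ∀ k j, scaleFamily φ k j = 0 ∨ ∃ I : DyadicInterval, I.k = k ∧ (I.j : ℕ) = j ∧
      scaleFamily φ k j = φ I := by
    intro k j
    by_cases hkj : 1 ≤ k ∧ j < 2 ^ k
    · exact Or.inr ⟨⟨k, hkj.1, ⟨j, hkj.2⟩⟩, rfl, rfl, dif_pos hkj⟩
    · exact Or.inl (dif_neg hkj)
  refine ⟨fun k j => ?_, fun k j x => ?_, fun k j x y => ?_, fun k j => ?_⟩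
  all_goals rcases key k j with h0 | ⟨I, rfl, hj, hI⟩
  · rw [h0]; exact continuous_const
  · rw [hI]; exact (h.adapted I).continuous
  · have := decay_pos k x (node k j)
    rw [h0, Pi.zero_apply, norm_zero]; positivity
  · have hC := (h.adapted I).const_pos 3 (by norm_num)
    have := decay_pos I.k x (node I.k I.j)
    rw [hI, ← hj, Real.coe_toNNReal _ (by positivity)]
    refine ((h.adapted I).norm_le x).trans ?_
    gcongr
    norm_num
  · have := decay_pos k x (node k j)
    have := decay_pos k y (node k j)
    rw [h0, Pi.zero_apply, Pi.zero_apply, sub_zero, norm_zero]; positivity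
  · have hC := (h.adapted I).const_pos 3 (by norm_num)
    rw [hI, ← hj, Real.coe_toNNReal _ (by positivity)]
    exact (h.adapted I).norm_sub_le x y
  · rw [h0]; simp
  · rw [hI]; exact h.zero_mean I

/-! ### Identification of the square function and conclusion -/

theorem injective_index :
    Function.Injective fun I : DyadicInterval => ((I.k, (I.j : ℕ)) : ℕ × ℕ) := by
  rintro ⟨k, hk, j⟩ ⟨l, hl, i⟩ h
  simp only [Prod.mk.injEq] at h
  obtain ⟨rfl, h2⟩ := h
  simp only [DyadicInterval.mk.injEq, heq_eq_eq, true_and]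
  exact Fin.ext h2

instance : Countable DyadicInterval := injective_index.countable

/-- The squared normalisation `|I|⁻¹` and the division by `|I|` combine to `(2ᵏ)²`. -/
theorem enorm_pairing_sq_div_length (φ : DyadicInterval → UnitAddCircle → ℂ)
    (f : UnitAddCircle → ℂ) (I : DyadicInterval) :
    ‖pairing (normalized φ I) f‖ₑ ^ 2 / ENNReal.ofReal I.length
      = coeff (scaleFamily φ) f I.k I.j ^ 2 := by
  have hl := I.length_pos
  have e : pairing (normalized φ I) f
      = ((I.length ^ (-(1 / 2) : ℝ) : ℝ) : ℂ) * ∫ x, φ I x * conj (f x) := by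
    unfold pairing normalized
    simp_rw [mul_assoc]
    rw [integral_const_mul]
  have hn : ‖((I.length ^ (-(1 / 2) : ℝ) : ℝ) : ℂ)‖ₑ ^ 2 = 2 ^ I.k := by
    rw [← ofReal_norm, Complex.norm_real, Real.norm_of_nonneg (by positivity),
      ← ENNReal.ofReal_pow (by positivity), ← Real.rpow_mul_natCast hl.le]
    norm_num
    rw [Real.rpow_neg_one, DyadicInterval.length, inv_inv, ENNReal.ofReal_pow (by norm_num)]
    simp
  have hL : ENNReal.ofReal I.length = (2 ^ I.k)⁻¹ := ofReal_two_pow_inv I.k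
  rw [e, enorm_mul, mul_pow, hn, hL, ENNReal.div_eq_inv_mul, inv_inv, coeff, scaleFamily_apply]
  ring

/-- There are countably many intervals, so outside one null set closed intervals and cells have the
same members; then each generation contributes exactly one cell. -/
theorem squareFunction_ae_eq (φ : DyadicInterval → UnitAddCircle → ℂ) (f : UnitAddCircle → ℂ) :
    squareFunction φ f =ᵐ[volume] fun x => (∑' k, sqTerm (scaleFamily φ) f k x) ^ (1 / 2 : ℝ) := by
  have hae : ∀ᵐ x, ∀ I : DyadicInterval, x ∈ I.toSet ↔ x ∈ cell I.k I.j :=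
    ae_all_iff.2 fun I => Filter.Eventually.mono (toSet_ae_eq_cell I) fun x hx => iff_of_eq hx
  filter_upwards [hae] with x hx
  unfold squareFunction
  congr 1
  classical
  set G : ℕ × ℕ → ℝ≥0∞ := fun p =>
    if cellIndex p.1 x = p.2 then coeff (scaleFamily φ) f p.1 p.2 ^ 2 else 0 with hG
  have h1 : ∀ I : DyadicInterval, I.toSet.indicator
      (fun _ => ‖pairing (normalized φ I) f‖ₑ ^ 2 / ENNReal.ofReal I.length) x
      = G (I.k, (I.j : ℕ)) := by
    intro I
    rw [hG]
    by_cases hI : x ∈ I.toSet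
    · rw [Set.indicator_of_mem hI, enorm_pairing_sq_div_length]
      exact (if_pos ((hx I).1 hI)).symm
    · rw [Set.indicator_of_notMem hI]
      exact (if_neg fun hc => hI ((hx I).2 hc)).symm
  simp_rw [h1]
  have hsupp : Function.support G ⊆ Set.range fun I : DyadicInterval => (I.k, (I.j : ℕ)) := by
    rintro ⟨k, j⟩ hkj
    by_contra hcon
    refine hkj ?_
    have hz : scaleFamily φ k j = 0 := by
      refine dif_neg fun hc => hcon ⟨⟨k, hc.1, ⟨j, hc.2⟩⟩, rfl⟩
    simp [hG, coeff, hz]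
  rw [injective_index.tsum_eq hsupp, ENNReal.tsum_prod (f := fun k j => G (k, j))]
  refine tsum_congr fun k => ?_
  rw [tsum_eq_single (cellIndex k x)]
  · simp [hG, sqTerm]
  · intro j hj
    exact if_neg hj.symm

theorem squareFunction_congr_ae (φ : DyadicInterval → UnitAddCircle → ℂ)
    {f g : UnitAddCircle → ℂ} (hfg : f =ᵐ[volume] g) : squareFunction φ f = squareFunction φ g := by
  have : ∀ u, pairing u f = pairing u g := by
    intro u
    refine integral_congr_ae ?_
    filter_upwards [hfg] with x hx
    rw [hx]
  funext x
  unfold squareFunction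
  simp_rw [this]

/-- The square function of a kernel family is bounded on `L^p` for every `1 < p < ∞`. -/
theorem exists_lintegral_tsum_sqTerm_rpow_half_le (B : ℝ≥0) {p : ℝ} (hp : 1 < p) : ∃ K : ℝ≥0,
    ∀ ψ, IsKernelFamily B ψ → ∀ f : UnitAddCircle → ℂ, Measurable f →
      MemLp f (ENNReal.ofReal p) →
      ∫⁻ x, (∑' k, sqTerm ψ f k x) ^ (p / 2) ≤ K * ∫⁻ x, ‖f x‖ₑ ^ p := by
  rcases lt_trichotomy p 2 with h2 | rfl | h2
  · obtain ⟨K, hK⟩ := exists_lintegral_tsum_sqTerm_rpow_le_of_lt_two B hp h2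
    refine ⟨K, fun ψ h f hfm hf => hK ψ h f hfm (hf.integrable ?_)⟩
    rw [ENNReal.one_le_ofReal]; exact hp.le
  · obtain ⟨K, hK⟩ := exists_lintegral_tsum_sqTerm_le B
    refine ⟨K, fun ψ h f _ hf => ?_⟩
    have := hK ψ h f (by simpa using hf)
    simpa using this
  · obtain ⟨K, hK⟩ := exists_lintegral_tsum_sqTerm_rpow_le B (q := p / 2) (by linarith)
    refine ⟨K, fun ψ h f hfm hf => ?_⟩
    have hf2 : MemLp f 2 := hf.mono_exponent (by
      rw [show (2 : ℝ≥0∞) = ENNReal.ofReal 2 by simp]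
      exact ENNReal.ofReal_le_ofReal h2.le)
    refine (hK ψ h f hfm hf2).trans_eq ?_
    congr 1
    refine lintegral_congr fun x => ?_
    rw [← ENNReal.rpow_natCast, ← ENNReal.rpow_mul]
    congr 1
    push_cast
    ring

end LittlewoodPaley

theorem mainTheorem7 (p : ℝ≥0∞) (hp : 1 < p) (hp_top : p < ⊤) (C : ℕ → ℝ) :
    ∃ K : ℝ≥0, ∀ φ : LittlewoodPaley.DyadicInterval → UnitAddCircle → ℂ,
      LittlewoodPaley.IsZeroMeanAdaptedFamily C φ →
      ∀ f : UnitAddCircle → ℂ, MemLp f p volume →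
        MemLp (LittlewoodPaley.squareFunction φ f) p volume ∧
        eLpNorm (LittlewoodPaley.squareFunction φ f) p volume ≤ K * eLpNorm f p volume := by
  have hp0 : p ≠ 0 := (zero_lt_one.trans hp).ne'
  have hr : 1 < p.toReal := by
    rw [← ENNReal.toReal_one]
    exact (ENNReal.toReal_lt_toReal (by simp) hp_top.ne).2 hp
  have hr0 : 0 < p.toReal := by linarith
  obtain ⟨K, hK⟩ := LittlewoodPaley.exists_lintegral_tsum_sqTerm_rpow_half_le
    (64 * C 3).toNNReal hr
  refine ⟨K ^ (1 / p.toReal), fun φ hφ f hf => ?_⟩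
  have hmeas : AEStronglyMeasurable (LittlewoodPaley.squareFunction φ f) volume := by
    refine AEMeasurable.aestronglyMeasurable ⟨_, ?_, LittlewoodPaley.squareFunction_ae_eq φ f⟩
    exact (Measurable.tsum fun k => LittlewoodPaley.measurable_sqTerm _ f k).pow_const _
  have hle : eLpNorm (LittlewoodPaley.squareFunction φ f) p volume
      ≤ (K ^ (1 / p.toReal) : ℝ≥0) * eLpNorm f p volume := by
    -- The kernel estimates are for Borel functions, while the square function depends only on the
    -- almost-everywhere class of `f`.
    obtain ⟨g, hg, hfg⟩ := hf.aestronglyMeasurable.aemeasurable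
    have hgp : MemLp g p volume := (memLp_congr_ae hfg).1 hf
    rw [LittlewoodPaley.squareFunction_congr_ae φ hfg, eLpNorm_congr_ae hfg,
      eLpNorm_congr_ae (LittlewoodPaley.squareFunction_ae_eq φ g),
      eLpNorm_eq_lintegral_rpow_enorm_toReal hp0 hp_top.ne,
      eLpNorm_eq_lintegral_rpow_enorm_toReal hp0 hp_top.ne,
      ENNReal.coe_rpow_of_nonneg _ (by positivity), ← ENNReal.mul_rpow_of_nonneg _ _ (by positivity)]
    refine ENNReal.rpow_le_rpow ?_ (by positivity)
    refine le_trans (le_of_eq ?_) (hK _ hφ.isKernelFamily g hg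
      (by rwa [ENNReal.ofReal_toReal hp_top.ne]))
    refine lintegral_congr fun x => ?_
    rw [enorm_eq_self, ← ENNReal.rpow_mul]
    congr 1
    ring
  exact ⟨⟨hmeas, hle.trans_lt (ENNReal.mul_lt_top ENNReal.coe_lt_top hf.2)⟩, hle⟩
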